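/- Let $X$ be a complex Banach space. A linear operator $A:D(A)\subset X\to X$ (not necessarily densely defined) is called sectorial if there are $\omega\in\mathbb R$, $\theta\in(\pi/2,\pi)$ and $M$ such that every $\lambda\neq\omega$ with $|\arg(\lambda-\omega)|<\theta$ belongs to the resolvent set of $A$ and satisfies $\|(\lambda-A)^{-1}\|\le M/|\lambda-\omega|$. It then generates an analytic semigroup, given by $\mathrm e^{0A}=I$ and, for $t>0$, by the Dunford integral $$\mathrm e^{tA}=\frac1{2\pi \mathrm i}\int_\Gamma \mathrm e^{t\lambda}(\lambda-A)^{-1}\,\mathrm d\lambda ,$$ where $\Gamma$ is a curve in this sector from $\infty\,\mathrm e^{-\mathrm i\eta}$ to $\infty\,\mathrm e^{\mathrm i\eta}$, with $\eta\in(\pi/2,\theta)$. For $k\ge1$ put $$\varphi_k(tA)=\int_0^1\frac{\xi^{k-1}}{(k-1)!}\,\mathrm e^{(1-\xi)tA}\,\mathrm d\xi .$$ For $0<\alpha<1$ and $1\le p\le\infty$ let $D_A(\alpha,p)$ be the space of all $x\in X$ for which $v(t)=\|t^{1-\alpha-1/p}A\mathrm e^{tA}x\|$ belongs to $L^p(0,1)$,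 with norm $\|x\|+\|v\|_{L^p(0,1)}$, and let $D_A(0,p)=X$ with the norm of $X$. The domain $D(A)$ carries the graph norm $\|x\|+\|Ax\|$. Let $A_1$ and $A_2$ be sectorial operators in $X$ whose semigroups commute, that is, $\mathrm e^{tA_1}\mathrm e^{tA_2}=\mathrm e^{tA_2}\mathrm e^{tA_1}$ for all $t\ge0$. Let $A$ be a sectorial operator that realizes the sum $A_1+A_2$, in the sense that $D(A_1)\cap D(A_2)\subset D(A)$ and $Ax=A_1x+A_2x$ for all $x\in D(A_1)\cap D(A_2)$; write $\varphi_k(t(A_1+A_2))=\varphi_k(tA)$. Let $k\ge1$, $T>0$ and $$\Delta_k(t)=\varphi_k(t(A_1+A_2))-k!\,\varphi_k(tA_1)\varphi_k(tA_2).$$ (a) For all $0\le\beta_1,\beta_2<1$ there is a constant $C$ such that for all $0<t\le T$ the operator $\Delta_k(t)$ maps $D_{A_1}(\beta_1,\infty)$ into $D_A(\beta_2,1)$ and $$\|\Delta_k(t)x\|_{D_A(\beta_2,1)}\le C\,t^{\beta_1-\beta_2}\,\|x\|_{D_{A_1}(\beta_1,\infty)}\quad\text{for all }x\in D_{A_1}(\beta_1,\infty).$$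 (b) For all $0\le\beta_2<1$ there is a constant $C$ such that for all $0<t\le T$ the operator $\Delta_k(t)$ maps $D(A_1)$ into $D_A(\beta_2,1)$ and $$\|\Delta_k(t)x\|_{D_A(\beta_2,1)}\le C\,t^{1-\beta_2}\,\bigl(\|x\|+\|A_1x\|\bigr)\quad\text{for all }x\in D(A_1).$$ In both parts $C$ may depend on $k$, $T$, the operators and the exponents, but not on $t$ or $x$. -/

import Mathlib

open scoped ENNReal

noncomputable section

namespace SplitPhi

variable {X : Type*} [NormedAddCommGroup X] [NormedSpace ℂ X]

/-- `R` is the bounded two-sided inverse of `z - A : D(A) → X`. -/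
def IsResolventAt (A : X →ₗ.[ℂ] X) (z : ℂ) (R : X →L[ℂ] X) : Prop :=
  (∀ y : X, ∃ h : R y ∈ A.domain, z • R y - A ⟨R y, h⟩ = y) ∧
    ∀ x : A.domain, R (z • (x : X) - A x) = x

/-- The resolvent set of the (possibly unbounded, possibly not densely defined) operator `A`. -/
def resolventSet (A : X →ₗ.[ℂ] X) : Set ℂ :=
  {z | ∃ R : X →L[ℂ] X, IsResolventAt A z R}

open Classical in
/-- The resolvent `R(z, A) = (z - A)⁻¹` for `z` in the resolvent set (and `0` elsewhere). -/
def resolvent (A : X →ₗ.[ℂ] X) (z : ℂ) : X →L[ℂ] X :=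
  if h : z ∈ resolventSet A then Classical.choose h else 0

/-- `A` is sectorial with vertex `ω`, angle `θ ∈ (π/2, π)` and constant `M`: the resolvent set
contains the sector `{z ≠ ω, |arg (z - ω)| < θ}`, and `‖R(z, A)‖ ≤ M / |z - ω|` there. -/
structure IsSectorialWith (A : X →ₗ.[ℂ] X) (ω θ M : ℝ) : Prop where
  angle_gt : Real.pi / 2 < θ
  angle_lt : θ < Real.pi
  sector_subset : ∀ z : ℂ, z ≠ ω → |(z - ω).arg| < θ → z ∈ resolventSet A
  norm_resolvent_le : ∀ z : ℂ, z ≠ ω → |(z - ω).arg| < θ → ‖resolvent A z‖ ≤ M / ‖z - ω‖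

/-- `A` is sectorial; its domain need not be dense. -/
def IsSectorial (A : X →ₗ.[ℂ] X) : Prop :=
  ∃ ω θ : ℝ, ∃ M : ℝ, IsSectorialWith A ω θ M

/-- The Dunford integral `(2πi)⁻¹ ∫_Γ e^{tz} R(z, A) dz`, where `Γ` consists of the two rays
`{a + ρ e^{± iη} : ρ ≥ 0}` and runs from `∞ e^{-iη}` through `a` to `∞ e^{iη}`. -/
def dunford (A : X →ₗ.[ℂ] X) (a η t : ℝ) : X →L[ℂ] X :=
  (2 * Real.pi * Complex.I : ℂ)⁻¹ •
    ((∫ ρ in Set.Ioi (0 : ℝ),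
        (Complex.exp (t * (a + ρ * Complex.exp (η * Complex.I))) * Complex.exp (η * Complex.I)) •
          resolvent A (a + ρ * Complex.exp (η * Complex.I)))
      - ∫ ρ in Set.Ioi (0 : ℝ),
        (Complex.exp (t * (a + ρ * Complex.exp (-η * Complex.I))) *
            Complex.exp (-η * Complex.I)) •
          resolvent A (a + ρ * Complex.exp (-η * Complex.I)))

open Classical in
/-- The analytic semigroup `e^{tA}`, `t ≥ 0`, generated by a sectorial operator `A`:
`e^{0A} = 1`, and for `t > 0` the Dunford integral over a curve in a sector `(ω, θ)` on which `A`
satisfies the sectorial estimate, with opening angle `η = (π/2 + θ)/2 ∈ (π/2, θ)` and vertex `ω + 1`.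
(By Cauchy's theorem the value does not depend on the sector or on the curve.) -/
def semigroup (A : X →ₗ.[ℂ] X) (t : ℝ) : X →L[ℂ] X :=
  if h : IsSectorial A then
    if 0 < t then
      dunford A (h.choose + 1) ((Real.pi / 2 + h.choose_spec.choose) / 2) t
    else 1
  else 0

open Classical in
/-- The map `A`, extended by `0` outside `D(A)`. It is only used at points `e^{tA} x`, `t > 0`,
which lie in `D(A)`. -/
def app (A : X →ₗ.[ℂ] X) (x : X) : X :=
  if h : x ∈ A.domain then A ⟨x, h⟩ else 0

/-- The function `v(t) = ‖t^{1 - α - 1/p} A e^{tA} x‖`. -/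
def interpFun (A : X →ₗ.[ℂ] X) (α : ℝ) (p : ℝ≥0∞) (x : X) (t : ℝ) : ℝ :=
  ‖((t ^ (1 - α - (1 / p).toReal) : ℝ) : ℂ) • app A (semigroup A t x)‖

/-- Lebesgue measure on `(0, 1)`. -/
abbrev unitMeasure : MeasureTheory.Measure ℝ :=
  MeasureTheory.volume.restrict (Set.Ioo (0 : ℝ) 1)

/-- The real interpolation space `D_A(α, p)`, with `D_A(0, p) = X`. -/
def interpSpace (A : X →ₗ.[ℂ] X) (α : ℝ) (p : ℝ≥0∞) : Set X :=
  {x | α = 0 ∨ MeasureTheory.MemLp (interpFun A α p x) p unitMeasure}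

open Classical in
/-- The norm of `D_A(α, p)`: it is `‖x‖ + ‖v‖_{L^p(0,1)}` for `0 < α < 1`, and `‖x‖` for `α = 0`. -/
def interpNorm (A : X →ₗ.[ℂ] X) (α : ℝ) (p : ℝ≥0∞) (x : X) : ℝ :=
  if α = 0 then ‖x‖
  else ‖x‖ + (MeasureTheory.eLpNorm (interpFun A α p x) p unitMeasure).toReal

/-- The operator `φ_k(tA)`: `φ_0(tA) = e^{tA}` and
`φ_k(tA) = ∫_0^1 ξ^{k-1}/(k-1)! e^{(1-ξ)tA} dξ` for `k ≥ 1`. -/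
def phi (A : X →ₗ.[ℂ] X) : ℕ → ℝ → (X →L[ℂ] X)
  | 0, t => semigroup A t
  | k + 1, t => ∫ ξ in (0 : ℝ)..1,
      (((ξ ^ k / (k.factorial : ℝ) : ℝ)) : ℂ) • semigroup A ((1 - ξ) * t)

/-- The splitting defect `φ_k(tA) - k! φ_k(tA₁) φ_k(tA₂)`. -/
def defect (A₁ A₂ A : X →ₗ.[ℂ] X) (k : ℕ) (t : ℝ) : X →L[ℂ] X :=
  phi A k t - (k.factorial : ℂ) • (phi A₁ k t ∘L phi A₂ k t)

end SplitPhi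

end

/-! Write `S`, `T`, `P` for the semigroups of `A₁`, `A₂`, `A`, with a prime for the derivative in
time, so that `P' s = A P(s)`, and put `τ = (1 - ξ) t`. Let `y = Δ_k(t) x`. It suffices to find `E`
with `‖y‖ ≤ E` and `‖P'(s) y‖ ≤ E / t` for `0 < s ≤ t`. For `s > t` analyticity gives `‖P'(s) y‖ ≤ N
E / s`, and splitting `∫ s^{-β₂} ‖P'(s) y‖ ds` at `s = t` bounds the norm of `y` in `D_A(β₂, 1)` by
`C t^{-β₂} E` (`exists_interpNorm_le`). So `E` must be a constant times `t^b` times the norm of `x`,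
with `b = β₁` in (a) and `b = 1` in (b).

If `b = 0`, integration by parts in `ξ` shows that `φ_k(tA)` maps into `D(A)` with `‖A φ_k(tA)‖ ≤ C
/ t`, and likewise for `A₁` and `A₂` (`norm_defectOf_le_rough`).

If `b > 0`, regularity of `x` enters only as `‖S'(r) x‖ ≤ K r^{b-1}`, which integrates to `‖S(r) x -
x‖ ≤ K r^b / b`. The weight `ξ^{k-1}/(k-1)!` has mass `1/k!`, so on replacing `S(τ) x` by `x` the
two terms of the defect cancel. Hence the defect can be written with `S(τ) x - x` in place of `S(τ)
x`, and this is `O(t^b)`. For `P'(s) y = S'(s) T(s) y + S(s) T'(s) y` the first term is estimated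
with the derivative falling on `x`, which costs `τ^{b-1}`; in the integral part of the second term,
`T'(s + τ) = O(1/τ)` meets `S(τ) x - x = O(τ^b)` (`norm_defectOf_le_smooth`). Both singularities are
integrable.

All this needs `P = S T` on the vectors involved. The domains need not be dense, so this is shown as
`P(t) S(ε) = S(t) T(t) S(ε)` and then on the closure of `D(A₁)` (`semigroup_apply_range`,
`semigroup_apply_of_tendsto`). The curve `w(r) = S(r + ε) T(r) x` solves `w' = A w`, so `P(t - r)
w(r)` is constant; its end values are identified after applying the resolvent of `A`, which is
injective.

The facts about one semigroup come from the Dunford integral by Cauchy's theorem, scaling and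
Hankel's integral, and are collected in `IsAnalyticSemigroup`. -/

noncomputable section

namespace SplitPhi

open MeasureTheory Set Filter Topology

/-! ### Exponential contour integrals over two rays, and Cauchy's theorem for them -/

section Contour

variable {E : Type*} [NormedAddCommGroup E] [NormedSpace ℂ E]

/-- The integral of `F` along the ray `{a + ρ e : ρ > 0}`. -/
def ray (F : ℂ → E) (a e : ℂ) : E := ∫ ρ in Ioi (0 : ℝ), e • F (a + ρ * e)

/-- The difference of the integrals over the rays from `a` in the directions `e^{± iη}`. -/
def wedge (F : ℂ → E) (a : ℂ) (η : ℝ) : E :=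
  ray F a (Complex.exp (η * Complex.I)) - ray F a (Complex.exp (-η * Complex.I))

/-- The open sector of half-angle `θ` about the positive real axis. -/
def sector (θ : ℝ) : Set ℂ := {w | w ≠ 0 ∧ |w.arg| < θ}

/-- Cauchy's theorem through a primitive: each truncated ray integral is an increment of `G`, and
the segment joining the two truncation points changes `G` by at most `δ ρ`, by the mean value
inequality. Convexity keeps that segment inside `U`. -/
theorem ray_sub_ray [CompleteSpace E] {F G : ℂ → E} {U : Set ℂ} (hF : ContinuousOn F U)
    (hU : Convex ℝ U)
    (hG : ∀ z ∈ U, HasDerivAt G (F z) z) {a b e e' : ℂ}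
    (ha : ∀ ρ : ℝ, 0 ≤ ρ → a + ρ * e ∈ U) (hb : ∀ ρ : ℝ, 0 ≤ ρ → b + ρ * e' ∈ U)
    (hia : IntegrableOn (fun ρ : ℝ => e • F (a + ρ * e)) (Ioi 0))
    (hib : IntegrableOn (fun ρ : ℝ => e' • F (b + ρ * e')) (Ioi 0))
    {δ : ℝ → ℝ} (hδ : Tendsto δ atTop (𝓝 0))
    (hbd : ∀ᶠ ρ : ℝ in atTop, ∀ z ∈ segment ℝ (a + ρ * e) (b + ρ * e'),
      ‖F z‖ * ‖(b + ρ * e') - (a + ρ * e)‖ ≤ δ ρ) :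
    ray F a e - ray F b e' = G b - G a := by
  have key : ∀ (a e : ℂ), (∀ ρ : ℝ, 0 ≤ ρ → a + ρ * e ∈ U) →
      IntegrableOn (fun ρ : ℝ => e • F (a + ρ * e)) (Ioi 0) →
      Tendsto (fun ρ : ℝ => G (a + ρ * e)) atTop (𝓝 (ray F a e + G a)) := by
    intro a e ha hia
    have h1 := intervalIntegral_tendsto_integral_Ioi (0 : ℝ) hia tendsto_id
    have h2 : ∀ᶠ ρ : ℝ in atTop,
        (∫ x in (0 : ℝ)..id ρ, e • F (a + x * e)) + G a = G (a + ρ * e) := by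
      filter_upwards [eventually_ge_atTop 0] with ρ hρ
      have hd : ∀ x ∈ uIcc (0 : ℝ) ρ,
          HasDerivAt (fun x : ℝ => G (a + x * e)) (e • F (a + x * e)) x := by
        intro x hx
        rw [uIcc_of_le hρ] at hx
        have h3 : HasDerivAt (fun x : ℝ => a + (x : ℂ) * e) e x := by
          simpa using ((Complex.ofRealCLM.hasDerivAt (x := x)).mul_const e).const_add a
        exact (hG _ (ha x hx.1)).scomp x h3
      have hc : IntervalIntegrable (fun x : ℝ => e • F (a + x * e)) volume 0 ρ := by
        apply ContinuousOn.intervalIntegrable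
        rw [uIcc_of_le hρ]
        refine ContinuousOn.const_smul ?_ _
        refine hF.comp (by fun_prop) fun x hx => ha x hx.1
      have := intervalIntegral.integral_eq_sub_of_hasDerivAt hd hc
      simp only [id]
      rw [this]; simp
    exact (h1.add_const (G a)).congr' h2
  have h1 := key a e ha hia
  have h2 := key b e' hb hib
  have h3 : Tendsto (fun ρ : ℝ => G (b + ρ * e') - G (a + ρ * e)) atTop (𝓝 0) := by
    refine squeeze_zero_norm' ?_ hδ
    filter_upwards [hbd, eventually_ge_atTop 0] with ρ hρ h0
    have hseg : segment ℝ (a + ρ * e) (b + ρ * e') ⊆ U := hU.segment_subset (ha ρ h0) (hb ρ h0)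
    by_cases hne : ‖(b + ρ * e') - (a + ρ * e)‖ = 0
    · have : b + ρ * e' = a + ρ * e := sub_eq_zero.1 (norm_eq_zero.1 hne)
      have h5 := hρ _ (left_mem_segment ℝ _ _)
      rw [hne, mul_zero] at h5
      rw [this]; simpa using h5
    · have hpos : 0 < ‖(b + ρ * e') - (a + ρ * e)‖ := lt_of_le_of_ne (norm_nonneg _) (Ne.symm hne)
      have := (convex_segment (𝕜 := ℝ) (a + ρ * e) (b + ρ * e')).norm_image_sub_le_of_norm_hasDerivWithin_le
        (f := G) (f' := F) (C := δ ρ / ‖(b + ρ * e') - (a + ρ * e)‖)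
        (fun z hz => (hG z (hseg hz)).hasDerivWithinAt)
        (fun z hz => by rw [le_div_iff₀ hpos]; exact hρ z hz)
        (left_mem_segment ℝ _ _) (right_mem_segment ℝ _ _)
      rwa [div_mul_cancel₀ _ hne] at this
  have h4 := tendsto_nhds_unique h3 (h2.sub h1)
  have : ray F a e - ray F b e' - (G b - G a) = -(ray F b e' + G b - (ray F a e + G a)) := by abel
  rw [← sub_eq_zero, this, ← h4, neg_zero]

theorem mem_sector_of_im_neg {θ : ℝ} (h1 : Real.pi / 2 < θ) (h2 : θ < Real.pi) {w : ℂ}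
    (hw : (w * Complex.exp (-θ * Complex.I)).im < 0) : w ∈ sector θ := by
  have h0 : w ≠ 0 := by rintro rfl; simp at hw
  refine ⟨h0, ?_⟩
  have hn : 0 < ‖w‖ := norm_pos_iff.2 h0
  have h3 : (w * Complex.exp (-θ * Complex.I)) =
      ‖w‖ * Complex.exp ((w.arg - θ : ℝ) * Complex.I) := by
    nth_rw 1 [← Complex.norm_mul_exp_arg_mul_I w]
    rw [mul_assoc, ← Complex.exp_add]; push_cast; ring_nf
  rw [h3, Complex.im_ofReal_mul, Complex.exp_ofReal_mul_I_im] at hw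
  have hs : Real.sin (w.arg - θ) < 0 := by
    by_contra h; push Not at h; nlinarith [mul_nonneg hn.le h]
  have ha1 := Complex.neg_pi_lt_arg w
  have ha2 := Complex.arg_le_pi w
  rw [abs_lt]
  constructor
  · by_contra h
    push Not at h
    have : 0 ≤ Real.sin (w.arg - θ + 2 * Real.pi) :=
      Real.sin_nonneg_of_nonneg_of_le_pi (by linarith) (by linarith)
    rw [Real.sin_add_two_pi] at this
    linarith
  · by_contra h
    push Not at h
    have : 0 ≤ Real.sin (w.arg - θ) :=
      Real.sin_nonneg_of_nonneg_of_le_pi (by linarith) (by linarith)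
    linarith

theorem conj_mem_sector {θ : ℝ} (h2 : θ < Real.pi) {w : ℂ}
    (hw : (starRingEnd ℂ) w ∈ sector θ) : w ∈ sector θ := by
  refine ⟨fun h => hw.1 (by simp [h]), ?_⟩
  have := hw.2
  rw [Complex.arg_conj] at this
  split_ifs at this with h
  · rw [abs_of_pos Real.pi_pos] at this; linarith
  · rwa [abs_neg] at this

theorem mem_sector_of_im_pos {θ : ℝ} (h1 : Real.pi / 2 < θ) (h2 : θ < Real.pi) {w : ℂ}
    (hw : 0 < (w * Complex.exp (θ * Complex.I)).im) : w ∈ sector θ := by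
  refine conj_mem_sector h2 (mem_sector_of_im_neg h1 h2 ?_)
  have : (starRingEnd ℂ) w * Complex.exp (-θ * Complex.I) =
      (starRingEnd ℂ) (w * Complex.exp (θ * Complex.I)) := by
    rw [map_mul, ← Complex.exp_conj]; simp
  rw [this, Complex.conj_im]; linarith

/-- The data of a pair of admissible directions. -/
structure IsAngle (η θ : ℝ) : Prop where
  gt : Real.pi / 2 < η
  lt : η < θ
  lt_pi : θ < Real.pi

variable {η θ : ℝ}

theorem IsAngle.cos_neg (h : IsAngle η θ) : Real.cos η < 0 :=
  Real.cos_neg_of_pi_div_two_lt_of_lt h.gt (by linarith [h.lt, h.lt_pi, Real.pi_pos])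

theorem IsAngle.sin_pos (h : IsAngle η θ) : 0 < Real.sin η :=
  Real.sin_pos_of_pos_of_lt_pi (by linarith [h.gt, Real.pi_pos]) (by linarith [h.lt, h.lt_pi])

theorem IsAngle.upper_mem (h : IsAngle η θ) {x ρ : ℝ} (hx : 0 < x) (hρ : 0 ≤ ρ) :
    (((x : ℂ) + ρ * Complex.exp (η * Complex.I)) * Complex.exp (-θ * Complex.I)).im < 0 := by
  have h1 : (((x : ℂ) + ρ * Complex.exp (η * Complex.I)) * Complex.exp (-θ * Complex.I)) =
      (x : ℂ) * Complex.exp ((-θ : ℝ) * Complex.I) +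
        (ρ : ℂ) * Complex.exp ((η - θ : ℝ) * Complex.I) := by
    rw [add_mul, mul_assoc (ρ : ℂ), ← Complex.exp_add]; push_cast; ring_nf
  rw [h1, Complex.add_im, Complex.im_ofReal_mul, Complex.im_ofReal_mul,
    Complex.exp_ofReal_mul_I_im, Complex.exp_ofReal_mul_I_im]
  have h2 : Real.sin (-θ) < 0 := by
    rw [Real.sin_neg]
    linarith [Real.sin_pos_of_pos_of_lt_pi (x := θ) (by linarith [h.gt, h.lt, Real.pi_pos]) h.lt_pi]
  have h3 : Real.sin (η - θ) < 0 :=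
    Real.sin_neg_of_neg_of_neg_pi_lt (by linarith [h.lt])
      (by linarith [h.gt, h.lt_pi, Real.pi_pos])
  nlinarith [mul_neg_of_pos_of_neg hx h2, mul_nonneg hρ (neg_nonneg.2 h3.le)]

theorem IsAngle.lower_mem (h : IsAngle η θ) {x ρ : ℝ} (hx : 0 < x) (hρ : 0 ≤ ρ) :
    0 < (((x : ℂ) + ρ * Complex.exp (-η * Complex.I)) * Complex.exp (θ * Complex.I)).im := by
  have h1 := h.upper_mem hx hρ
  have : ((x : ℂ) + ρ * Complex.exp (-η * Complex.I)) * Complex.exp (θ * Complex.I) =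
      (starRingEnd ℂ) (((x : ℂ) + ρ * Complex.exp (η * Complex.I)) *
        Complex.exp (-θ * Complex.I)) := by
    rw [map_mul, map_add, map_mul, ← Complex.exp_conj, ← Complex.exp_conj]; simp
  rw [this, Complex.conj_im]; linarith

/-- `e` is one of the two directions `e^{± iη}`. -/
def IsDir (η : ℝ) (e : ℂ) : Prop :=
  e = Complex.exp (η * Complex.I) ∨ e = Complex.exp (-η * Complex.I)

theorem isDir_pos (η : ℝ) : IsDir η (Complex.exp (η * Complex.I)) := Or.inl rfl
theorem isDir_neg (η : ℝ) : IsDir η (Complex.exp (-η * Complex.I)) := Or.inr rfl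

variable {e : ℂ}

theorem IsDir.norm_eq (h : IsDir η e) : ‖e‖ = 1 := by
  rcases h with rfl | rfl
  · exact Complex.norm_exp_ofReal_mul_I η
  · simpa using Complex.norm_exp_ofReal_mul_I (-η)

theorem IsDir.re_eq (h : IsDir η e) : e.re = Real.cos η := by
  rcases h with rfl | rfl
  · exact Complex.exp_ofReal_mul_I_re η
  · simpa using Complex.exp_ofReal_mul_I_re (-η)

theorem IsDir.abs_im_eq (h : IsDir η e) : |e.im| = |Real.sin η| := by
  rcases h with rfl | rfl
  · rw [Complex.exp_ofReal_mul_I_im η]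
  · have := Complex.exp_ofReal_mul_I_im (-η)
    push_cast at this
    rw [this, Real.sin_neg, abs_neg]

theorem IsDir.mem_sector (h : IsDir η e) (hη : IsAngle η θ) {x ρ : ℝ} (hx : 0 < x) (hρ : 0 ≤ ρ) :
    (x : ℂ) + ρ * e ∈ sector θ := by
  have h1 : Real.pi / 2 < θ := hη.gt.trans hη.lt
  rcases h with rfl | rfl
  · exact mem_sector_of_im_neg h1 hη.lt_pi (hη.upper_mem hx hρ)
  · exact mem_sector_of_im_pos h1 hη.lt_pi (hη.lower_mem hx hρ)

/-- `x sin η` is the distance from `-x` to the line through `0` in direction `e`; multiplication by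
the conjugate of `e` rotates that line onto the real axis. -/
theorem IsDir.le_norm_left (h : IsDir η e) (hη : IsAngle η θ) {x ρ : ℝ} (hx : 0 ≤ x) :
    x * Real.sin η ≤ ‖(x : ℂ) + ρ * e‖ := by
  have h1 : ‖((x : ℂ) + ρ * e) * (starRingEnd ℂ) e‖ = ‖(x : ℂ) + ρ * e‖ := by
    rw [norm_mul, Complex.norm_conj, h.norm_eq, mul_one]
  rw [← h1]
  refine le_trans ?_ (Complex.abs_im_le_norm _)
  have : (((x : ℂ) + ρ * e) * (starRingEnd ℂ) e).im = - (x * e.im) := by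
    simp [Complex.add_re, Complex.add_im]; ring
  rw [this, abs_neg, abs_mul, h.abs_im_eq, abs_of_nonneg hx, abs_of_pos hη.sin_pos]

theorem IsDir.le_norm_right (h : IsDir η e) (hη : IsAngle η θ) {x ρ : ℝ} (hρ : 0 ≤ ρ) :
    ρ * Real.sin η ≤ ‖(x : ℂ) + ρ * e‖ := by
  refine le_trans ?_ (Complex.abs_im_le_norm _)
  have : ((x : ℂ) + ρ * e).im = ρ * e.im := by simp
  rw [this, abs_mul, h.abs_im_eq, abs_of_nonneg hρ, abs_of_pos hη.sin_pos]

theorem IsDir.norm_exp (h : IsDir η e) (t x ρ : ℝ) :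
    ‖Complex.exp (t * ((x : ℂ) + ρ * e))‖ = Real.exp (t * x) * Real.exp (-(-(t * Real.cos η)) * ρ) := by
  rw [Complex.norm_exp, ← Real.exp_add]
  congr 1
  simp [h.re_eq]; ring

theorem exists_primitive [CompleteSpace E] {F : ℂ → E} {U : Set ℂ} (hU : Convex ℝ U)
    (hUo : IsOpen U) (hF : DifferentiableOn ℂ F U) :
    ∃ G : ℂ → E, ∀ z ∈ U, HasDerivAt G (F z) z := by
  obtain ⟨G, hG⟩ := hU.exists_forall_hasDerivWithinAt hF
  exact ⟨G, fun z hz => (hG z hz).hasDerivAt (hUo.mem_nhds hz)⟩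

theorem convex_im_mul_lt (c : ℂ) : Convex ℝ {w : ℂ | (w * c).im < 0} := by
  have : {w : ℂ | (w * c).im < 0} =
      ⇑(Complex.imLm ∘ₗ LinearMap.mulRight ℝ c) ⁻¹' Iio 0 := by
    ext w; simp
  rw [this]
  exact (convex_Iio 0).linear_preimage _

theorem convex_lt_im_mul (c : ℂ) : Convex ℝ {w : ℂ | 0 < (w * c).im} := by
  have : {w : ℂ | 0 < (w * c).im} =
      ⇑(Complex.imLm ∘ₗ LinearMap.mulRight ℝ c) ⁻¹' Ioi 0 := by
    ext w; simp
  rw [this]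
  exact (convex_Ioi 0).linear_preimage _

theorem exists_of_mem_segment {a b : ℝ} (hab : a ≤ b) {v z : ℂ}
    (hz : z ∈ segment ℝ ((a : ℂ) + v) ((b : ℂ) + v)) : ∃ x ∈ Icc a b, z = (x : ℂ) + v := by
  obtain ⟨s, t, hs, ht, hst, rfl⟩ := hz
  obtain rfl : s = 1 - t := by linarith
  refine ⟨(1 - t) * a + t * b, ⟨?_, ?_⟩, ?_⟩
  · nlinarith [mul_nonneg ht (sub_nonneg.2 hab)]
  · nlinarith [mul_nonneg hs (sub_nonneg.2 hab)]
  · simp only [Complex.real_smul]; push_cast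
    ring

/-- Each ray is moved separately inside its own half plane. Either move changes the integral by the
same `∫_a^b F` along the real axis, so the difference of the two rays is unchanged. -/
theorem wedge_translate [CompleteSpace E] {F : ℂ → E} (hη : IsAngle η θ)
    (hF : DifferentiableOn ℂ F (sector θ)) {a b : ℝ} (ha : 0 < a) (hab : a ≤ b)
    (hint : ∀ e, IsDir η e → ∀ x : ℝ, a ≤ x →
      IntegrableOn (fun ρ : ℝ => e • F (x + ρ * e)) (Ioi 0))
    {δ : ℝ → ℝ} (hδ : Tendsto δ atTop (𝓝 0))
    (hbd : ∀ e, IsDir η e → ∀ x ∈ Icc a b, ∀ ρ : ℝ, 0 ≤ ρ → ‖F (x + ρ * e)‖ ≤ δ ρ) :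
    wedge F a η = wedge F b η := by
  have h1 : Real.pi / 2 < θ := hη.gt.trans hη.lt
  have key : ∀ (U : Set ℂ), Convex ℝ U → IsOpen U → U ⊆ sector θ → ∀ e, IsDir η e →
      (∀ x ρ : ℝ, 0 < x → 0 ≤ ρ → (x : ℂ) + ρ * e ∈ U) →
      ray F a e - ray F b e = ∫ x in a..b, F x := by
    intro U hU hUo hUs e he hmem
    obtain ⟨G, hG⟩ := exists_primitive hU hUo (hF.mono hUs)
    have hb : 0 < b := ha.trans_le hab
    have hδ' : Tendsto (fun ρ => δ ρ * (b - a)) atTop (𝓝 0) := by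
      simpa using hδ.mul_const (b - a)
    rw [ray_sub_ray (hF.mono hUs).continuousOn hU hG (fun ρ h => hmem a ρ ha h)
      (fun ρ h => hmem b ρ hb h) (hint e he a le_rfl) (hint e he b hab) hδ']
    · symm
      apply intervalIntegral.integral_eq_sub_of_hasDerivAt (f := fun x : ℝ => G x)
      · intro x hx
        rw [uIcc_of_le hab] at hx
        have := hG x (by simpa using hmem x 0 (ha.trans_le hx.1) le_rfl)
        simpa [Function.comp_def] using this.scomp x (Complex.ofRealCLM.hasDerivAt (x := x))
      · apply ContinuousOn.intervalIntegrable
        rw [uIcc_of_le hab]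
        refine (hF.mono hUs).continuousOn.comp (by fun_prop) fun x hx => ?_
        simpa using hmem x 0 (ha.trans_le hx.1) le_rfl
    · filter_upwards [eventually_ge_atTop 0] with ρ hρ z hz
      obtain ⟨x, hx, rfl⟩ := exists_of_mem_segment hab hz
      have : ((b : ℂ) + ρ * e) - (a + ρ * e) = ((b - a : ℝ) : ℂ) := by push_cast; ring
      rw [this, Complex.norm_real, Real.norm_of_nonneg (by linarith)]
      exact mul_le_mul_of_nonneg_right (hbd e he x hx ρ hρ) (by linarith)
  have hu := key {w | (w * Complex.exp (-θ * Complex.I)).im < 0} (convex_im_mul_lt _)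
    (isOpen_lt (by fun_prop) continuous_const) (fun w hw => mem_sector_of_im_neg h1 hη.lt_pi hw)
    _ (isDir_pos η) (fun x ρ hx hρ => hη.upper_mem hx hρ)
  have hl := key {w | 0 < (w * Complex.exp (θ * Complex.I)).im} (convex_lt_im_mul _)
    (isOpen_lt continuous_const (by fun_prop)) (fun w hw => mem_sector_of_im_pos h1 hη.lt_pi hw)
    _ (isDir_neg η) (fun x ρ hx hρ => hη.lower_mem hx hρ)
  unfold wedge
  rw [← sub_eq_zero]
  rw [← sub_eq_zero] at hu hl
  rw [← sub_self (0 : E)]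
  nth_rw 1 [← hu]
  rw [← hl]
  abel

theorem integrableOn_exp_neg {b : ℝ} (hb : 0 < b) :
    IntegrableOn (fun ρ : ℝ => Real.exp (-b * ρ)) (Ioi 0) :=
  exp_neg_integrableOn_Ioi 0 hb

theorem integral_exp_neg {b : ℝ} (hb : 0 < b) :
    ∫ ρ in Ioi (0 : ℝ), Real.exp (-b * ρ) = b⁻¹ := by
  rw [integral_exp_mul_Ioi (by linarith)]
  simp [div_eq_mul_inv]

theorem integrableOn_expRay (he : IsDir η e) (hη : IsAngle η θ) {t : ℝ} (ht : 0 < t) (x : ℝ)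
    {H : ℝ → E} (hm : AEStronglyMeasurable H (volume.restrict (Ioi 0))) {B : ℝ}
    (hB : ∀ ρ, 0 < ρ → ‖H ρ‖ ≤ B) :
    IntegrableOn (fun ρ : ℝ => Complex.exp (t * (x + ρ * e)) • H ρ) (Ioi 0) := by
  have hb : 0 < -(t * Real.cos η) := by nlinarith [hη.cos_neg]
  refine Integrable.mono' ((integrableOn_exp_neg hb).const_mul (B * Real.exp (t * x))) ?_ ?_
  · refine AEStronglyMeasurable.smul ?_ hm
    exact Continuous.aestronglyMeasurable (by fun_prop)
  · filter_upwards [ae_restrict_mem measurableSet_Ioi] with ρ hρ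
    rw [norm_smul, he.norm_exp]
    have := hB ρ hρ
    calc _ ≤ Real.exp (t * x) * Real.exp (-(-(t * Real.cos η)) * ρ) * B := by gcongr
      _ = _ := by ring

theorem norm_integral_expRay_le (he : IsDir η e) (hη : IsAngle η θ) {t : ℝ} (ht : 0 < t) (x : ℝ)
    {H : ℝ → E} {B : ℝ} (hB : ∀ ρ, 0 < ρ → ‖H ρ‖ ≤ B) :
    ‖∫ ρ in Ioi (0 : ℝ), Complex.exp (t * (x + ρ * e)) • H ρ‖ ≤
      B * Real.exp (t * x) * (-(t * Real.cos η))⁻¹ := by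
  have hb : 0 < -(t * Real.cos η) := by nlinarith [hη.cos_neg]
  rw [← integral_exp_neg hb, ← integral_const_mul]
  refine norm_integral_le_of_norm_le ((integrableOn_exp_neg hb).const_mul _) ?_
  filter_upwards [ae_restrict_mem measurableSet_Ioi] with ρ hρ
  rw [norm_smul, he.norm_exp]
  have := hB ρ hρ
  calc _ ≤ Real.exp (t * x) * Real.exp (-(-(t * Real.cos η)) * ρ) * B := by gcongr
    _ = _ := by ring

theorem hasDerivAt_integral_expRay (he : IsDir η e) (hη : IsAngle η θ) {t : ℝ}
    (ht : 0 < t) (x : ℝ) {H : ℝ → E} (hm : AEStronglyMeasurable H (volume.restrict (Ioi 0)))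
    {B : ℝ} (hB : ∀ ρ, 0 < ρ → ‖H ρ‖ ≤ B) :
    HasDerivAt (fun t : ℝ => ∫ ρ in Ioi (0 : ℝ), Complex.exp (t * (x + ρ * e)) • H ρ)
      (∫ ρ in Ioi (0 : ℝ), Complex.exp (t * (x + ρ * e)) • (((x : ℂ) + ρ * e) • H ρ)) t := by
  -- For parameters in `(t/2, 2t)` the exponential decays at least like `e^{-bρ}`; half of this rate
  -- absorbs the factor `ρ` produced by differentiation.
  set b : ℝ := -(t / 2 * Real.cos η) with hbdef
  have hb : 0 < b := by rw [hbdef]; nlinarith [hη.cos_neg]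
  have hmexp : ∀ s : ℝ, AEStronglyMeasurable (fun ρ : ℝ => Complex.exp (s * (x + ρ * e)) • H ρ)
      (volume.restrict (Ioi 0)) := fun s =>
    AEStronglyMeasurable.smul (Continuous.aestronglyMeasurable (by fun_prop)) hm
  have hB0 : 0 ≤ B := (norm_nonneg _).trans (hB 1 one_pos)
  refine (hasDerivAt_integral_of_dominated_loc_of_deriv_le
    (F' := fun (t : ℝ) (ρ : ℝ) => Complex.exp (t * (x + ρ * e)) • (((x : ℂ) + ρ * e) • H ρ))
    (bound := fun ρ => (B * Real.exp (2 * t * |x|) * (|x| + 2 / b)) * Real.exp (-(b / 2) * ρ))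
    (Ioo_mem_nhds (a := t / 2) (b := 2 * t) (by linarith) (by linarith))
    (Eventually.of_forall hmexp) (integrableOn_expRay he hη ht x hm hB) ?_ ?_ ?_ ?_).2
  · refine AEStronglyMeasurable.smul (Continuous.aestronglyMeasurable (by fun_prop)) ?_
    exact AEStronglyMeasurable.smul (Continuous.aestronglyMeasurable (by fun_prop)) hm
  · filter_upwards [ae_restrict_mem measurableSet_Ioi] with ρ hρ s hs
    have hρ' : (0 : ℝ) < ρ := hρ
    rw [norm_smul, norm_smul, he.norm_exp]
    have h1 : ‖(x : ℂ) + ρ * e‖ ≤ |x| + ρ := by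
      refine (norm_add_le _ _).trans ?_
      rw [norm_mul, he.norm_eq, Complex.norm_real, Complex.norm_real, mul_one,
        Real.norm_of_nonneg hρ'.le, Real.norm_eq_abs]
    have h2 : Real.exp (s * x) ≤ Real.exp (2 * t * |x|) := by
      apply Real.exp_le_exp.2
      have := le_abs_self x
      have h3 := abs_nonneg x
      have hs0 : 0 < s := by linarith [hs.1]
      calc s * x ≤ s * |x| := by gcongr
        _ ≤ 2 * t * |x| := by gcongr; exact hs.2.le
    have h3 : Real.exp (-(-(s * Real.cos η)) * ρ) ≤ Real.exp (-b * ρ) := by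
      apply Real.exp_le_exp.2
      have : s * Real.cos η ≤ t / 2 * Real.cos η :=
        mul_le_mul_of_nonpos_right hs.1.le hη.cos_neg.le
      rw [hbdef]; nlinarith
    have h4 : ρ * Real.exp (-b * ρ) ≤ 2 / b * Real.exp (-(b / 2) * ρ) := by
      have : Real.exp (-b * ρ) = Real.exp (-(b / 2) * ρ) * Real.exp (-(b / 2 * ρ)) := by
        rw [← Real.exp_add]; ring_nf
      rw [this, Real.exp_neg (b / 2 * ρ)]
      have h5 := Real.add_one_le_exp (b / 2 * ρ)
      have h6 : ρ ≤ 2 / b * Real.exp (b / 2 * ρ) := by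
        rw [div_mul_eq_mul_div, le_div_iff₀ hb]; linarith
      calc _ = Real.exp (-(b / 2) * ρ) * (ρ * (Real.exp (b / 2 * ρ))⁻¹) := by ring
        _ ≤ Real.exp (-(b / 2) * ρ) * (2 / b) := by
          gcongr
          rw [← div_eq_mul_inv, div_le_iff₀ (Real.exp_pos _)]
          exact h6
        _ = _ := by ring
    have h7 : Real.exp (-b * ρ) ≤ Real.exp (-(b / 2) * ρ) := by
      apply Real.exp_le_exp.2; nlinarith
    calc Real.exp (s * x) * Real.exp (-(-(s * Real.cos η)) * ρ) * (‖(x : ℂ) + ρ * e‖ * ‖H ρ‖)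
        ≤ Real.exp (2 * t * |x|) * Real.exp (-b * ρ) * ((|x| + ρ) * B) := by
          gcongr; exact hB ρ hρ
      _ = Real.exp (2 * t * |x|) * B * (|x| * Real.exp (-b * ρ) + ρ * Real.exp (-b * ρ)) := by ring
      _ ≤ Real.exp (2 * t * |x|) * B *
          (|x| * Real.exp (-(b / 2) * ρ) + 2 / b * Real.exp (-(b / 2) * ρ)) := by gcongr
      _ = _ := by ring
  · exact (integrableOn_exp_neg (half_pos hb)).const_mul _
  · refine Eventually.of_forall fun ρ s _ => ?_
    have h1 : HasDerivAt (fun s : ℝ => Complex.exp (s * ((x : ℂ) + ρ * e)))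
        (Complex.exp (s * ((x : ℂ) + ρ * e)) * ((x : ℂ) + ρ * e)) s := by
      have h2 : HasDerivAt (fun s : ℝ => (s : ℂ) * ((x : ℂ) + ρ * e)) ((x : ℂ) + ρ * e) s := by
        simpa using (Complex.ofRealCLM.hasDerivAt (x := s)).mul_const ((x : ℂ) + ρ * e)
      exact (Complex.hasDerivAt_exp _).comp s h2
    simpa [smul_smul] using h1.smul_const (H ρ)

omit [NormedSpace ℂ E] in
theorem IsDir.aestronglyMeasurable (he : IsDir η e) (hη : IsAngle η θ) {F : ℂ → E}
    (hF : ContinuousOn F (sector θ)) {x : ℝ} (hx : 0 < x) :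
    AEStronglyMeasurable (fun ρ : ℝ => F (x + ρ * e)) (volume.restrict (Ioi 0)) := by
  refine ContinuousOn.aestronglyMeasurable ?_ measurableSet_Ioi
  exact hF.comp (by fun_prop) fun ρ hρ => he.mem_sector hη hx (le_of_lt hρ)

omit [NormedSpace ℂ E] in
theorem IsDir.norm_le (he : IsDir η e) (hη : IsAngle η θ) {F : ℂ → E} {K : ℝ}
    (hK : ∀ w ∈ sector θ, ‖F w‖ ≤ K * (1 + ‖w‖⁻¹)) (hK0 : 0 ≤ K) {a x ρ : ℝ} (ha : 0 < a)
    (hx : a ≤ x) (hρ : 0 ≤ ρ) : ‖F (x + ρ * e)‖ ≤ K * (1 + (a * Real.sin η)⁻¹) := by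
  have hx0 : 0 < x := ha.trans_le hx
  refine (hK _ (he.mem_sector hη hx0 hρ)).trans ?_
  have h1 : a * Real.sin η ≤ ‖(x : ℂ) + ρ * e‖ :=
    le_trans (mul_le_mul_of_nonneg_right hx hη.sin_pos.le) (he.le_norm_left hη hx0.le)
  have h2 : 0 < a * Real.sin η := mul_pos ha hη.sin_pos
  gcongr

theorem wedge_exp_translate [CompleteSpace E] {F : ℂ → E} (hη : IsAngle η θ)
    (hF : DifferentiableOn ℂ F (sector θ)) {K : ℝ} (hK0 : 0 ≤ K)
    (hK : ∀ w ∈ sector θ, ‖F w‖ ≤ K * (1 + ‖w‖⁻¹)) {t a b : ℝ} (ht : 0 < t) (ha : 0 < a)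
    (hab : a ≤ b) :
    wedge (fun z => Complex.exp (t * z) • F z) a η =
      wedge (fun z => Complex.exp (t * z) • F z) b η := by
  have hc : 0 < -(t * Real.cos η) := by nlinarith [hη.cos_neg]
  refine wedge_translate hη (by fun_prop) ha hab ?_
    (δ := fun ρ => (Real.exp (t * b) * Real.exp (-(-(t * Real.cos η)) * ρ)) *
      (K * (1 + (a * Real.sin η)⁻¹))) ?_ ?_
  · intro e he x hx
    exact (integrableOn_expRay he hη ht x
      (he.aestronglyMeasurable hη hF.continuousOn (ha.trans_le hx))
      (fun ρ hρ => he.norm_le hη hK hK0 ha hx hρ.le)).smul e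
  · have h1 : Tendsto (fun ρ : ℝ => Real.exp (-(-(t * Real.cos η)) * ρ)) atTop (𝓝 0) := by
      refine Real.tendsto_exp_atBot.comp ?_
      exact tendsto_id.const_mul_atTop_of_neg (by linarith)
    simpa using (h1.const_mul (Real.exp (t * b))).mul_const (K * (1 + (a * Real.sin η)⁻¹))
  · intro e he x hx ρ hρ
    rw [norm_smul, he.norm_exp]
    have := he.norm_le hη hK hK0 ha hx.1 hρ
    have h2 := hx.2
    gcongr

theorem ray_exp_scale (F : ℂ → E) {t : ℝ} (ht : 0 < t) (e : ℂ) :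
    ray (fun z => Complex.exp (t * z) • F z) ((t⁻¹ : ℝ) : ℂ) e =
      ray (fun z => Complex.exp z • ((t : ℂ)⁻¹ • F ((t : ℂ)⁻¹ * z))) 1 e := by
  unfold ray
  have h := integral_comp_mul_left_Ioi
    (fun ρ : ℝ => e • Complex.exp (t * (((t⁻¹ : ℝ) : ℂ) + ρ * e)) • F (((t⁻¹ : ℝ) : ℂ) + ρ * e)) 0
    (inv_pos.2 ht)
  rw [mul_zero, inv_inv] at h
  have h2 : ∀ y : E, y = t⁻¹ • t • y := fun y => by rw [smul_smul, inv_mul_cancel₀ ht.ne', one_smul]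
  rw [h2 (∫ ρ in Ioi (0 : ℝ), _), ← h, ← integral_smul]
  congr 1
  ext ρ
  have h3 : (t : ℂ) ≠ 0 := by exact_mod_cast ht.ne'
  have h4 : ((t⁻¹ : ℝ) : ℂ) + ((t⁻¹ * ρ : ℝ) : ℂ) * e = (t : ℂ)⁻¹ * (1 + ρ * e) := by
    push_cast; ring
  rw [h4, ← mul_assoc, mul_inv_cancel₀ h3, one_mul, ← Complex.coe_smul, smul_smul, smul_smul,
    smul_smul, smul_smul]
  congr 1
  push_cast; ring

/-- The vertex is first moved from `1` to `1/t`, and then `z ↦ z/t` brings the contour back to the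
fixed one. Bounds that are uniform in `t` come from here: the powers of `t` are read off from `t⁻¹
F(z/t)`. -/
theorem wedge_exp_scale [CompleteSpace E] {F : ℂ → E} (hη : IsAngle η θ)
    (hF : DifferentiableOn ℂ F (sector θ)) {K : ℝ} (hK0 : 0 ≤ K)
    (hK : ∀ w ∈ sector θ, ‖F w‖ ≤ K * (1 + ‖w‖⁻¹)) {t : ℝ} (ht : 0 < t) :
    wedge (fun z => Complex.exp (t * z) • F z) 1 η =
      wedge (fun z => Complex.exp z • ((t : ℂ)⁻¹ • F ((t : ℂ)⁻¹ * z))) 1 η := by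
  have h1 : wedge (fun z => Complex.exp (t * z) • F z) 1 η =
      wedge (fun z => Complex.exp (t * z) • F z) ((t⁻¹ : ℝ) : ℂ) η := by
    rw [← Complex.ofReal_one]
    rcases le_total 1 t⁻¹ with h | h
    · exact wedge_exp_translate hη hF hK0 hK ht one_pos h
    · exact (wedge_exp_translate hη hF hK0 hK ht (inv_pos.2 ht) h).symm
  rw [h1, wedge, ray_exp_scale F ht, ray_exp_scale F ht, wedge]

theorem norm_ray_exp_le (he : IsDir η e) (hη : IsAngle η θ) {F : ℂ → E} {B : ℝ}
    (hB : ∀ ρ : ℝ, 0 < ρ → ‖F (1 + ρ * e)‖ ≤ B) :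
    ‖ray (fun z => Complex.exp z • F z) 1 e‖ ≤ B * (Real.exp 1 * (-Real.cos η)⁻¹) := by
  have := norm_integral_expRay_le he hη one_pos 1 (H := fun ρ : ℝ => F (1 + ρ * e)) hB
  unfold ray
  rw [integral_smul, norm_smul, he.norm_eq, one_mul]
  simpa [mul_assoc] using this

theorem norm_wedge_exp_le (hη : IsAngle η θ) {F : ℂ → E} {B : ℝ}
    (hB : ∀ e, IsDir η e → ∀ ρ : ℝ, 0 < ρ → ‖F (1 + ρ * e)‖ ≤ B) :
    ‖wedge (fun z => Complex.exp z • F z) 1 η‖ ≤ 2 * B * (Real.exp 1 * (-Real.cos η)⁻¹) := by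
  refine (norm_sub_le _ _).trans ?_
  have h1 := norm_ray_exp_le (isDir_pos η) hη (hB _ (isDir_pos η))
  have h2 := norm_ray_exp_le (isDir_neg η) hη (hB _ (isDir_neg η))
  linarith

theorem hasDerivAt_wedge_exp (hη : IsAngle η θ) {F : ℂ → E} (hF : ContinuousOn F (sector θ))
    {K : ℝ} (hK0 : 0 ≤ K) (hK : ∀ w ∈ sector θ, ‖F w‖ ≤ K * (1 + ‖w‖⁻¹)) {t : ℝ} (ht : 0 < t) :
    HasDerivAt (fun t : ℝ => wedge (fun z => Complex.exp (t * z) • F z) 1 η)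
      (wedge (fun z => Complex.exp (t * z) • (z • F z)) 1 η) t := by
  have key : ∀ e, IsDir η e →
      HasDerivAt (fun t : ℝ => ray (fun z => Complex.exp (t * z) • F z) 1 e)
      (ray (fun z => Complex.exp (t * z) • (z • F z)) 1 e) t := by
    intro e he
    have := hasDerivAt_integral_expRay he hη ht 1
      (he.aestronglyMeasurable hη hF one_pos)
      (fun ρ hρ => he.norm_le hη hK hK0 one_pos le_rfl hρ.le)
    unfold ray
    simp only [integral_smul]
    simpa [Pi.smul_def] using this.const_smul e
  exact (key _ (isDir_pos η)).sub (key _ (isDir_neg η))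

theorem integrableOn_ray_exp (he : IsDir η e) (hη : IsAngle η θ) {F : ℂ → E}
    (hF : ContinuousOn F (sector θ))
    {K : ℝ} (hK0 : 0 ≤ K) (hK : ∀ w ∈ sector θ, ‖F w‖ ≤ K * (1 + ‖w‖⁻¹)) {t : ℝ} (ht : 0 < t) :
    IntegrableOn (fun ρ : ℝ => e • Complex.exp (t * (1 + ρ * e)) • F (1 + ρ * e)) (Ioi 0) := by
  have := integrableOn_expRay he hη ht 1 (he.aestronglyMeasurable hη hF one_pos)
    (fun ρ hρ => he.norm_le hη hK hK0 one_pos le_rfl hρ.le)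
  simpa [Pi.smul_def, IntegrableOn] using this.smul e

/-- A holomorphic function on a half plane `{Re z < r}` containing the contour, bounded there, has
vanishing exponential contour integral. -/
theorem wedge_exp_eq_zero [CompleteSpace E] (hη : IsAngle η θ) {F : ℂ → E} {r : ℝ} (hr : 1 < r)
    (hF : DifferentiableOn ℂ F {z | z.re < r}) {B : ℝ} (hB : ∀ z : ℂ, z.re < r → ‖F z‖ ≤ B)
    {t : ℝ} (ht : 0 < t) :
    wedge (fun z => Complex.exp (t * z) • F z) 1 η = 0 := by
  have hc : 0 < -(t * Real.cos η) := by nlinarith [hη.cos_neg]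
  have hU : Convex ℝ {z : ℂ | z.re < r} := convex_halfSpace_re_lt r
  have hUo : IsOpen {z : ℂ | z.re < r} := isOpen_lt Complex.continuous_re continuous_const
  have hd : DifferentiableOn ℂ (fun z => Complex.exp (t * z) • F z) {z | z.re < r} := by fun_prop
  obtain ⟨G, hG⟩ := exists_primitive hU hUo hd
  have hre : ∀ e, IsDir η e → ∀ ρ : ℝ, ((1 : ℂ) + ρ * e).re = 1 + ρ * Real.cos η := by
    intro e he ρ; simp [he.re_eq]
  have hmem : ∀ e, IsDir η e → ∀ ρ : ℝ, 0 ≤ ρ → (1 : ℂ) + ρ * e ∈ {z : ℂ | z.re < r} := by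
    intro e he ρ hρ
    rw [mem_ofPred_eq, hre e he]
    nlinarith [hη.cos_neg]
  have hB0 : 0 ≤ B := (norm_nonneg _).trans (hB 1 (by simpa using hr))
  have hint : ∀ e, IsDir η e → IntegrableOn
      (fun ρ : ℝ => e • Complex.exp (t * (1 + ρ * e)) • F (1 + ρ * e)) (Ioi 0) := by
    intro e he
    have hm : AEStronglyMeasurable (fun ρ : ℝ => F (1 + ρ * e)) (volume.restrict (Ioi 0)) := by
      refine ContinuousOn.aestronglyMeasurable ?_ measurableSet_Ioi
      exact hF.continuousOn.comp (by fun_prop) fun ρ hρ => hmem e he ρ (le_of_lt hρ)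
    have := integrableOn_expRay he hη ht 1 hm (fun ρ hρ => hB _ (hmem e he ρ hρ.le))
    simpa [Pi.smul_def, IntegrableOn] using this.smul e
  unfold wedge
  rw [ray_sub_ray hd.continuousOn hU hG (hmem _ (isDir_pos η)) (hmem _ (isDir_neg η))
    (hint _ (isDir_pos η)) (hint _ (isDir_neg η))
    (δ := fun ρ => (Real.exp t * B * 2) * (ρ * Real.exp (-(-(t * Real.cos η)) * ρ))) ?_ ?_, sub_self]
  · have := (Real.tendsto_pow_mul_exp_neg_atTop_nhds_zero 1)
    have h1 : Tendsto (fun ρ : ℝ => -(t * Real.cos η) * ρ) atTop atTop :=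
      tendsto_id.const_mul_atTop hc
    have h2 := ((this.comp h1).const_mul (-(t * Real.cos η))⁻¹).const_mul (Real.exp t * B * 2)
    simp only [mul_zero] at h2
    refine h2.congr fun ρ => ?_
    simp only [Function.comp, pow_one]
    rw [mul_assoc (-(t * Real.cos η)) ρ, inv_mul_cancel_left₀ hc.ne']
    ring_nf
  · filter_upwards [eventually_ge_atTop 0] with ρ hρ z hz
    -- The closing segment joins conjugate points and is vertical, so `|e^{tz}|` is constant on it
    -- and its decay in `ρ` beats the length `2 * ρ`.
    have hz1 : z.re = 1 + ρ * Real.cos η := by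
      have : (segment ℝ (1 + ρ * Complex.exp (η * Complex.I)) (1 + ρ * Complex.exp (-η * Complex.I)))
          ⊆ {z : ℂ | z.re = 1 + ρ * Real.cos η} := by
        have hcv : Convex ℝ {z : ℂ | z.re = 1 + ρ * Real.cos η} := by
          exact convex_hyperplane (f := Complex.re) ⟨by simp, by simp⟩ _
        exact hcv.segment_subset (hre _ (isDir_pos η) ρ) (hre _ (isDir_neg η) ρ)
      exact this hz
    have hzr : z.re < r := by rw [hz1]; nlinarith [hη.cos_neg]
    have h1 : ‖(1 + ρ * Complex.exp (-η * Complex.I)) - (1 + ρ * Complex.exp (η * Complex.I))‖ ≤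
        2 * ρ := by
      have : (1 + ρ * Complex.exp (-η * Complex.I)) - (1 + ρ * Complex.exp (η * Complex.I)) =
        ρ * Complex.exp (-η * Complex.I) - ρ * Complex.exp (η * Complex.I) := by ring
      rw [this]
      refine (norm_sub_le _ _).trans ?_
      rw [norm_mul, norm_mul, (isDir_pos η).norm_eq, (isDir_neg η).norm_eq, Complex.norm_real,
        Real.norm_of_nonneg hρ]
      linarith
    have h2 : ‖Complex.exp (t * z)‖ = Real.exp t * Real.exp (-(-(t * Real.cos η)) * ρ) := by
      rw [Complex.norm_exp, ← Real.exp_add, Complex.re_ofReal_mul, hz1]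
      congr 1; ring
    rw [norm_smul, h2]
    have := hB z hzr
    calc _ ≤ Real.exp t * Real.exp (-(-(t * Real.cos η)) * ρ) * B * (2 * ρ) := by gcongr
      _ = _ := by ring

end Contour

/-! ### Hankel's contour integral -/

section Hankel

variable {η θ : ℝ} {e : ℂ}

theorem two_div_mul_eq {a b : ℂ} (ha : a ≠ 0) (hb : b ≠ 0) (h : a + b = 2) :
    2 / (a * b) = a⁻¹ + b⁻¹ := by
  rw [← h]; field_simp; ring

theorem IsDir.one_add_mem_slitPlane (he : IsDir η e) (hη : IsAngle η θ) {ρ : ℝ} (hρ : 0 ≤ ρ) :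
    1 + (ρ : ℂ) * e ∈ Complex.slitPlane := by
  have h := he.mem_sector hη one_pos hρ
  rw [Complex.mem_slitPlane_iff_arg]
  rw [Complex.ofReal_one] at h
  refine ⟨fun h' => ?_, h.1⟩
  have h2 := h.2
  rw [h', abs_of_pos Real.pi_pos] at h2
  linarith [hη.lt_pi]

theorem IsDir.one_sub_re (he : IsDir η e) (ρ : ℝ) :
    -Real.cos η * (1 + ρ) ≤ (1 - (ρ : ℂ) * e).re := by
  have : (1 - (ρ : ℂ) * e).re = 1 - ρ * Real.cos η := by simp [he.re_eq]
  rw [this]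
  linarith [Real.neg_one_le_cos η]

theorem IsDir.one_sub_mem_slitPlane (he : IsDir η e) (hη : IsAngle η θ) {ρ : ℝ} (hρ : 0 ≤ ρ) :
    1 - (ρ : ℂ) * e ∈ Complex.slitPlane := by
  rw [Complex.mem_slitPlane_iff]
  left
  have := he.one_sub_re ρ
  nlinarith [hη.cos_neg]

theorem IsDir.le_norm (he : IsDir η e) (hη : IsAngle η θ) {ρ : ℝ} (hρ : 0 ≤ ρ) :
    Real.sin η / 2 * (1 + ρ) ≤ ‖(1 : ℂ) + ρ * e‖ := by
  have h1 := he.le_norm_left hη (x := 1) (ρ := ρ) zero_le_one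
  have h2 := he.le_norm_right hη (x := 1) hρ
  rw [Complex.ofReal_one] at h1 h2
  linarith

theorem IsDir.norm_hankel_le (he : IsDir η e) (hη : IsAngle η θ) {ρ : ℝ} (hρ : 0 ≤ ρ) :
    ‖2 / ((1 + (ρ : ℂ) * e) * (1 - ρ * e))‖ ≤
      2 / (Real.sin η / 2 * -Real.cos η) * (1 + ρ ^ 2)⁻¹ := by
  have h1 := he.le_norm hη hρ
  have h2 := (he.one_sub_re ρ).trans (Complex.re_le_norm _)
  have hs := hη.sin_pos
  have hc := hη.cos_neg
  have h3 : (Real.sin η / 2 * -Real.cos η) * (1 + ρ ^ 2) ≤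
      ‖(1 + (ρ : ℂ) * e) * (1 - ρ * e)‖ := by
    rw [norm_mul]
    calc _ ≤ (Real.sin η / 2 * -Real.cos η) * ((1 + ρ) * (1 + ρ)) := by
          have : 0 < Real.sin η / 2 * -Real.cos η := by nlinarith
          gcongr; nlinarith
      _ = Real.sin η / 2 * (1 + ρ) * (-Real.cos η * (1 + ρ)) := by ring
      _ ≤ _ := by
          have : 0 ≤ -Real.cos η * (1 + ρ) := by nlinarith
          gcongr
  have h4 : 0 < (Real.sin η / 2 * -Real.cos η) * (1 + ρ ^ 2) := by
    have : 0 < Real.sin η / 2 * -Real.cos η := by nlinarith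
    positivity
  rw [norm_div, ← div_eq_mul_inv, div_div, Complex.norm_two]
  gcongr

/-- The primitive is `log (1 + ρ e) - log (1 - ρ e)`, whose arguments never leave the slit plane; at
infinity the two terms `log ρ` cancel. -/
theorem integral_hankel_ray (he : IsDir η e) (hη : IsAngle η θ) :
    ∫ ρ in Ioi (0 : ℝ), e * (2 / ((1 + (ρ : ℂ) * e) * (1 - ρ * e))) =
      Complex.log e - Complex.log (-e) := by
  have hi : e.im ≠ 0 := by
    have := he.abs_im_eq
    rw [abs_of_pos hη.sin_pos] at this
    intro h
    rw [h, abs_zero] at this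
    linarith [hη.sin_pos]
  have hd : ∀ ρ ∈ Ici (0 : ℝ), HasDerivAt
      (fun ρ : ℝ => Complex.log (1 + ρ * e) - Complex.log (1 - ρ * e))
      (e * (2 / ((1 + (ρ : ℂ) * e) * (1 - ρ * e)))) ρ := by
    intro ρ hρ
    have m1 := he.one_add_mem_slitPlane hη hρ
    have m2 := he.one_sub_mem_slitPlane hη hρ
    have h0 : HasDerivAt (fun x : ℝ => (x : ℂ) * e) e ρ := by
      simpa using (Complex.ofRealCLM.hasDerivAt (x := ρ)).mul_const e
    refine (((h0.const_add 1).clog_real m1).sub ((h0.const_sub 1).clog_real m2)).congr_deriv ?_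
    have n1 := Complex.slitPlane_ne_zero m1
    have n2 := Complex.slitPlane_ne_zero m2
    rw [two_div_mul_eq n1 n2 (by ring)]
    simp only [div_eq_mul_inv]
    ring
  have hint : IntegrableOn (fun ρ : ℝ => e * (2 / ((1 + (ρ : ℂ) * e) * (1 - ρ * e)))) (Ioi 0) := by
    refine Integrable.mono' ((integrable_inv_one_add_sq.integrableOn (s := Ioi 0)).const_mul
      (2 / (Real.sin η / 2 * -Real.cos η))) ?_ ?_
    · refine ContinuousOn.aestronglyMeasurable ?_ measurableSet_Ioi
      refine continuousOn_const.mul (continuousOn_const.div (by fun_prop) fun ρ hρ => ?_)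
      exact mul_ne_zero (Complex.slitPlane_ne_zero (he.one_add_mem_slitPlane hη (le_of_lt hρ)))
        (Complex.slitPlane_ne_zero (he.one_sub_mem_slitPlane hη (le_of_lt hρ)))
    · filter_upwards [ae_restrict_mem measurableSet_Ioi] with ρ hρ
      rw [norm_mul, he.norm_eq, one_mul]
      exact he.norm_hankel_le hη (le_of_lt hρ)
  have hl : Tendsto (fun ρ : ℝ => Complex.log (1 + ρ * e) - Complex.log (1 - ρ * e)) atTop
      (𝓝 (Complex.log e - Complex.log (-e))) := by
    have h0 : Tendsto (fun ρ : ℝ => ((ρ⁻¹ : ℝ) : ℂ)) atTop (𝓝 0) := by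
      have := (Complex.continuous_ofReal.tendsto 0).comp tendsto_inv_atTop_zero
      simpa [Function.comp_def] using this
    have m1 : e ∈ Complex.slitPlane := Complex.mem_slitPlane_iff.2 (Or.inr hi)
    have m2 : -e ∈ Complex.slitPlane := Complex.mem_slitPlane_iff.2 (Or.inr (by simpa using hi))
    have h1 : Tendsto (fun ρ : ℝ => Complex.log (((ρ⁻¹ : ℝ) : ℂ) + e)) atTop
        (𝓝 (Complex.log e)) := by
      refine Tendsto.clog ?_ m1
      simpa using h0.add_const e
    have h2 : Tendsto (fun ρ : ℝ => Complex.log (((ρ⁻¹ : ℝ) : ℂ) - e)) atTop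
        (𝓝 (Complex.log (-e))) := by
      refine Tendsto.clog ?_ m2
      simpa using h0.sub_const e
    refine (h1.sub h2).congr' ?_
    filter_upwards [eventually_gt_atTop 0] with ρ hρ
    have hρ' : (ρ : ℂ) ≠ 0 := by exact_mod_cast hρ.ne'
    have e1 : (1 : ℂ) + ρ * e = (ρ : ℂ) * (((ρ⁻¹ : ℝ) : ℂ) + e) := by
      push_cast; rw [mul_add, mul_inv_cancel₀ hρ']
    have e2 : (1 : ℂ) - ρ * e = (ρ : ℂ) * (((ρ⁻¹ : ℝ) : ℂ) - e) := by
      push_cast; rw [mul_sub, mul_inv_cancel₀ hρ']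
    have n1 := Complex.slitPlane_ne_zero (he.one_add_mem_slitPlane hη hρ.le)
    have n2 := Complex.slitPlane_ne_zero (he.one_sub_mem_slitPlane hη hρ.le)
    rw [e1] at n1 ⊢
    rw [e2] at n2 ⊢
    rw [Complex.log_ofReal_mul hρ (right_ne_zero_of_mul n1),
      Complex.log_ofReal_mul hρ (right_ne_zero_of_mul n2)]
    ring
  rw [integral_Ioi_of_hasDerivAt_of_tendsto' hd hint hl]
  simp

/-- Since `-e^{± iη} = e^{± i(η - π)}` with exponents in the principal strip, the two rays
contribute `πi` and `-πi`. -/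
theorem wedge_hankel_zero (hη : IsAngle η θ) :
    wedge (fun z => 2 / (z * (2 - z))) 1 η = 2 * Real.pi * Complex.I := by
  have h1 := hη.gt
  have h2 := hη.lt
  have h3 := hη.lt_pi
  have hpi := Real.pi_pos
  have key : ∀ e, IsDir η e → ray (fun z => 2 / (z * (2 - z))) 1 e =
      Complex.log e - Complex.log (-e) := by
    intro e he
    rw [← integral_hankel_ray he hη]
    unfold ray
    congr 1
    ext ρ
    rw [smul_eq_mul]
    beta_reduce
    rw [show (2 : ℂ) - (1 + ρ * e) = 1 - ρ * e by ring]
  have l1 : Complex.log (Complex.exp (η * Complex.I)) = η * Complex.I :=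
    Complex.log_exp (by simp; linarith) (by simp; linarith)
  have l2 : Complex.log (Complex.exp (-η * Complex.I)) = -η * Complex.I :=
    Complex.log_exp (by simp; linarith) (by simp; linarith)
  have l3 : Complex.log (-Complex.exp (η * Complex.I)) = (η - Real.pi) * Complex.I := by
    have : -Complex.exp (η * Complex.I) = Complex.exp ((η - Real.pi) * Complex.I) := by
      rw [sub_mul, Complex.exp_sub, Complex.exp_pi_mul_I, div_neg, div_one]
    rw [this, Complex.log_exp (by simp; linarith) (by simp; linarith)]
  have l4 : Complex.log (-Complex.exp (-η * Complex.I)) = (-η + Real.pi) * Complex.I := by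
    have : -Complex.exp (-η * Complex.I) = Complex.exp ((-η + Real.pi) * Complex.I) := by
      rw [add_mul, Complex.exp_add, Complex.exp_pi_mul_I, mul_neg, mul_one]
    rw [this, Complex.log_exp (by simp; linarith) (by simp; linarith)]
  rw [wedge, key _ (isDir_pos η), key _ (isDir_neg η), l1, l2, l3, l4]
  ring

theorem two_sub_ne_zero_of_re_lt {z : ℂ} (hz : z.re < 3 / 2) : 2 - z ≠ 0 := by
  intro h
  have := congrArg Complex.re h
  simp at this; linarith

/-- Hankel's contour integral: `∫_Γ e^z / z dz = 2πi`. -/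
theorem wedge_exp_inv (hη : IsAngle η θ) :
    wedge (fun z => Complex.exp z • z⁻¹) 1 η = 2 * Real.pi * Complex.I := by
  have hF : DifferentiableOn ℂ (fun z : ℂ => z⁻¹) (sector θ) :=
    fun z hz => (differentiableAt_inv hz.1).differentiableWithinAt
  have hK : ∀ w ∈ sector θ, ‖w⁻¹‖ ≤ 1 * (1 + ‖w‖⁻¹) := fun w _ => by
    rw [norm_inv, one_mul]; linarith
  -- Decompose `2 / (z (2 - z)) = 1/z + 1/(2 - z)`. The second summand is regular to the left of `Re
  -- z = 3/2`, so its exponential integral vanishes, while that of `1/z` does not depend on `t` by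
  -- scaling.
  have hD : ∀ t : ℝ, 0 < t → wedge (fun z => Complex.exp (t * z) • (2 - z)⁻¹) 1 η = 0 := by
    intro t ht
    refine wedge_exp_eq_zero hη (r := 3 / 2) (by norm_num) ?_ (B := 2) ?_ ht
    · exact fun z hz => ((differentiableAt_const _).sub differentiableAt_id).inv
        (two_sub_ne_zero_of_re_lt hz) |>.differentiableWithinAt
    · intro z hz
      rw [norm_inv]
      have h1 : (1 / 2 : ℝ) ≤ ‖2 - z‖ := by
        refine le_trans ?_ (Complex.re_le_norm _)
        simp; linarith
      have := inv_anti₀ (by norm_num) h1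
      norm_num at this ⊢; exact this
  have hre : ∀ e, IsDir η e → ∀ ρ : ℝ, 0 ≤ ρ → ((1 : ℂ) + ρ * e).re < 3 / 2 := by
    intro e he ρ hρ
    have : ((1 : ℂ) + ρ * e).re = 1 + ρ * Real.cos η := by simp [he.re_eq]
    rw [this]
    nlinarith [hη.cos_neg]
  have hC : ∀ t : ℝ, 0 < t → wedge (fun z => Complex.exp (t * z) • (2 / (z * (2 - z)))) 1 η =
      wedge (fun z => Complex.exp z • z⁻¹) 1 η := by
    intro t ht
    have ht' : (t : ℂ) ≠ 0 := by exact_mod_cast ht.ne'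
    have h1 := wedge_exp_scale hη hF zero_le_one hK ht
    have h2 : wedge (fun z => Complex.exp z • ((t : ℂ)⁻¹ • ((t : ℂ)⁻¹ * z)⁻¹)) 1 η =
        wedge (fun z => Complex.exp z • z⁻¹) 1 η := by
      congr 1; ext z
      rw [mul_inv, inv_inv, smul_eq_mul (t : ℂ)⁻¹, inv_mul_cancel_left₀ ht']
    have key : ∀ e, IsDir η e → ray (fun z => Complex.exp (t * z) • (2 / (z * (2 - z)))) 1 e =
        ray (fun z => Complex.exp (t * z) • z⁻¹) 1 e +
          ray (fun z => Complex.exp (t * z) • (2 - z)⁻¹) 1 e := by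
      intro e he
      have i1 := integrableOn_ray_exp he hη hF.continuousOn zero_le_one hK ht
      have hm : AEStronglyMeasurable (fun ρ : ℝ => (2 - (1 + ρ * e) : ℂ)⁻¹)
          (volume.restrict (Ioi 0)) := by
        refine ContinuousOn.aestronglyMeasurable ?_ measurableSet_Ioi
        exact ContinuousOn.inv₀ (by fun_prop) fun ρ hρ =>
          two_sub_ne_zero_of_re_lt (hre e he ρ (le_of_lt hρ))
      have i2 := integrableOn_expRay he hη ht 1 hm (B := 2) (fun ρ hρ => by
        rw [norm_inv]
        have h1 : (1 / 2 : ℝ) ≤ ‖2 - ((1 : ℂ) + ρ * e)‖ := by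
          refine le_trans ?_ (Complex.re_le_norm _)
          have := hre e he ρ hρ.le
          rw [Complex.sub_re]
          simp only [Complex.re_ofNat]; linarith
        have := inv_anti₀ (by norm_num) h1
        norm_num at this ⊢; exact this)
      have i2' := i2.smul e
      rw [Complex.ofReal_one] at i2'
      change Integrable (fun ρ : ℝ => e • Complex.exp (t * (1 + ρ * e)) •
        (2 - (1 + ρ * e) : ℂ)⁻¹) (volume.restrict (Ioi 0)) at i2'
      unfold ray
      beta_reduce
      rw [← integral_add i1 i2']
      refine setIntegral_congr_fun measurableSet_Ioi fun ρ hρ => ?_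
      have n1 := Complex.slitPlane_ne_zero (he.one_add_mem_slitPlane hη (le_of_lt hρ))
      have n2 := two_sub_ne_zero_of_re_lt (hre e he ρ (le_of_lt hρ))
      simp only [smul_eq_mul]
      rw [two_div_mul_eq n1 n2 (by ring)]
      ring
    have h3 : wedge (fun z => Complex.exp (t * z) • (2 / (z * (2 - z)))) 1 η =
        wedge (fun z => Complex.exp (t * z) • z⁻¹) 1 η +
          wedge (fun z => Complex.exp (t * z) • (2 - z)⁻¹) 1 η := by
      unfold wedge
      rw [key _ (isDir_pos η), key _ (isDir_neg η)]
      abel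
    rw [h3, hD t ht, add_zero, h1, h2]
  -- The value being independent of `t`, it may be computed as `t → 0`: the quadratic decay of `2 /
  -- (z (2 - z))` permits dominated convergence without help from the exponential.
  have hlim : Tendsto (fun t : ℝ => wedge (fun z => Complex.exp (t * z) • (2 / (z * (2 - z)))) 1 η)
      (𝓝[>] 0) (𝓝 (wedge (fun z => 2 / (z * (2 - z))) 1 η)) := by
    have key : ∀ e, IsDir η e → Tendsto
        (fun t : ℝ => ray (fun z => Complex.exp (t * z) • (2 / (z * (2 - z)))) 1 e)
        (𝓝[>] 0) (𝓝 (ray (fun z => 2 / (z * (2 - z))) 1 e)) := by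
      intro e he
      have h2 : ∀ ρ : ℝ, (2 : ℂ) - (1 + ρ * e) = 1 - ρ * e := fun ρ => by ring
      refine tendsto_integral_filter_of_dominated_convergence
        (fun ρ => Real.exp 1 * (2 / (Real.sin η / 2 * -Real.cos η) * (1 + ρ ^ 2)⁻¹)) ?_ ?_ ?_ ?_
      · refine Eventually.of_forall fun t => ContinuousOn.aestronglyMeasurable ?_ measurableSet_Ioi
        have c1 : ContinuousOn (fun ρ : ℝ => Complex.exp (t * (1 + ρ * e))) (Ioi 0) := by fun_prop
        have c2 : ContinuousOn (fun ρ : ℝ => (1 + ρ * e) * (2 - (1 + ρ * e))) (Ioi 0) := by fun_prop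
        refine (c1.smul ((continuousOn_const (c := (2 : ℂ))).div c2 fun ρ hρ => ?_)).const_smul e
        exact mul_ne_zero (Complex.slitPlane_ne_zero (he.one_add_mem_slitPlane hη (le_of_lt hρ)))
          (two_sub_ne_zero_of_re_lt (hre e he ρ (le_of_lt hρ)))
      · filter_upwards [Ioo_mem_nhdsGT one_pos] with t ht
        filter_upwards [ae_restrict_mem measurableSet_Ioi] with ρ hρ
        rw [norm_smul, norm_smul, he.norm_eq, one_mul, h2]
        have h3 := he.norm_hankel_le hη (le_of_lt hρ)
        have h4 : ‖Complex.exp (t * (1 + ρ * e))‖ ≤ Real.exp 1 := by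
          rw [Complex.norm_exp]
          apply Real.exp_le_exp.2
          have : ((1 : ℂ) + ρ * e).re = 1 + ρ * Real.cos η := by simp [he.re_eq]
          rw [Complex.re_ofReal_mul, this]
          have h5 : ρ * Real.cos η ≤ 0 := mul_nonpos_of_nonneg_of_nonpos (le_of_lt hρ) hη.cos_neg.le
          nlinarith [ht.1, ht.2, mul_nonneg ht.1.le (neg_nonneg.2 h5)]
        gcongr
      · exact ((integrable_inv_one_add_sq.integrableOn (s := Ioi 0)).const_mul _).const_mul _
      · refine Eventually.of_forall fun ρ => ?_
        refine Tendsto.const_smul ?_ e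
        have : Continuous fun t : ℝ => Complex.exp (t * (1 + ρ * e)) •
            (2 / (((1 : ℂ) + ρ * e) * (2 - (1 + ρ * e)))) := by fun_prop
        have h := this.tendsto 0
        simp only [Complex.ofReal_zero, zero_mul, Complex.exp_zero, one_smul] at h
        exact h.mono_left nhdsWithin_le_nhds
    exact (key _ (isDir_pos η)).sub (key _ (isDir_neg η))
  rw [← wedge_hankel_zero hη]
  refine tendsto_nhds_unique ?_ hlim
  refine tendsto_const_nhds.congr' ?_
  filter_upwards [self_mem_nhdsWithin] with t ht
  exact (hC t ht).symm

end Hankel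

/-! ### Resolvent identities for operators with arbitrary domain -/

section Resolvent

variable {X : Type*} [NormedAddCommGroup X] [NormedSpace ℂ X] {A : X →ₗ.[ℂ] X}

theorem isResolventAt_resolvent {z : ℂ} (hz : z ∈ resolventSet A) :
    IsResolventAt A z (resolvent A z) := by
  rw [resolvent, dif_pos hz]
  exact Classical.choose_spec hz

theorem IsResolventAt.sub_eq {z w : ℂ} {R Q : X →L[ℂ] X} (hR : IsResolventAt A z R)
    (hQ : IsResolventAt A w Q) : R - Q = (w - z) • (R * Q) := by
  ext y
  obtain ⟨h, hy⟩ := hQ.1 y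
  have h1 := hR.2 ⟨Q y, h⟩
  have h2 : z • Q y - A ⟨Q y, h⟩ = y - (w - z) • Q y := by
    rw [sub_smul, ← sub_eq_zero]
    rw [← sub_eq_zero] at hy
    rw [← hy]; abel
  rw [h2, map_sub, map_smul] at h1
  simp only [sub_apply, smul_apply, mul_apply_eq_comp]
  rw [sub_eq_iff_eq_add] at h1 ⊢
  rw [h1]; abel

theorem IsResolventAt.commute {z w : ℂ} {R Q : X →L[ℂ] X} (hR : IsResolventAt A z R)
    (hQ : IsResolventAt A w Q) : Commute R Q := by
  rcases eq_or_ne z w with rfl | hne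
  · have := hR.sub_eq hQ
    rw [sub_self, zero_smul, sub_eq_zero] at this
    rw [this]
  · have h1 := hR.sub_eq hQ
    have h2 := hQ.sub_eq hR
    have h3 : (w - z) • (R * Q) = (w - z) • (Q * R) := by
      rw [← h1, ← neg_sub Q R, h2, ← neg_smul, neg_sub]
    exact smul_right_injective _ (sub_ne_zero.2 hne.symm) h3

theorem IsResolventAt.eq_zero {z : ℂ} {R : X →L[ℂ] X} (hR : IsResolventAt A z R) {y : X}
    (hy : R y = 0) : y = 0 := by
  obtain ⟨h, h1⟩ := hR.1 y
  have : (⟨R y, h⟩ : A.domain) = 0 := Subtype.ext hy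
  rw [this, hy] at h1
  simpa using h1.symm

/-- This stands in for density of the domain: identities and limits are established after applying a
resolvent, which is then cancelled. -/
theorem IsResolventAt.injective {z : ℂ} {R : X →L[ℂ] X} (hR : IsResolventAt A z R) {y y' : X}
    (hy : R y = R y') : y = y' :=
  sub_eq_zero.1 (hR.eq_zero (by rw [map_sub, hy, sub_self]))

/-- `x ∈ D(A)` with `A x = y`, from a resolvent representation of `x`. -/
theorem IsResolventAt.apply_of_eq {z : ℂ} {R : X →L[ℂ] X} (hR : IsResolventAt A z R) {x y : X}
    (h : x = R (z • x - y)) : ∃ hx : x ∈ A.domain, A ⟨x, hx⟩ = y := by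
  obtain ⟨h1, h2⟩ := hR.1 (z • x - y)
  have h3 : x ∈ A.domain := by rw [h]; exact h1
  refine ⟨h3, ?_⟩
  have h4 : (⟨R (z • x - y), h1⟩ : A.domain) = ⟨x, h3⟩ := Subtype.ext h.symm
  rw [h4, ← h] at h2
  exact sub_right_injective h2

theorem IsResolventAt.eq_of_apply {z : ℂ} {R : X →L[ℂ] X} (hR : IsResolventAt A z R) {x y : X}
    (h : ∃ hx : x ∈ A.domain, A ⟨x, hx⟩ = y) : R (z • x - y) = x := by
  obtain ⟨hx, rfl⟩ := h
  exact hR.2 ⟨x, hx⟩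

end Resolvent

/-! ### Linearity of the contour integral -/

section Tame

variable {E E' : Type*} [NormedAddCommGroup E] [NormedSpace ℂ E]
  [NormedAddCommGroup E'] [NormedSpace ℂ E'] {η θ : ℝ} {e : ℂ}

/-- Holomorphic functions on a sector that are bounded at infinity and `O(1/|z|)` at the vertex. -/
structure Tame (θ : ℝ) (F : ℂ → E) : Prop where
  diff : DifferentiableOn ℂ F (sector θ)
  bound : ∃ K : ℝ, 0 ≤ K ∧ ∀ w ∈ sector θ, ‖F w‖ ≤ K * (1 + ‖w‖⁻¹)

theorem Tame.add {F G : ℂ → E} (hF : Tame θ F) (hG : Tame θ G) : Tame θ (fun z => F z + G z) := by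
  obtain ⟨K, hK0, hK⟩ := hF.bound
  obtain ⟨L, hL0, hL⟩ := hG.bound
  refine ⟨hF.diff.add hG.diff, K + L, by positivity, fun w hw => ?_⟩
  refine (norm_add_le _ _).trans ?_
  linarith [hK w hw, hL w hw]

theorem Tame.clm {F : ℂ → E} (hF : Tame θ F) (L : E →L[ℂ] E') : Tame θ (fun z => L (F z)) := by
  obtain ⟨K, hK0, hK⟩ := hF.bound
  refine ⟨L.differentiable.comp_differentiableOn hF.diff, ‖L‖ * K, by positivity, fun w hw => ?_⟩
  calc _ ≤ ‖L‖ * ‖F w‖ := L.le_opNorm _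
    _ ≤ ‖L‖ * (K * (1 + ‖w‖⁻¹)) := by gcongr; exact hK w hw
    _ = _ := by ring

theorem Tame.const (c : E) : Tame θ (fun _ : ℂ => c) :=
  ⟨differentiableOn_const _, ‖c‖, norm_nonneg _, fun w _ => by
    have : 0 ≤ ‖w‖⁻¹ := by positivity
    nlinarith [norm_nonneg c]⟩

theorem wedge_exp_add (hη : IsAngle η θ) {F G : ℂ → E} (hF : Tame θ F) (hG : Tame θ G) {t : ℝ}
    (ht : 0 < t) :
    wedge (fun z => Complex.exp (t * z) • (F z + G z)) 1 η =
      wedge (fun z => Complex.exp (t * z) • F z) 1 η +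
        wedge (fun z => Complex.exp (t * z) • G z) 1 η := by
  obtain ⟨K, hK0, hK⟩ := hF.bound
  obtain ⟨L, hL0, hL⟩ := hG.bound
  have key : ∀ e, IsDir η e → ray (fun z => Complex.exp (t * z) • (F z + G z)) 1 e =
      ray (fun z => Complex.exp (t * z) • F z) 1 e +
        ray (fun z => Complex.exp (t * z) • G z) 1 e := by
    intro e he
    unfold ray
    rw [← integral_add (integrableOn_ray_exp he hη hF.diff.continuousOn hK0 hK ht)
      (integrableOn_ray_exp he hη hG.diff.continuousOn hL0 hL ht)]
    simp only [smul_add]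
  unfold wedge
  rw [key _ (isDir_pos η), key _ (isDir_neg η)]
  abel

theorem wedge_exp_clm [CompleteSpace E] [CompleteSpace E'] (hη : IsAngle η θ) {F : ℂ → E}
    (hF : Tame θ F) (L : E →L[ℂ] E') {t : ℝ} (ht : 0 < t) :
    wedge (fun z => Complex.exp (t * z) • L (F z)) 1 η =
      L (wedge (fun z => Complex.exp (t * z) • F z) 1 η) := by
  obtain ⟨K, hK0, hK⟩ := hF.bound
  have key : ∀ e, IsDir η e → ray (fun z => Complex.exp (t * z) • L (F z)) 1 e =
      L (ray (fun z => Complex.exp (t * z) • F z) 1 e) := by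
    intro e he
    unfold ray
    rw [← ContinuousLinearMap.integral_comp_comm L
      (integrableOn_ray_exp he hη hF.diff.continuousOn hK0 hK ht)]
    simp only [map_smul]
  unfold wedge
  rw [key _ (isDir_pos η), key _ (isDir_neg η), map_sub]

theorem isOpen_sector (h : θ < Real.pi) : IsOpen (sector θ) := by
  have h1 : sector θ = Complex.slitPlane ∩ (fun w : ℂ => |w.arg|) ⁻¹' Iio θ := by
    ext w
    rw [mem_inter_iff, Complex.mem_slitPlane_iff_arg]
    constructor
    · rintro ⟨h1, h2⟩
      refine ⟨⟨fun h3 => ?_, h1⟩, h2⟩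
      rw [h3, abs_of_pos Real.pi_pos] at h2; linarith
    · rintro ⟨h1, h2⟩
      exact ⟨h1.2, h2⟩
  rw [h1]
  refine ContinuousOn.isOpen_inter_preimage ?_ Complex.isOpen_slitPlane isOpen_Iio
  exact fun w hw => (Complex.continuousAt_arg hw).abs.continuousWithinAt

theorem smul_mem_sector {w : ℂ} (hw : w ∈ sector θ) {r : ℝ} (hr : 0 < r) :
    (r : ℂ) * w ∈ sector θ := by
  refine ⟨mul_ne_zero (by exact_mod_cast hr.ne') hw.1, ?_⟩
  rw [Complex.arg_real_mul _ hr]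
  exact hw.2

end Tame

/-! ### The Dunford integral of a sectorial operator -/

section Sectorial

variable {X : Type*} [NormedAddCommGroup X] [NormedSpace ℂ X]
  {A : X →ₗ.[ℂ] X} {ω θ M η : ℝ}

namespace IsSectorialWith

theorem isResolventAt (hs : IsSectorialWith A ω θ M) {z : ℂ} (hz : z ∈ sector θ) :
    IsResolventAt A (ω + z) (resolvent A (ω + z)) := by
  refine isResolventAt_resolvent (hs.sector_subset _ ?_ ?_)
  · simpa using hz.1
  · simpa using hz.2

theorem norm_le (hs : IsSectorialWith A ω θ M) {z : ℂ} (hz : z ∈ sector θ) :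
    ‖resolvent A (ω + z)‖ ≤ M / ‖z‖ := by
  have := hs.norm_resolvent_le (ω + z) (by simpa using hz.1) (by simpa using hz.2)
  simpa using this

theorem pos_mem_sector (hs : IsSectorialWith A ω θ M) {r : ℝ} (hr : 0 < r) :
    (r : ℂ) ∈ sector θ := by
  refine ⟨by exact_mod_cast hr.ne', ?_⟩
  rw [Complex.arg_ofReal_of_nonneg hr.le, abs_zero]
  linarith [hs.angle_gt, Real.pi_pos]

theorem M_nonneg (hs : IsSectorialWith A ω θ M) : 0 ≤ M := by
  have := (norm_nonneg _).trans (hs.norm_le (hs.pos_mem_sector one_pos))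
  simpa using this

theorem hasDerivAt_resolvent (hs : IsSectorialWith A ω θ M) {z : ℂ} (hz : z ∈ sector θ) :
    HasDerivAt (fun z => resolvent A (ω + z))
      (-(resolvent A (ω + z) * resolvent A (ω + z))) z := by
  have hev : ∀ᶠ w in 𝓝 z, w ∈ sector θ := (isOpen_sector hs.angle_lt).mem_nhds hz
  have hid : ∀ w ∈ sector θ, resolvent A (ω + w) - resolvent A (ω + z) =
      (z - w) • (resolvent A (ω + w) * resolvent A (ω + z)) := by
    intro w hw
    rw [(hs.isResolventAt hw).sub_eq (hs.isResolventAt hz)]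
    congr 1; ring
  have hzn : 0 < ‖z‖ := norm_pos_iff.2 hz.1
  have hcont : ContinuousAt (fun z => resolvent A (ω + z)) z := by
    rw [ContinuousAt, tendsto_iff_norm_sub_tendsto_zero]
    have hb : Tendsto (fun w : ℂ => ‖z - w‖ * (M / (‖z‖ / 2) * ‖resolvent A (ω + z)‖)) (𝓝 z)
        (𝓝 0) := by
      have : Continuous fun w : ℂ => ‖z - w‖ * (M / (‖z‖ / 2) * ‖resolvent A (ω + z)‖) := by
        fun_prop
      simpa using this.tendsto z
    refine squeeze_zero' (Eventually.of_forall fun _ => norm_nonneg _) ?_ hb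
    have hev2 : ∀ᶠ w : ℂ in 𝓝 z, ‖z‖ / 2 < ‖w‖ :=
      continuous_norm.continuousAt.eventually_const_lt (by linarith)
    filter_upwards [hev, hev2] with w hw hw2
    rw [hid w hw, norm_smul]
    have hM := hs.M_nonneg
    gcongr
    refine (norm_mul_le _ _).trans ?_
    gcongr
    exact (hs.norm_le hw).trans (by gcongr)
  rw [hasDerivAt_iff_tendsto_slope]
  have h1 : Tendsto (fun w => -(resolvent A (ω + w) * resolvent A (ω + z))) (𝓝[≠] z)
      (𝓝 (-(resolvent A (ω + z) * resolvent A (ω + z)))) :=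
    ((hcont.tendsto.mul_const _).neg).mono_left nhdsWithin_le_nhds
  refine h1.congr' ?_
  filter_upwards [nhdsWithin_le_nhds hev, self_mem_nhdsWithin] with w hw hne
  rw [slope, vsub_eq_sub, hid w hw, smul_smul, ← neg_sub w z, mul_neg,
    inv_mul_cancel₀ (sub_ne_zero.2 hne), neg_one_smul]

theorem tame_resolvent (hs : IsSectorialWith A ω θ M) :
    Tame θ (fun z => resolvent A (ω + z)) := by
  refine ⟨fun z hz => (hs.hasDerivAt_resolvent hz).differentiableAt.differentiableWithinAt,
    M, hs.M_nonneg, fun w hw => (hs.norm_le hw).trans ?_⟩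
  rw [div_eq_mul_inv]
  have := hs.M_nonneg
  gcongr; linarith

theorem norm_smul_le (hs : IsSectorialWith A ω θ M) {w : ℂ} (hw : w ∈ sector θ) :
    ‖w • resolvent A (ω + w)‖ ≤ M := by
  have h0 : 0 < ‖w‖ := norm_pos_iff.2 hw.1
  rw [norm_smul]
  have := hs.norm_le hw
  rw [le_div_iff₀ h0] at this
  linarith

theorem tame_smul_resolvent (hs : IsSectorialWith A ω θ M) :
    Tame θ (fun z => z • resolvent A (ω + z)) := by
  refine ⟨differentiableOn_id.smul hs.tame_resolvent.diff, M, hs.M_nonneg, fun w hw => ?_⟩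
  refine (hs.norm_smul_le hw).trans ?_
  have := hs.M_nonneg
  have h0 : 0 ≤ ‖w‖⁻¹ := by positivity
  nlinarith

end IsSectorialWith

/-- The unnormalized contour integral `∫_Γ e^{tz} R(ω + z, A) dz`. -/
def contour (A : X →ₗ.[ℂ] X) (ω η t : ℝ) : X →L[ℂ] X :=
  wedge (fun z => Complex.exp (t * z) • resolvent A (ω + z)) 1 η

/-- The derivative of `contour`. -/
def contourDeriv (A : X →ₗ.[ℂ] X) (ω η t : ℝ) : X →L[ℂ] X :=
  wedge (fun z => Complex.exp (t * z) • (z • resolvent A (ω + z))) 1 η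

theorem dunford_eq (A : X →ₗ.[ℂ] X) (ω η t : ℝ) :
    dunford A (ω + 1) η t =
      (2 * Real.pi * Complex.I : ℂ)⁻¹ • Complex.exp (t * ω) • contour A ω η t := by
  have key : ∀ e : ℂ, (∫ ρ in Ioi (0 : ℝ), (Complex.exp (t * ((ω + 1 : ℝ) + ρ * e)) * e) •
      resolvent A ((ω + 1 : ℝ) + ρ * e)) = Complex.exp (t * ω) •
        ray (fun z => Complex.exp (t * z) • resolvent A (ω + z)) 1 e := by
    intro e
    unfold ray
    rw [← integral_smul]
    congr 1; ext1 ρ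
    rw [smul_smul, smul_smul, Complex.ofReal_add, Complex.ofReal_one, add_assoc (ω : ℂ) 1,
      mul_add (t : ℂ) ω, Complex.exp_add]
    congr 1; ring
  unfold dunford contour wedge
  rw [key, key, ← smul_sub]

theorem two_pi_I_ne_zero : (2 * Real.pi * Complex.I : ℂ) ≠ 0 := Complex.two_pi_I_ne_zero

variable [CompleteSpace X]

omit [CompleteSpace X] in
theorem hasDerivAt_contour (hs : IsSectorialWith A ω θ M) (hη : IsAngle η θ) {t : ℝ}
    (ht : 0 < t) : HasDerivAt (contour A ω η) (contourDeriv A ω η t) t := by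
  obtain ⟨K, hK0, hK⟩ := hs.tame_resolvent.bound
  exact hasDerivAt_wedge_exp hη hs.tame_resolvent.diff.continuousOn hK0 hK ht

/-- The bounded form of `(A - ω) contour = contourDeriv`. The resolvent identity reads `R(ω+z) =
R(ω+2) (2 R(ω+z) - z R(ω+z) + 1)`; integrate it, the constant `1` contributing nothing because its
contour closes to the left. -/
theorem contour_eq (hs : IsSectorialWith A ω θ M) (hη : IsAngle η θ) {t : ℝ} (ht : 0 < t) :
    contour A ω η t =
      resolvent A (ω + 2) * ((2 : ℂ) • contour A ω η t - contourDeriv A ω η t) := by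
  have h2 : (2 : ℂ) ∈ sector θ := by exact_mod_cast hs.pos_mem_sector (r := 2) two_pos
  have hid : ∀ z ∈ sector θ, resolvent A (ω + z) = resolvent A (ω + 2) *
      ((2 : ℂ) • resolvent A (ω + z) + ((-1 : ℂ) • (z • resolvent A (ω + z)) + 1)) := by
    intro z hz
    have h3 := (hs.isResolventAt hz).sub_eq (hs.isResolventAt h2)
    rw [((hs.isResolventAt hz).commute (hs.isResolventAt h2)).eq, sub_eq_iff_eq_add] at h3
    nth_rw 1 [h3]
    rw [mul_add, mul_add, mul_one, mul_smul_comm, mul_smul_comm, mul_smul_comm, ← add_assoc,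
      smul_smul, ← add_smul]
    congr 2; ring
  have t1 : Tame θ (fun z => (2 : ℂ) • resolvent A (ω + z)) :=
    hs.tame_resolvent.clm ((2 : ℂ) • ContinuousLinearMap.id ℂ (X →L[ℂ] X))
  have t2 : Tame θ (fun z => (-1 : ℂ) • (z • resolvent A (ω + z))) :=
    hs.tame_smul_resolvent.clm ((-1 : ℂ) • ContinuousLinearMap.id ℂ (X →L[ℂ] X))
  have t3 : Tame θ (fun _ => (1 : X →L[ℂ] X)) := Tame.const 1
  have e1 := wedge_exp_clm hη hs.tame_resolvent ((2 : ℂ) • ContinuousLinearMap.id ℂ (X →L[ℂ] X)) ht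
  have e2 := wedge_exp_clm hη hs.tame_smul_resolvent
    ((-1 : ℂ) • ContinuousLinearMap.id ℂ (X →L[ℂ] X)) ht
  have e3 : wedge (fun z => Complex.exp (t * z) • (1 : X →L[ℂ] X)) 1 η = 0 :=
    wedge_exp_eq_zero hη (r := 2) one_lt_two (differentiableOn_const _)
      (B := ‖(1 : X →L[ℂ] X)‖) (fun _ _ => le_rfl) ht
  have e4 := wedge_exp_clm hη (t1.add (t2.add t3))
    (ContinuousLinearMap.mul ℂ (X →L[ℂ] X) (resolvent A (ω + 2))) ht
  rw [wedge_exp_add hη t1 (t2.add t3) ht, wedge_exp_add hη t2 t3 ht, e3] at e4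
  simp only [smul_apply, ContinuousLinearMap.id_apply,
    ContinuousLinearMap.mul_apply'] at e1 e2 e4
  rw [e1, e2] at e4
  have e5 : contour A ω η t = wedge (fun z => Complex.exp (t * z) • (resolvent A (ω + 2) *
      ((2 : ℂ) • resolvent A (ω + z) + ((-1 : ℂ) • (z • resolvent A (ω + z)) + 1)))) 1 η := by
    have key : ∀ e, IsDir η e → ray (fun z => Complex.exp (t * z) • resolvent A (ω + z)) 1 e =
        ray (fun z => Complex.exp (t * z) • (resolvent A (ω + 2) *
      ((2 : ℂ) • resolvent A (ω + z) + ((-1 : ℂ) • (z • resolvent A (ω + z)) + 1)))) 1 e := by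
      intro e he
      refine setIntegral_congr_fun measurableSet_Ioi fun ρ hρ => ?_
      beta_reduce
      have := he.mem_sector hη one_pos (le_of_lt hρ)
      rw [Complex.ofReal_one] at this
      rw [← hid _ this]
    unfold contour wedge
    rw [key _ (isDir_pos η), key _ (isDir_neg η)]
  refine e5.trans (e4.trans ?_)
  rw [add_zero, neg_one_smul, sub_eq_add_neg, contour, contourDeriv]

theorem commute_contour (hs : IsSectorialWith A ω θ M) (hη : IsAngle η θ) {t : ℝ} (ht : 0 < t) :
    Commute (resolvent A (ω + 2)) (contour A ω η t) := by
  have h2 : (2 : ℂ) ∈ sector θ := by exact_mod_cast hs.pos_mem_sector (r := 2) two_pos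
  have e1 := wedge_exp_clm hη hs.tame_resolvent
    (ContinuousLinearMap.mul ℂ (X →L[ℂ] X) (resolvent A (ω + 2))) ht
  have e2 := wedge_exp_clm hη hs.tame_resolvent
    ((ContinuousLinearMap.mul ℂ (X →L[ℂ] X)).flip (resolvent A (ω + 2))) ht
  simp only [ContinuousLinearMap.mul_apply', ContinuousLinearMap.flip_apply] at e1 e2
  rw [Commute, SemiconjBy, contour, ← e1, ← e2]
  have key : ∀ e, IsDir η e →
      ray (fun z => Complex.exp (t * z) • (resolvent A (ω + 2) * resolvent A (ω + z))) 1 e =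
        ray (fun z => Complex.exp (t * z) • (resolvent A (ω + z) * resolvent A (ω + 2))) 1 e := by
    intro e he
    refine setIntegral_congr_fun measurableSet_Ioi fun ρ hρ => ?_
    beta_reduce
    have := he.mem_sector hη one_pos (le_of_lt hρ)
    rw [Complex.ofReal_one] at this
    rw [((hs.isResolventAt this).commute (hs.isResolventAt h2)).eq]
  unfold wedge
  rw [key _ (isDir_pos η), key _ (isDir_neg η)]

/-- After rescaling, the integrands on the fixed contour are `t⁻¹ R(ω + z/t)`, bounded by `M/|z|`,
and `t⁻¹ (z/t) R(ω + z/t)`, bounded by `M/t`. -/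
theorem norm_contour_le (hs : IsSectorialWith A ω θ M) (hη : IsAngle η θ) :
    ∃ C, 0 ≤ C ∧ ∀ t, 0 < t → ‖contour A ω η t‖ ≤ C ∧ ‖contourDeriv A ω η t‖ ≤ C / t := by
  obtain ⟨K, hK0, hK⟩ := hs.tame_resolvent.bound
  obtain ⟨L, hL0, hL⟩ := hs.tame_smul_resolvent.bound
  have hM := hs.M_nonneg
  have hsin := hη.sin_pos
  have hc : 0 ≤ Real.exp 1 * (-Real.cos η)⁻¹ :=
    mul_nonneg (Real.exp_pos _).le (inv_nonneg.2 (by linarith [hη.cos_neg]))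
  have hmem : ∀ e, IsDir η e → ∀ ρ : ℝ, 0 < ρ → (1 : ℂ) + ρ * e ∈ sector θ := fun e he ρ hρ => by
    simpa using he.mem_sector hη one_pos hρ.le
  refine ⟨2 * (M / Real.sin η + M) * (Real.exp 1 * (-Real.cos η)⁻¹), by positivity,
    fun t ht => ⟨?_, ?_⟩⟩
  · rw [contour, wedge_exp_scale hη hs.tame_resolvent.diff hK0 hK ht]
    refine (norm_wedge_exp_le hη (B := M / Real.sin η) ?_).trans ?_
    · intro e he ρ hρ
      have hm := hmem e he ρ hρ
      have hm' := smul_mem_sector hm (inv_pos.2 ht)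
      rw [Complex.ofReal_inv] at hm'
      have h1 := hs.norm_le hm'
      rw [norm_smul]
      have h2 : Real.sin η ≤ ‖(1 : ℂ) + ρ * e‖ := by
        simpa using he.le_norm_left hη (x := 1) (ρ := ρ) zero_le_one
      rw [norm_mul, norm_inv, Complex.norm_real, Real.norm_of_nonneg ht.le] at h1
      rw [norm_inv, Complex.norm_real, Real.norm_of_nonneg ht.le]
      calc t⁻¹ * _ ≤ t⁻¹ * (M / (t⁻¹ * ‖(1 : ℂ) + ρ * e‖)) := by gcongr
        _ = M / ‖(1 : ℂ) + ρ * e‖ := by field_simp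
        _ ≤ _ := by gcongr
    · gcongr; linarith
  · rw [contourDeriv, wedge_exp_scale hη hs.tame_smul_resolvent.diff hL0 hL ht]
    refine (norm_wedge_exp_le hη (B := t⁻¹ * M) ?_).trans ?_
    · intro e he ρ hρ
      have hm := hmem e he ρ hρ
      have hm' := smul_mem_sector hm (inv_pos.2 ht)
      rw [Complex.ofReal_inv] at hm'
      rw [norm_smul, norm_inv, Complex.norm_real, Real.norm_of_nonneg ht.le]
      gcongr
      exact hs.norm_smul_le hm'
    · rw [div_eq_mul_inv]
      have : 0 ≤ M / Real.sin η := by positivity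
      calc _ = 2 * M * (Real.exp 1 * (-Real.cos η)⁻¹) * t⁻¹ := by ring
        _ ≤ _ := by gcongr; linarith

/-- The initial condition in the only form available without density. With `Q = R(ω+2)` and `R =
R(ω+z)`, the difference `Q R - z⁻¹ Q = z⁻¹ (2 Q R - R)` is `O(|z|⁻²)`. Hankel's integral evaluates
the subtracted term, and the extra power of `1/z` becomes the factor `t` after scaling. -/
theorem norm_resolvent_mul_contour_le (hs : IsSectorialWith A ω θ M) (hη : IsAngle η θ) :
    ∃ C, ∀ t, 0 < t → ‖resolvent A (ω + 2) * contour A ω η t -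
      (2 * Real.pi * Complex.I : ℂ) • resolvent A (ω + 2)‖ ≤ C * t := by
  have h2 : (2 : ℂ) ∈ sector θ := by exact_mod_cast hs.pos_mem_sector (r := 2) two_pos
  have hM := hs.M_nonneg
  have hsin := hη.sin_pos
  have hmem : ∀ e, IsDir η e → ∀ ρ : ℝ, 0 < ρ → (1 : ℂ) + ρ * e ∈ sector θ := fun e he ρ hρ => by
    simpa using he.mem_sector hη one_pos hρ.le
  set Q := resolvent A (ω + 2) with hQ
  obtain ⟨K, hK0, hK⟩ := hs.tame_resolvent.bound
  refine ⟨2 * ((2 * ‖Q‖ + 1) * M / (Real.sin η * Real.sin η)) *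
    (Real.exp 1 * (-Real.cos η)⁻¹), fun t ht => ?_⟩
  have tinv : Tame θ (fun z : ℂ => z⁻¹) :=
    ⟨fun z hz => (differentiableAt_inv hz.1).differentiableWithinAt, 1, zero_le_one,
      fun w _ => by rw [norm_inv, one_mul]; linarith⟩
  have t1 := hs.tame_resolvent.clm (ContinuousLinearMap.mul ℂ (X →L[ℂ] X) Q)
  have t2 := tinv.clm ((ContinuousLinearMap.id ℂ ℂ).smulRight (-Q))
  have e1 := wedge_exp_clm hη hs.tame_resolvent (ContinuousLinearMap.mul ℂ (X →L[ℂ] X) Q) ht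
  have e2 := wedge_exp_clm hη tinv ((ContinuousLinearMap.id ℂ ℂ).smulRight (-Q)) ht
  have e0 : wedge (fun z => Complex.exp (t * z) • z⁻¹) 1 η = 2 * Real.pi * Complex.I := by
    rw [wedge_exp_scale hη tinv.diff zero_le_one (fun w _ => by
      rw [norm_inv, one_mul]; linarith) ht, ← wedge_exp_inv hη]
    congr 1; ext z
    have ht' : (t : ℂ) ≠ 0 := by exact_mod_cast ht.ne'
    rw [mul_inv, inv_inv, smul_eq_mul (t : ℂ)⁻¹, inv_mul_cancel_left₀ ht']
  rw [e0] at e2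
  have e3 := wedge_exp_add hη t1 t2 ht
  rw [e1, e2] at e3
  simp only [ContinuousLinearMap.smulRight_apply, ContinuousLinearMap.id_apply,
    ContinuousLinearMap.mul_apply'] at e3
  have t3 := t1.add t2
  obtain ⟨L, hL0, hL⟩ := t3.bound
  have e4 := wedge_exp_scale hη t3.diff hL0 hL ht
  simp only [ContinuousLinearMap.smulRight_apply, ContinuousLinearMap.id_apply,
    ContinuousLinearMap.mul_apply'] at e4
  have e5 : Q * contour A ω η t - (2 * Real.pi * Complex.I : ℂ) • Q =
      Q * contour A ω η t + (2 * Real.pi * Complex.I : ℂ) • (-Q) := by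
    rw [smul_neg, sub_eq_add_neg]
  rw [e5, contour, ← e3, e4]
  refine (norm_wedge_exp_le hη
    (B := (2 * ‖Q‖ + 1) * M / (Real.sin η * Real.sin η) * t) ?_).trans ?_
  · intro e he ρ hρ
    have hm := hmem e he ρ hρ
    set w : ℂ := 1 + ρ * e with hw
    have hm' := smul_mem_sector hm (inv_pos.2 ht)
    rw [Complex.ofReal_inv] at hm'
    set z : ℂ := (t : ℂ)⁻¹ * w with hz
    have h3 : Real.sin η ≤ ‖w‖ := by
      simpa using he.le_norm_left hη (x := 1) (ρ := ρ) zero_le_one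
    have hw0 : 0 < ‖w‖ := hsin.trans_le h3
    have hz0 : z ≠ 0 := hm'.1
    have hzn : ‖z‖ = t⁻¹ * ‖w‖ := by
      rw [hz, norm_mul, norm_inv, Complex.norm_real, Real.norm_of_nonneg ht.le]
    have hR := (hs.isResolventAt hm').sub_eq (hs.isResolventAt h2)
    rw [((hs.isResolventAt hm').commute (hs.isResolventAt h2)).eq, ← hQ] at hR
    set R := resolvent A (ω + z) with hRdef
    have h4 : Q * R + z⁻¹ • (-Q) = z⁻¹ • ((2 : ℂ) • (Q * R) - R) := by
      have : R = Q + ((ω + 2 : ℂ) - (ω + z)) • (Q * R) := by rw [← hR]; abel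
      have h5 : (2 : ℂ) • (Q * R) - R = z • (Q * R) - Q := by
        nth_rw 2 [this]
        rw [← sub_sub, sub_right_comm, ← sub_smul]
        congr 2; ring
      rw [h5, smul_sub, smul_smul, inv_mul_cancel₀ hz0, one_smul, smul_neg, sub_eq_add_neg]
    have h6 : ‖(2 : ℂ) • (Q * R) - R‖ ≤ (2 * ‖Q‖ + 1) * (M / ‖z‖) := by
      have h7 : ‖R‖ ≤ M / ‖z‖ := hs.norm_le hm'
      calc _ ≤ ‖(2 : ℂ) • (Q * R)‖ + ‖R‖ := norm_sub_le _ _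
        _ ≤ 2 * (‖Q‖ * ‖R‖) + ‖R‖ := by
          rw [norm_smul, Complex.norm_two]; gcongr; exact norm_mul_le _ _
        _ = (2 * ‖Q‖ + 1) * ‖R‖ := by ring
        _ ≤ _ := by gcongr
    rw [h4, norm_smul, norm_smul, norm_inv, norm_inv, Complex.norm_real,
      Real.norm_of_nonneg ht.le]
    calc t⁻¹ * (‖z‖⁻¹ * _) ≤ t⁻¹ * (‖z‖⁻¹ * ((2 * ‖Q‖ + 1) * (M / ‖z‖))) := by gcongr
      _ = (2 * ‖Q‖ + 1) * M / (‖w‖ * ‖w‖) * t := by rw [hzn]; field_simp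
      _ ≤ _ := by gcongr
  · apply le_of_eq; ring

end Sectorial

/-! ### Semigroup calculus without density of the domain -/

section Semigroup

variable {X : Type*} [NormedAddCommGroup X] [NormedSpace ℂ X]
  {A : X →ₗ.[ℂ] X} {S S' : ℝ → X →L[ℂ] X} {μ : ℂ} {R : X →L[ℂ] X}

/-- The analytic semigroup `S` generated by `A`, with `S' t = A (S t)` and `R = (μ - A)⁻¹`. -/
structure IsAnalyticSemigroup (A : X →ₗ.[ℂ] X) (S S' : ℝ → X →L[ℂ] X) (μ : ℂ) (R : X →L[ℂ] X) :
    Prop where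
  zero : S 0 = 1
  hasDerivAt : ∀ t, 0 < t → HasDerivAt S (S' t) t
  resolvent : IsResolventAt A μ R
  eq_mul : ∀ t, 0 < t → S t = R * (μ • S t - S' t)
  commute_pos : ∀ t, 0 < t → Commute R (S t)
  tendsto : Tendsto (fun t => R * S t) (𝓝[>] 0) (𝓝 R)
  bound : ∀ L : ℝ, 0 < L → ∃ N : ℝ, 0 ≤ N ∧ ∀ t, 0 < t → t ≤ L → ‖S t‖ ≤ N ∧ ‖S' t‖ ≤ N / t

theorem IsSectorial.semigroup_eq (hA : IsSectorial A) : ∃ ω θ M η : ℝ, IsSectorialWith A ω θ M ∧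
    IsAngle η θ ∧ ∀ t, 0 < t → semigroup A t =
      (2 * Real.pi * Complex.I : ℂ)⁻¹ • Complex.exp (t * ω) • contour A ω η t := by
  obtain ⟨M, hM⟩ := hA.choose_spec.choose_spec
  refine ⟨hA.choose, hA.choose_spec.choose, M, (Real.pi / 2 + hA.choose_spec.choose) / 2, hM,
    ⟨?_, ?_, hM.angle_lt⟩, fun t ht => ?_⟩
  · linarith [hM.angle_gt]
  · linarith [hM.angle_gt]
  · rw [semigroup, dif_pos hA, if_pos ht, dunford_eq]

theorem IsSectorial.exists_isAnalyticSemigroup [CompleteSpace X] (hA : IsSectorial A) :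
    ∃ S' μ R, IsAnalyticSemigroup A (semigroup A) S' μ R := by
  obtain ⟨ω, θ, M, η, hs, hη, hS⟩ := hA.semigroup_eq
  have h2 : (2 : ℂ) ∈ sector θ := by exact_mod_cast hs.pos_mem_sector (r := 2) two_pos
  set c : ℂ := (2 * Real.pi * Complex.I : ℂ)⁻¹ with hc
  refine ⟨fun t => c • (Complex.exp (t * ω) • contourDeriv A ω η t +
    (Complex.exp (t * ω) * ω) • contour A ω η t), ω + 2, resolvent A (ω + 2), ?_, ?_,
    hs.isResolventAt h2, ?_, ?_, ?_, ?_⟩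
  · rw [semigroup, dif_pos hA, if_neg (lt_irrefl 0)]
  · intro t ht
    have h1 : HasDerivAt (fun s : ℝ => Complex.exp (s * ω)) (Complex.exp (t * ω) * ω) t := by
      have : HasDerivAt (fun s : ℝ => (s : ℂ) * ω) ω t := by
        simpa using (Complex.ofRealCLM.hasDerivAt (x := t)).mul_const (ω : ℂ)
      exact (Complex.hasDerivAt_exp _).comp t this
    have h3 := (h1.smul (hasDerivAt_contour hs hη ht)).const_smul c
    refine h3.congr_of_eventuallyEq ?_
    filter_upwards [eventually_gt_nhds ht] with s hs'
    exact hS s hs'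
  · intro t ht
    rw [hS t ht]
    nth_rw 1 [contour_eq hs hη ht]
    rw [← mul_smul_comm, ← mul_smul_comm]
    congr 1
    module
  · intro t ht
    rw [hS t ht]
    exact ((commute_contour hs hη ht).smul_right _).smul_right _
  · obtain ⟨C, hC⟩ := norm_resolvent_mul_contour_le hs hη
    have h3 : Tendsto (fun t => resolvent A (ω + 2) * contour A ω η t) (𝓝[>] 0)
        (𝓝 ((2 * Real.pi * Complex.I : ℂ) • resolvent A (ω + 2))) := by
      rw [tendsto_iff_norm_sub_tendsto_zero]
      have h4 : Tendsto (fun t : ℝ => C * t) (𝓝[>] 0) (𝓝 0) := by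
        have : Continuous fun t : ℝ => C * t := by fun_prop
        simpa using (this.tendsto 0).mono_left nhdsWithin_le_nhds
      refine squeeze_zero' (Eventually.of_forall fun _ => norm_nonneg _) ?_ h4
      filter_upwards [self_mem_nhdsWithin] with t ht
      exact hC t ht
    have h5 : Tendsto (fun t : ℝ => Complex.exp (t * ω)) (𝓝[>] 0) (𝓝 1) := by
      have : Continuous fun t : ℝ => Complex.exp (t * ω) := by fun_prop
      simpa using (this.tendsto 0).mono_left nhdsWithin_le_nhds
    have h6 := (h5.smul h3).const_smul c
    rw [one_smul, smul_smul, hc, inv_mul_cancel₀ two_pi_I_ne_zero, one_smul] at h6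
    refine h6.congr' ?_
    filter_upwards [self_mem_nhdsWithin] with t ht
    rw [hS t ht, mul_smul_comm, mul_smul_comm]
  · intro L hL
    obtain ⟨C, hC0, hC⟩ := norm_contour_le hs hη
    refine ⟨‖c‖ * (Real.exp (L * |ω|) * C + Real.exp (L * |ω|) * |ω| * C * L) +
      ‖c‖ * (Real.exp (L * |ω|) * C), by positivity, fun t ht htL => ?_⟩
    obtain ⟨h3, h4⟩ := hC t ht
    have h5 : ‖Complex.exp (t * ω)‖ ≤ Real.exp (L * |ω|) := by
      rw [Complex.norm_exp]
      apply Real.exp_le_exp.2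
      have h6 := le_abs_self ω
      have h7 := abs_nonneg ω
      have : ((t : ℂ) * ω).re = t * ω := by simp
      rw [this]
      calc t * ω ≤ t * |ω| := by gcongr
        _ ≤ L * |ω| := by gcongr
    constructor
    · rw [hS t ht, norm_smul, norm_smul]
      calc _ ≤ ‖c‖ * (Real.exp (L * |ω|) * C) := by gcongr
        _ ≤ _ := le_add_of_nonneg_left (by positivity)
    · rw [norm_smul]
      calc _ ≤ ‖c‖ * (Real.exp (L * |ω|) * (C / t) + Real.exp (L * |ω|) * |ω| * C) := by
            gcongr
            refine (norm_add_le _ _).trans ?_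
            rw [norm_smul, norm_smul, norm_mul, Complex.norm_real, Real.norm_eq_abs]
            gcongr
        _ = ‖c‖ * (Real.exp (L * |ω|) * C + Real.exp (L * |ω|) * |ω| * C * t) / t := by
            field_simp
        _ ≤ _ := by
            gcongr
            refine le_trans ?_ (le_add_of_nonneg_right (by positivity))
            gcongr

namespace IsAnalyticSemigroup

variable (h : IsAnalyticSemigroup A S S' μ R)
include h

theorem commute {t : ℝ} (ht : 0 ≤ t) : Commute R (S t) := by
  rcases ht.eq_or_lt with rfl | ht
  · rw [h.zero]; exact Commute.one_right _
  · exact h.commute_pos t ht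

theorem continuousAt {t : ℝ} (ht : 0 < t) : ContinuousAt S t := (h.hasDerivAt t ht).continuousAt

theorem continuousOn : ContinuousOn S (Ioi 0) := fun _ ht => (h.continuousAt ht).continuousWithinAt

/-- Operators commuting with the semigroup commute with its derivative. -/
theorem commute_deriv {B : X →L[ℂ] X} (hB : ∀ t, 0 < t → Commute B (S t)) {t : ℝ} (ht : 0 < t) :
    Commute B (S' t) := by
  have h1 : HasDerivAt (fun t => B * S t) (B * S' t) t := (h.hasDerivAt t ht).const_mul B
  have h2 : HasDerivAt (fun t => S t * B) (S' t * B) t := (h.hasDerivAt t ht).mul_const B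
  refine h1.unique (h2.congr_of_eventuallyEq ?_)
  filter_upwards [eventually_gt_nhds ht] with s hs
  exact (hB s hs).eq

theorem resolvent_mul_deriv {t : ℝ} (ht : 0 < t) : R * S' t = μ • (R * S t) - S t := by
  nth_rw 2 [h.eq_mul t ht]
  rw [mul_sub, mul_smul_comm]; abel

theorem apply_mem {t : ℝ} (ht : 0 < t) (x : X) : ∃ hx : S t x ∈ A.domain, A ⟨S t x, hx⟩ = S' t x :=
  h.resolvent.apply_of_eq (by simpa using congrArg (· x) (h.eq_mul t ht))

/-- Both sides are `A S(s) S(t)`: write `S t = R (μ S t - S' t)` and let `S' s` absorb `R`. -/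
theorem deriv_mul {s t : ℝ} (hs : 0 < s) (ht : 0 < t) : S' s * S t = S s * S' t := by
  have h1 : S' s * R = μ • (S s * R) - S s := by
    rw [← (h.commute_deriv h.commute_pos hs).eq, h.resolvent_mul_deriv hs, (h.commute_pos s hs).eq]
  rw [h.eq_mul t ht, ← mul_assoc, h1, sub_mul, smul_mul_assoc, mul_assoc, ← h.eq_mul t ht, mul_sub,
    mul_smul_comm]
  abel

theorem eq_of_resolvent_mul {B C : X →L[ℂ] X} (hBC : R * B = R * C) : B = C := by
  ext x
  exact h.resolvent.injective (by simpa using congrArg (· x) hBC)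

/-- By `deriv_mul` the product `S (t - r) * S r` has zero derivative on `(0, t)`. Its limit as `r →
0` is accessible only after inserting `R`, because `S r` itself need not converge to `1`; `R` is
then cancelled by injectivity. -/
theorem mul_sub_eq {t r : ℝ} (hr : 0 < r) (hrt : r < t) : S (t - r) * S r = S t := by
  have ht : 0 < t := hr.trans hrt
  have hd : ∀ x ∈ Ioo 0 t, HasDerivAt (fun r => S (t - r) * S r) 0 x := by
    intro x hx
    have h1 : HasDerivAt (fun r => S (t - r)) (-S' (t - x)) x :=
      (h.hasDerivAt (t - x) (by linarith [hx.2])).comp_const_sub t x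
    refine (h1.mul (h.hasDerivAt x hx.1)).congr_deriv ?_
    rw [neg_mul, h.deriv_mul (by linarith [hx.2]) hx.1, neg_add_cancel]
  have hconst : ∀ x ∈ Ioo 0 t, S (t - x) * S x = S (t - r) * S r := by
    intro x hx
    exact isOpen_Ioo.is_const_of_deriv_eq_zero isPreconnected_Ioo
      (fun y hy => (hd y hy).differentiableAt.differentiableWithinAt)
      (fun y hy => (hd y hy).deriv) hx ⟨hr, hrt⟩
  have hlim : Tendsto (fun x => S (t - x) * (R * S x)) (𝓝[>] 0) (𝓝 (S t * R)) := by
    refine Tendsto.mul ?_ h.tendsto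
    have h3 : Tendsto (fun x : ℝ => t - x) (𝓝[>] 0) (𝓝 t) := by
      have : Continuous fun x : ℝ => t - x := by fun_prop
      simpa using (this.tendsto 0).mono_left nhdsWithin_le_nhds
    exact (h.continuousAt ht).tendsto.comp h3
  have hlim2 : Tendsto (fun x => S (t - x) * (R * S x)) (𝓝[>] 0) (𝓝 (R * (S (t - r) * S r))) := by
    refine tendsto_const_nhds.congr' ?_
    filter_upwards [Ioo_mem_nhdsGT ht] with x hx
    rw [← hconst x hx, ← mul_assoc, ← mul_assoc, (h.commute_pos (t - x) (by linarith [hx.2])).eq]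
  apply h.eq_of_resolvent_mul
  rw [tendsto_nhds_unique hlim2 hlim, (h.commute_pos t ht).eq]

theorem add {s t : ℝ} (hs : 0 ≤ s) (ht : 0 ≤ t) : S (s + t) = S s * S t := by
  rcases ht.eq_or_lt with rfl | ht
  · rw [add_zero, h.zero, mul_one]
  rcases hs.eq_or_lt with rfl | hs
  · rw [zero_add, h.zero, one_mul]
  · have := h.mul_sub_eq (t := s + t) ht (by linarith)
    rw [add_sub_cancel_right] at this
    exact this.symm

theorem commute_self {s t : ℝ} (hs : 0 ≤ s) (ht : 0 ≤ t) : Commute (S s) (S t) := by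
  rw [Commute, SemiconjBy, ← h.add hs ht, ← h.add ht hs, add_comm]

theorem nsmul {t : ℝ} (ht : 0 ≤ t) (n : ℕ) : S (n * t) = S t ^ n := by
  induction n with
  | zero => simp [h.zero]
  | succ n ih =>
    rw [Nat.cast_succ, add_one_mul, h.add (by positivity) ht, ih, pow_succ]

theorem deriv_add {s t : ℝ} (hs : 0 < s) (ht : 0 ≤ t) : S' (s + t) = S' s * S t := by
  have h1 : HasDerivAt (fun r => S (r + t)) (S' (s + t)) s :=
    (h.hasDerivAt (s + t) (by linarith)).comp_add_const s t
  have h2 : HasDerivAt (fun r => S r * S t) (S' s * S t) s := (h.hasDerivAt s hs).mul_const _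
  refine h1.unique (h2.congr_of_eventuallyEq ?_)
  filter_upwards [eventually_gt_nhds hs] with r hr
  exact h.add hr.le ht

theorem deriv_add' {s t : ℝ} (hs : 0 ≤ s) (ht : 0 < t) : S' (s + t) = S s * S' t := by
  rw [add_comm, h.deriv_add ht hs]
  exact ((h.commute_deriv (fun r hr => h.commute_self hs hr.le) ht).eq).symm

theorem continuousAt_deriv {t : ℝ} (ht : 0 < t) : ContinuousAt S' t := by
  have h1 : ContinuousAt (fun r => S' (t / 2) * S (r - t / 2)) t := by
    refine continuousAt_const.mul ?_
    have : ContinuousAt S (t - t / 2) := h.continuousAt (by linarith)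
    exact ContinuousAt.comp (f := fun r => r - t / 2) this (by fun_prop)
  refine h1.congr ?_
  filter_upwards [eventually_gt_nhds (show t / 2 < t by linarith)] with r hr
  rw [← h.deriv_add (by linarith) (by linarith)]
  congr 1; ring

theorem continuousOn_deriv : ContinuousOn S' (Ioi 0) :=
  fun _ ht => (h.continuousAt_deriv ht).continuousWithinAt

theorem continuousOn_resolvent_mul : ContinuousOn (fun t => R * S t) (Ici 0) := by
  intro t ht
  rcases (mem_Ici.1 ht).eq_or_lt with rfl | ht
  · rw [← continuousWithinAt_Ioi_iff_Ici, ContinuousWithinAt, h.zero, mul_one]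
    exact h.tendsto
  · exact (continuousAt_const.mul (h.continuousAt ht)).continuousWithinAt

theorem exists_bound (L : ℝ) : ∃ N : ℝ, 1 ≤ N ∧ (∀ t, 0 ≤ t → t ≤ L → ‖S t‖ ≤ N) ∧
    ∀ t, 0 < t → t ≤ L → ‖S' t‖ ≤ N / t := by
  obtain ⟨N, hN0, hN⟩ := h.bound (max L 1) (by positivity)
  refine ⟨max N 1, le_max_right _ _, fun t ht htL => ?_, fun t ht htL => ?_⟩
  · rcases ht.eq_or_lt with rfl | ht
    · rw [h.zero]
      exact (ContinuousLinearMap.norm_id_le).trans (le_max_right _ _)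
    · exact (hN t ht (htL.trans (le_max_left _ _))).1.trans (le_max_left _ _)
  · refine ((hN t ht (htL.trans (le_max_left _ _))).2).trans ?_
    gcongr
    exact le_max_left _ _

theorem app_eq {t : ℝ} (ht : 0 < t) (x : X) : app A (S t x) = S' t x := by
  obtain ⟨h1, h2⟩ := h.apply_mem ht x
  rw [app, dif_pos h1, h2]

theorem deriv_apply_of_mem {x : A.domain} {t : ℝ} (ht : 0 < t) : S' t x = S t (A x) := by
  have h1 := h.resolvent.2 x
  set v := μ • (x : X) - A x with hv
  have h2 : S' t * R = μ • (S t * R) - S t := by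
    rw [← (h.commute_deriv h.commute_pos ht).eq, h.resolvent_mul_deriv ht, (h.commute_pos t ht).eq]
  have h3 := congrArg (· v) h2
  simp only [mul_apply_eq_comp, sub_apply, smul_apply, h1] at h3
  rw [h3, hv, map_sub, map_smul]; abel

/-- A vector of the domain has the form `R v`, and `R (S t) v → R v`. -/
theorem tendsto_apply_of_mem (x : A.domain) : Tendsto (fun t => S t x) (𝓝[>] 0) (𝓝 (x : X)) := by
  have h1 := h.resolvent.2 x
  set v := μ • (x : X) - A x with hv
  have h2 : Tendsto (fun t => (R * S t) v) (𝓝[>] 0) (𝓝 (R v)) :=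
    ((ContinuousLinearMap.apply ℂ X v).continuous.tendsto R).comp h.tendsto
  rw [h1] at h2
  refine h2.congr' ?_
  filter_upwards [self_mem_nhdsWithin] with t ht
  rw [(h.commute_pos t ht).eq, mul_apply_eq_comp, h1]

end IsAnalyticSemigroup

end Semigroup

/-! ### Integrals on an open interval, and the weights of the φ-functions -/

section Integration

variable {E : Type*} [NormedAddCommGroup E] {a b : ℝ} {g : ℝ → E} {C : ℝ → ℝ}

theorem ae_of_forall_Ioo {p : ℝ → Prop} (h : ∀ x ∈ Ioo a b, p x) :
    ∀ᵐ x, x ∈ Ioc a b → p x := by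
  have : ∀ᵐ x : ℝ, x ≠ b := by simp [ae_iff]
  filter_upwards [this] with x hx hx'
  exact h x ⟨hx'.1, lt_of_le_of_ne hx'.2 hx⟩

theorem intervalIntegrable_of_norm_le (hab : a ≤ b) (hg : ContinuousOn g (Ioo a b))
    (hC : IntervalIntegrable C volume a b) (h : ∀ x ∈ Ioo a b, ‖g x‖ ≤ C x) :
    IntervalIntegrable g volume a b := by
  rw [intervalIntegrable_iff_integrableOn_Ioo_of_le hab] at hC ⊢
  refine Integrable.mono' hC (hg.aestronglyMeasurable measurableSet_Ioo) ?_
  filter_upwards [ae_restrict_mem measurableSet_Ioo] with x hx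
  exact h x hx

theorem norm_integral_le_of_norm_le_Ioo [NormedSpace ℝ E] (hab : a ≤ b)
    (hC : IntervalIntegrable C volume a b) (h : ∀ x ∈ Ioo a b, ‖g x‖ ≤ C x) :
    ‖∫ x in a..b, g x‖ ≤ ∫ x in a..b, C x :=
  intervalIntegral.norm_integral_le_of_norm_le hab (ae_of_forall_Ioo h) hC

end Integration

/-- The weight `ξ^k / k!`. -/
def weight (k : ℕ) (ξ : ℝ) : ℝ := ξ ^ k / (k.factorial : ℝ)

/-- The derivative of `weight k`. -/
def weightDeriv (k : ℕ) (ξ : ℝ) : ℝ := (k * ξ ^ (k - 1)) / (k.factorial : ℝ)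

theorem continuous_weight (k : ℕ) : Continuous (weight k) := by unfold weight; fun_prop

theorem continuous_weightDeriv (k : ℕ) : Continuous (weightDeriv k) := by
  unfold weightDeriv; fun_prop

theorem hasDerivAt_weight (k : ℕ) (ξ : ℝ) : HasDerivAt (weight k) (weightDeriv k ξ) ξ :=
  (hasDerivAt_pow k ξ).div_const _

theorem weight_nonneg (k : ℕ) {ξ : ℝ} (h0 : 0 ≤ ξ) : 0 ≤ weight k ξ := by
  unfold weight; positivity

theorem weight_le_one (k : ℕ) {ξ : ℝ} (h0 : 0 ≤ ξ) (h1 : ξ ≤ 1) : weight k ξ ≤ 1 := by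
  unfold weight
  have : (1 : ℝ) ≤ k.factorial := by exact_mod_cast k.factorial_pos
  exact div_le_one_of_le₀ ((pow_le_one₀ h0 h1).trans this) (by positivity)

theorem norm_weight_le (k : ℕ) {ξ : ℝ} (h0 : 0 ≤ ξ) (h1 : ξ ≤ 1) : ‖(weight k ξ : ℂ)‖ ≤ 1 := by
  rw [Complex.norm_real, Real.norm_of_nonneg (weight_nonneg k h0)]
  exact weight_le_one k h0 h1

theorem norm_weightDeriv_le (k : ℕ) {ξ : ℝ} (h0 : 0 ≤ ξ) (h1 : ξ ≤ 1) :
    ‖(weightDeriv k ξ : ℂ)‖ ≤ k := by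
  have h2 : (1 : ℝ) ≤ k.factorial := by exact_mod_cast k.factorial_pos
  have h3 : ξ ^ (k - 1) ≤ 1 := pow_le_one₀ h0 h1
  have h4 : 0 ≤ ξ ^ (k - 1) := by positivity
  rw [Complex.norm_real, weightDeriv, Real.norm_of_nonneg (by positivity)]
  rw [div_le_iff₀ (by positivity)]
  gcongr
  linarith

theorem integral_weight (k : ℕ) : ∫ ξ in (0 : ℝ)..1, weight k ξ = (((k + 1).factorial : ℝ))⁻¹ := by
  unfold weight
  rw [intervalIntegral.integral_div, integral_pow]
  rw [Nat.factorial_succ]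
  push_cast
  have : ((k : ℝ) + 1) ≠ 0 := by positivity
  field_simp
  simp

section Apply

variable {X : Type*} [NormedAddCommGroup X] [NormedSpace ℂ X]

theorem hasDerivAt_clm_apply {G : ℝ → X →L[ℂ] X} {G' : X →L[ℂ] X} {f : ℝ → X} {f' : X} {s : ℝ}
    (hG : HasDerivAt G G' s) (hf : HasDerivAt f f' s) :
    HasDerivAt (fun s => G s (f s)) (G' (f s) + G s f') s := by
  have h1 := ((ContinuousLinearMap.restrictScalarsL ℂ X X ℝ ℝ).hasFDerivAt).comp_hasDerivAt s hG
  exact h1.clm_apply hf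

end Apply

/-! ### The φ-functions: smoothing and domains -/

section Phi

variable {X : Type*} [NormedAddCommGroup X] [NormedSpace ℂ X]
  {A : X →ₗ.[ℂ] X} {S S' : ℝ → X →L[ℂ] X} {μ : ℂ} {R : X →L[ℂ] X}

/-- `φ_{k+1}` of the semigroup `S`. -/
def phiOf (S : ℝ → X →L[ℂ] X) (k : ℕ) (t : ℝ) : X →L[ℂ] X :=
  ∫ ξ in (0 : ℝ)..1, (weight k ξ : ℂ) • S ((1 - ξ) * t)

namespace IsAnalyticSemigroup

variable (h : IsAnalyticSemigroup A S S' μ R)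
include h

theorem continuousOn_comp {t : ℝ} (ht : 0 < t) :
    ContinuousOn (fun ξ => S ((1 - ξ) * t)) (Ioo 0 1) :=
  h.continuousOn.comp (by fun_prop) fun _ hξ => mul_pos (sub_pos.2 hξ.2) ht

theorem continuousOn_resolvent_comp {t : ℝ} (ht : 0 < t) :
    ContinuousOn (fun ξ => R * S ((1 - ξ) * t)) (Icc 0 1) :=
  h.continuousOn_resolvent_mul.comp (f := fun ξ : ℝ => (1 - ξ) * t) (by fun_prop)
    fun _ hξ => mul_nonneg (sub_nonneg.2 hξ.2) ht.le

theorem hasDerivAt_comp {t : ℝ} (ht : 0 < t) {ξ : ℝ} (hξ : ξ < 1) :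
    HasDerivAt (fun ξ => S ((1 - ξ) * t)) (-(t : ℂ) • S' ((1 - ξ) * t)) ξ := by
  have h0 : HasDerivAt (fun ξ : ℝ => (1 - ξ) * t) (-t) ξ := by
    simpa using ((hasDerivAt_id ξ).const_sub 1).mul_const t
  have h1 := (h.hasDerivAt ((1 - ξ) * t) (mul_pos (sub_pos.2 hξ) ht)).scomp ξ h0
  refine h1.congr_deriv ?_
  rw [← Complex.coe_smul, Complex.ofReal_neg]

theorem intervalIntegrable_smul {t : ℝ} (ht : 0 < t) {p : ℝ → ℝ} (hp : Continuous p) :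
    IntervalIntegrable (fun ξ => (p ξ : ℂ) • S ((1 - ξ) * t)) volume 0 1 := by
  obtain ⟨N, hN1, hN, -⟩ := h.exists_bound t
  refine intervalIntegrable_of_norm_le zero_le_one
    (ContinuousOn.smul (Complex.continuous_ofReal.comp hp).continuousOn (h.continuousOn_comp ht)) (C := fun ξ => |p ξ| * N)
    (Continuous.intervalIntegrable (by fun_prop) _ _) fun ξ hξ => ?_
  rw [norm_smul, Complex.norm_real, Real.norm_eq_abs]
  gcongr
  exact hN _ (mul_nonneg (sub_nonneg.2 hξ.2.le) ht.le) (by nlinarith [hξ.1, hξ.2])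

omit h in
theorem norm_integral_smul_le {t : ℝ} (ht : 0 < t) {p : ℝ → ℝ} {N c : ℝ} (hc : 0 ≤ c)
    (hN : ∀ r, 0 ≤ r → r ≤ t → ‖S r‖ ≤ N) (hp : ∀ ξ, 0 ≤ ξ → ξ ≤ 1 → ‖(p ξ : ℂ)‖ ≤ c) :
    ‖∫ ξ in (0 : ℝ)..1, (p ξ : ℂ) • S ((1 - ξ) * t)‖ ≤ c * N := by
  have := norm_integral_le_of_norm_le_Ioo (g := fun ξ => (p ξ : ℂ) • S ((1 - ξ) * t))
    (C := fun _ => c * N) zero_le_one intervalIntegrable_const (fun ξ hξ => by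
      rw [norm_smul]
      have h1 := hp ξ hξ.1.le hξ.2.le
      have h2 := hN ((1 - ξ) * t) (mul_nonneg (sub_nonneg.2 hξ.2.le) ht.le)
        (by nlinarith [hξ.1, hξ.2])
      gcongr)
  simpa using this

omit h in
theorem norm_phiOf_le (k : ℕ) {t N : ℝ} (ht : 0 < t)
    (hN : ∀ r, 0 ≤ r → r ≤ t → ‖S r‖ ≤ N) : ‖phiOf S k t‖ ≤ N :=
  (norm_integral_smul_le ht zero_le_one hN (fun _ h0 h1 => norm_weight_le k h0 h1)).trans_eq
    (one_mul N)

theorem phiOf_apply (k : ℕ) {t : ℝ} (ht : 0 < t) (x : X) :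
    phiOf S k t x = ∫ ξ in (0 : ℝ)..1, (weight k ξ : ℂ) • S ((1 - ξ) * t) x := by
  rw [phiOf, ContinuousLinearMap.intervalIntegral_apply
    (h.intervalIntegrable_smul ht (continuous_weight k))]
  simp only [smul_apply]

theorem integral_mul_smul [CompleteSpace X] {t : ℝ} (ht : 0 < t) {p : ℝ → ℝ} (hp : Continuous p)
    (B : X →L[ℂ] X) :
    IntervalIntegrable (fun ξ => B * ((p ξ : ℂ) • S ((1 - ξ) * t))) volume 0 1 ∧
      ∫ ξ in (0 : ℝ)..1, B * ((p ξ : ℂ) • S ((1 - ξ) * t)) =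
        B * ∫ ξ in (0 : ℝ)..1, (p ξ : ℂ) • S ((1 - ξ) * t) := by
  have i := h.intervalIntegrable_smul ht hp
  exact ⟨⟨(ContinuousLinearMap.mul ℂ (X →L[ℂ] X) B).integrable_comp i.1,
    (ContinuousLinearMap.mul ℂ (X →L[ℂ] X) B).integrable_comp i.2⟩,
    (ContinuousLinearMap.mul ℂ (X →L[ℂ] X) B).intervalIntegral_comp_comm i⟩

/-- Here `Y` is `A` applied to `phiOf S k t`. Since `t A S((1-ξ)t)` is minus the `ξ`-derivative of
`S((1-ξ)t)`, integration by parts gives `Y`; it is done under `R`, because only `R * S` is known to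
be norm continuous up to time `0`. In the constant, `k` comes from the derivative of the weight and
each boundary term adds `1`. -/
theorem exists_phiOf_eq [CompleteSpace X] (k : ℕ) {t N : ℝ} (ht : 0 < t) (hN1 : 1 ≤ N)
    (hN : ∀ r, 0 ≤ r → r ≤ t → ‖S r‖ ≤ N) :
    ∃ Y : X →L[ℂ] X, phiOf S k t = R * (μ • phiOf S k t - Y) ∧ ‖Y‖ ≤ (k + 2) * N / t := by
  set D : X →L[ℂ] X := ∫ ξ in (0 : ℝ)..1, (weightDeriv k ξ : ℂ) • S ((1 - ξ) * t) with hD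
  have i1 := h.intervalIntegrable_smul ht (continuous_weight k)
  have i2 := h.intervalIntegrable_smul ht (continuous_weightDeriv k)
  have ht' : (t : ℂ) ≠ 0 := by exact_mod_cast ht.ne'
  refine ⟨(t : ℂ)⁻¹ • (D - (weight k 1 : ℂ) • 1 + (weight k 0 : ℂ) • S t), ?_, ?_⟩
  · have hd : ∀ ξ ∈ Ioo (0 : ℝ) 1, HasDerivAt (fun ξ => (weight k ξ : ℂ) • (R * S ((1 - ξ) * t)))
        (R * ((weightDeriv k ξ : ℂ) • S ((1 - ξ) * t)) -
          (t * μ) • (R * ((weight k ξ : ℂ) • S ((1 - ξ) * t))) +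
          (t : ℂ) • ((weight k ξ : ℂ) • S ((1 - ξ) * t))) ξ := by
      intro ξ hξ
      have h1 := ((hasDerivAt_weight k ξ).ofReal_comp).smul
        ((h.hasDerivAt_comp ht hξ.2).const_mul R)
      refine h1.congr_deriv ?_
      rw [mul_smul_comm, h.resolvent_mul_deriv (mul_pos (sub_pos.2 hξ.2) ht), mul_smul_comm,
        mul_smul_comm]
      module
    obtain ⟨j1, k1⟩ := h.integral_mul_smul ht (continuous_weight k) R
    obtain ⟨j2, k2⟩ := h.integral_mul_smul ht (continuous_weightDeriv k) R
    have j3 : IntervalIntegrable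
        (fun ξ => (t * μ) • (R * ((weight k ξ : ℂ) • S ((1 - ξ) * t)))) volume 0 1 := j1.smul ((t : ℂ) * μ)
    have i3 : IntervalIntegrable
        (fun ξ => (t : ℂ) • ((weight k ξ : ℂ) • S ((1 - ξ) * t))) volume 0 1 := i1.smul (t : ℂ)
    have hint := intervalIntegral.integral_eq_sub_of_hasDerivAt_of_le zero_le_one
      (f := fun ξ => (weight k ξ : ℂ) • (R * S ((1 - ξ) * t)))
      (ContinuousOn.smul (Complex.continuous_ofReal.comp (continuous_weight k)).continuousOn
        (h.continuousOn_resolvent_comp ht)) hd ((j2.sub j3).add i3)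
    rw [intervalIntegral.integral_add (j2.sub j3) i3,
      intervalIntegral.integral_sub j2 j3, intervalIntegral.integral_smul,
      intervalIntegral.integral_smul, k1, k2] at hint
    simp only [sub_self, zero_mul, h.zero, mul_one, sub_zero, one_mul] at hint
    rw [← hD] at hint
    change R * D - (t * μ) • (R * phiOf S k t) + (t : ℂ) • phiOf S k t = _ at hint
    have h5 : (t : ℂ) • phiOf S k t = (t : ℂ) • (R * (μ • phiOf S k t -
        (t : ℂ)⁻¹ • (D - (weight k 1 : ℂ) • 1 + (weight k 0 : ℂ) • S t))) := by
      rw [← eq_sub_iff_add_eq'] at hint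
      rw [hint, mul_sub, smul_sub, mul_smul_comm, mul_smul_comm (t : ℂ)⁻¹,
        smul_inv_smul₀ ht', mul_add, mul_sub, mul_smul_comm, mul_smul_comm, mul_one]
      module
    exact smul_right_injective (M := X →L[ℂ] X) ht' h5
  · have e1 : ‖D‖ ≤ k * N := norm_integral_smul_le ht (Nat.cast_nonneg k) hN
      (fun ξ h0 h1 => norm_weightDeriv_le k h0 h1)
    have e2 : ‖(weight k 1 : ℂ) • (1 : X →L[ℂ] X)‖ ≤ N := by
      rw [norm_smul]
      calc _ ≤ 1 * 1 := mul_le_mul (norm_weight_le k zero_le_one le_rfl)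
            ContinuousLinearMap.norm_id_le (norm_nonneg _) zero_le_one
        _ ≤ N := by linarith
    have e3 : ‖(weight k 0 : ℂ) • S t‖ ≤ N := by
      rw [norm_smul]
      calc _ ≤ 1 * N := mul_le_mul (norm_weight_le k le_rfl zero_le_one)
            (hN t ht.le le_rfl) (norm_nonneg _) zero_le_one
        _ = N := one_mul N
    rw [norm_smul, norm_inv, Complex.norm_real, Real.norm_of_nonneg ht.le, div_eq_inv_mul]
    gcongr
    refine (norm_add_le _ _).trans ?_
    have := norm_sub_le D ((weight k 1 : ℂ) • (1 : X →L[ℂ] X))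
    linarith

/-- `∫_0^r S(s) f(s) ds` lies in `D(A)` for continuously differentiable `f`. -/
theorem integral_mem [CompleteSpace X] {r C : ℝ} (hr : 0 < r) {f f' : ℝ → X}
    (hf : ContinuousOn f (Icc 0 r)) (hd : ∀ s ∈ Ioo 0 r, HasDerivAt f (f' s) s)
    (hf' : ContinuousOn f' (Ioo 0 r)) (hC : ∀ s ∈ Ioo 0 r, ‖f' s‖ ≤ C) :
    ∃ hx : (∫ s in (0 : ℝ)..r, S s (f s)) ∈ A.domain,
      A ⟨_, hx⟩ = S r (f r) - f 0 - ∫ s in (0 : ℝ)..r, S s (f' s) := by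
  obtain ⟨N, hN1, hN, -⟩ := h.exists_bound r
  obtain ⟨B, hB⟩ := isCompact_Icc.exists_bound_of_continuousOn hf
  have hSI : ContinuousOn S (Ioo 0 r) := h.continuousOn.mono Ioo_subset_Ioi_self
  have i1 : IntervalIntegrable (fun s => S s (f s)) volume 0 r :=
    intervalIntegrable_of_norm_le hr.le (hSI.clm_apply (hf.mono Ioo_subset_Icc_self))
      (C := fun _ => N * B) intervalIntegrable_const fun s hs => by
        refine ((S s).le_opNorm _).trans ?_
        have h1 := hN s hs.1.le hs.2.le
        have h2 := hB s (Ioo_subset_Icc_self hs)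
        gcongr
  have i2 : IntervalIntegrable (fun s => S s (f' s)) volume 0 r :=
    intervalIntegrable_of_norm_le hr.le (hSI.clm_apply hf')
      (C := fun _ => N * C) intervalIntegrable_const fun s hs => by
        refine ((S s).le_opNorm _).trans ?_
        have h1 := hN s hs.1.le hs.2.le
        have h2 := hC s hs
        gcongr
  have j : ∀ g : ℝ → X, IntervalIntegrable g volume 0 r →
      IntervalIntegrable (fun s => R (g s)) volume 0 r := fun g i =>
    ⟨R.integrable_comp i.1, R.integrable_comp i.2⟩
  -- The product rule is integrated for `R S(s) f(s)`, which is continuous up to `s = 0` even when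
  -- `S(s) f(s)` is not; `apply_of_eq` then removes `R`.
  have hcont : ContinuousOn (fun s => (R * S s) (f s)) (Icc 0 r) :=
    (h.continuousOn_resolvent_mul.mono Icc_subset_Ici_self).clm_apply hf
  have hderiv : ∀ s ∈ Ioo 0 r, HasDerivAt (fun s => (R * S s) (f s))
      (μ • R (S s (f s)) - S s (f s) + R (S s (f' s))) s := by
    intro s hs
    have h1 : HasDerivAt (fun s => R * S s) (R * S' s) s := (h.hasDerivAt s hs.1).const_mul R
    refine (hasDerivAt_clm_apply h1 (hd s hs)).congr_deriv ?_
    have h3 := congrArg (· (f s)) (h.resolvent_mul_deriv hs.1)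
    simp only [mul_apply_eq_comp, sub_apply, smul_apply] at h3
    simp [h3]
  have i3 : IntervalIntegrable (fun s => μ • R (S s (f s))) volume 0 r := (j _ i1).smul μ
  have hint := intervalIntegral.integral_eq_sub_of_hasDerivAt_of_le hr.le hcont hderiv
    ((i3.sub i1).add (j _ i2))
  rw [intervalIntegral.integral_add (i3.sub i1) (j _ i2),
    intervalIntegral.integral_sub i3 i1, intervalIntegral.integral_smul,
    R.intervalIntegral_comp_comm i1, R.intervalIntegral_comp_comm i2] at hint
  simp only [mul_apply_eq_comp, h.zero, one_apply_eq_self] at hint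
  refine h.resolvent.apply_of_eq ?_
  simp only [map_sub, map_smul]
  rw [sub_add_eq_add_sub, sub_eq_iff_eq_add] at hint
  rw [← sub_eq_zero] at hint ⊢
  rw [← neg_eq_zero, ← hint]
  abel

/-- Hölder continuity at `0` from a bound on the derivative. -/
theorem norm_sub_le_rpow [CompleteSpace X] {b K L : ℝ} (hb : 0 < b) {x : X}
    (hK : ∀ r, 0 < r → r ≤ L → ‖S' r x‖ ≤ K * r ^ (b - 1)) {t : ℝ} (ht : 0 < t) (htL : t ≤ L) :
    ‖S t x - x‖ ≤ K * (t ^ b / b) := by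
  have hC : IntervalIntegrable (fun r : ℝ => K * r ^ (b - 1)) volume 0 t :=
    (intervalIntegral.intervalIntegrable_rpow' (by linarith)).const_mul K
  have hbd : ∀ r ∈ Ioo 0 t, ‖S' r x‖ ≤ K * r ^ (b - 1) :=
    fun r hr => hK r hr.1 (hr.2.le.trans htL)
  have hc : ContinuousOn (fun r => S' r x) (Ioo 0 t) :=
    (h.continuousOn_deriv.mono Ioo_subset_Ioi_self).clm_apply continuousOn_const
  have i1 : IntervalIntegrable (fun r => S' r x) volume 0 t :=
    intervalIntegrable_of_norm_le ht.le hc hC hbd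
  have hint := intervalIntegral.integral_eq_sub_of_hasDerivAt_of_le ht.le
    (f := fun r => (R * S r) x) (f' := fun r => R (S' r x))
    ((h.continuousOn_resolvent_mul.mono Icc_subset_Ici_self).clm_apply continuousOn_const)
    (fun r hr => by
      simpa using hasDerivAt_clm_apply ((h.hasDerivAt r hr.1).const_mul R) (hasDerivAt_const r x))
    ⟨R.integrable_comp i1.1, R.integrable_comp i1.2⟩
  rw [R.intervalIntegral_comp_comm i1] at hint
  simp only [mul_apply_eq_comp, h.zero, one_apply_eq_self, ← map_sub] at hint
  -- Cancelling `R` gives `S t x - x = ∫_0^t S' r x dr` without assuming beforehand that `S r x →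
  -- x`.
  rw [← h.resolvent.injective hint]
  refine (norm_integral_le_of_norm_le_Ioo ht.le hC hbd).trans ?_
  rw [intervalIntegral.integral_const_mul, integral_rpow (Or.inl (by linarith))]
  rw [sub_add_cancel, Real.zero_rpow hb.ne', sub_zero]

end IsAnalyticSemigroup

end Phi

/-! ### The semigroup of the sum as a product of semigroups -/

section Sum

variable {X : Type*} [NormedAddCommGroup X] [NormedSpace ℂ X]
  {A₁ A₂ A : X →ₗ.[ℂ] X} {S S' T T' P P' : ℝ → X →L[ℂ] X} {μ₁ μ₂ μ : ℂ} {R₁ R₂ R : X →L[ℂ] X}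

theorem tendsto_clm_apply {ι : Type*} {l : Filter ι} {G : ι → X →L[ℂ] X} {G₀ : X →L[ℂ] X}
    {f : ι → X} {f₀ : X} (hG : Tendsto G l (𝓝 G₀)) (hf : Tendsto f l (𝓝 f₀)) :
    Tendsto (fun i => G i (f i)) l (𝓝 (G₀ f₀)) :=
  ((isBoundedBilinearMap_apply (𝕜 := ℂ) (E := X) (F := X)).continuous.tendsto (G₀, f₀)).comp
    (hG.prodMk_nhds hf)

/-- Times with rational quotient are multiples of a common step `s / n`, so both operators are
powers of commuting ones. Norm continuity at positive times gives the rest, through the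
approximations `s ⌊(t/s) n⌋ / n` of `t`. -/
theorem commute_semigroups (h₁ : IsAnalyticSemigroup A₁ S S' μ₁ R₁)
    (h₂ : IsAnalyticSemigroup A₂ T T' μ₂ R₂) (hcomm : ∀ t, 0 ≤ t → Commute (S t) (T t))
    {s t : ℝ} (hs : 0 ≤ s) (ht : 0 ≤ t) : Commute (S s) (T t) := by
  rcases hs.eq_or_lt with rfl | hs
  · rw [h₁.zero]; exact Commute.one_left _
  rcases ht.eq_or_lt with rfl | ht
  · rw [h₂.zero]; exact Commute.one_right _
  have hrat : ∀ m n : ℕ, 0 < n → Commute (S s) (T (s * (m / n))) := by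
    intro m n hn
    have hn' : (n : ℝ) ≠ 0 := by positivity
    have e1 : s = n * (s / n) := by field_simp
    have e2 : s * (m / n) = m * (s / n) := by ring
    have h0 : 0 ≤ s / n := by positivity
    rw [e2, h₂.nsmul h0]
    nth_rw 1 [e1]
    rw [h₁.nsmul h0]
    exact (hcomm _ h0).pow_pow _ _
  have hlim : Tendsto (fun n : ℕ => s * ((⌊t / s * n⌋₊ : ℝ) / n)) atTop (𝓝 t) := by
    have h1 := (tendsto_nat_floor_mul_div_atTop (R := ℝ) (a := t / s) (by positivity)).comp
      (tendsto_natCast_atTop_atTop (R := ℝ))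
    have h2 := h1.const_mul s
    rw [mul_div_cancel₀ t hs.ne'] at h2
    exact h2
  have hT := (h₂.continuousAt ht).tendsto.comp hlim
  have l1 := hT.const_mul (S s)
  have l2 := hT.mul_const (S s)
  refine tendsto_nhds_unique l1 (l2.congr' ?_)
  filter_upwards [eventually_gt_atTop 0] with n hn
  exact ((hrat _ n hn).eq).symm

theorem apply_of_sum_le (hsum : A₁ + A₂ ≤ A) {x a b : X}
    (h₁ : ∃ hx : x ∈ A₁.domain, A₁ ⟨x, hx⟩ = a) (h₂ : ∃ hx : x ∈ A₂.domain, A₂ ⟨x, hx⟩ = b) :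
    ∃ hx : x ∈ A.domain, A ⟨x, hx⟩ = a + b := by
  obtain ⟨m₁, rfl⟩ := h₁
  obtain ⟨m₂, rfl⟩ := h₂
  have m : x ∈ (A₁ + A₂).domain := ⟨m₁, m₂⟩
  refine ⟨hsum.1 m, ?_⟩
  rw [← hsum.2 (x := ⟨x, m⟩) (y := ⟨x, hsum.1 m⟩) rfl]
  rfl

variable (h₁ : IsAnalyticSemigroup A₁ S S' μ₁ R₁) (h₂ : IsAnalyticSemigroup A₂ T T' μ₂ R₂)
  (h : IsAnalyticSemigroup A P P' μ R) (hsum : A₁ + A₂ ≤ A)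
  (hcomm : ∀ t, 0 ≤ t → Commute (S t) (T t))
include h₁ h₂ hcomm

theorem commute_deriv_left {s t : ℝ} (hs : 0 < s) (ht : 0 ≤ t) : Commute (S' s) (T t) :=
  (h₁.commute_deriv (fun _ hr => (commute_semigroups h₁ h₂ hcomm hr.le ht).symm) hs).symm

theorem commute_deriv_right {s t : ℝ} (hs : 0 ≤ s) (ht : 0 < t) : Commute (S s) (T' t) :=
  h₂.commute_deriv (fun _ hr => commute_semigroups h₁ h₂ hcomm hs hr.le) ht

include hsum

theorem apply_mul_mem {s t : ℝ} (hs : 0 < s) (ht : 0 < t) (x : X) :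
    ∃ hx : S s (T t x) ∈ A.domain, A ⟨S s (T t x), hx⟩ = S' s (T t x) + S s (T' t x) := by
  refine apply_of_sum_le hsum (h₁.apply_mem hs (T t x)) ?_
  have e1 : T t (S s x) = S s (T t x) := by
    simpa using (congrArg (· x) (commute_semigroups h₁ h₂ hcomm hs.le ht.le).eq).symm
  have e2 : T' t (S s x) = S s (T' t x) := by
    simpa using (congrArg (· x) (commute_deriv_right h₁ h₂ hcomm hs.le ht).eq).symm
  have := h₂.apply_mem ht (S s x)
  rwa [e1, e2] at this

include h

/-- `T r x` need not tend to `x`, so the initial value of `w(r) = S(r + ε) T(r) x` is recovered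
under `R`. The integral `W(r)` of `w` over `(0, r)` lies in `D(A₂)` by integration by parts, and in
`D(A₁)` because a factor `S(ε/2)` can be taken out. It turns out that `A W(r) = w(r) - S(ε) x`;
apply `R` and use `W(r) → 0`. -/
theorem tendsto_resolvent_apply [CompleteSpace X] {ε : ℝ} (hε : 0 < ε) (x : X) :
    Tendsto (fun r => R (S (r + ε) (T r x))) (𝓝[>] 0) (𝓝 (R (S ε x))) := by
  obtain ⟨N, hN1, hN, hN'⟩ := h₁.exists_bound (1 + ε)
  obtain ⟨N₂, hN₂1, hN₂, -⟩ := h₂.exists_bound 1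
  set W : ℝ → X := fun r => ∫ s in (0 : ℝ)..r, T s (S (s + ε) x) with hW
  have hcomm' : ∀ {s t : ℝ}, 0 ≤ s → 0 ≤ t → ∀ y, T t (S s y) = S s (T t y) := fun hs ht y => by
    simpa using (congrArg (· y) (commute_semigroups h₁ h₂ hcomm hs ht).eq).symm
  have hcommd : ∀ {s t : ℝ}, 0 < s → 0 ≤ t → ∀ y, T t (S' s y) = S' s (T t y) := fun hs ht y => by
    simpa using (congrArg (· y) (commute_deriv_left h₁ h₂ hcomm hs ht).eq).symm
  have hTc : ∀ r, ContinuousOn T (Ioo 0 r) := fun r => h₂.continuousOn.mono Ioo_subset_Ioi_self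
  have hSc : ∀ δ, 0 < δ → ∀ r, ContinuousOn (fun s => S (s + δ) x) (Icc 0 r) := fun δ hδ r =>
    (h₁.continuousOn.comp (by fun_prop) fun s hs => by
      have := hs.1; change 0 < s + δ; linarith).clm_apply continuousOn_const
  have hSc' : ∀ r, ContinuousOn (fun s => S' (s + ε) x) (Icc 0 r) := fun r =>
    (h₁.continuousOn_deriv.comp (by fun_prop) fun s hs => by
      have := hs.1; change 0 < s + ε; linarith).clm_apply continuousOn_const
  have hWn : ∀ r ∈ Ioo (0 : ℝ) 1, ‖W r‖ ≤ N₂ * (N * ‖x‖) * r := by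
    intro r hr
    have := norm_integral_le_of_norm_le_Ioo (g := fun s => T s (S (s + ε) x))
      (C := fun _ => N₂ * (N * ‖x‖)) hr.1.le intervalIntegrable_const (fun s hs => by
        refine ((T s).le_opNorm _).trans ?_
        have h1 := hN₂ s hs.1.le (by linarith [hs.2, hr.2])
        have h2 : ‖S (s + ε) x‖ ≤ N * ‖x‖ := (S _).le_of_opNorm_le
          (hN (s + ε) (by linarith [hs.1]) (by linarith [hs.2, hr.2])) x
        gcongr)
    rw [intervalIntegral.integral_const, sub_zero, smul_eq_mul] at this
    linarith
  have hAW : ∀ r ∈ Ioo (0 : ℝ) 1, R (S (r + ε) (T r x)) = R (S ε x) + (μ • R (W r) - W r) := by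
    intro r hr
    have a₂ := h₂.integral_mem (f := fun s => S (s + ε) x) (f' := fun s => S' (s + ε) x)
      (C := N / ε * ‖x‖) hr.1 (hSc ε hε r)
      (fun s hs => by
        have := (h₁.hasDerivAt (s + ε) (by linarith [hs.1])).comp_add_const s ε
        simpa using hasDerivAt_clm_apply this (hasDerivAt_const s x))
      ((hSc' r).mono Ioo_subset_Icc_self)
      (fun s hs => (S' _).le_of_opNorm_le ((hN' (s + ε) (by linarith [hs.1])
        (by linarith [hs.2, hr.2])).trans (by gcongr; linarith [hs.1])) x)
    have i : IntervalIntegrable (fun s => T s (S (s + ε / 2) x)) volume 0 r :=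
      intervalIntegrable_of_norm_le (C := fun _ => N₂ * (N * ‖x‖)) hr.1.le
        ((hTc r).clm_apply ((hSc _ (half_pos hε) r).mono Ioo_subset_Icc_self))
        intervalIntegrable_const fun s hs => by
          refine ((T s).le_opNorm _).trans ?_
          have h1 := hN₂ s hs.1.le (by linarith [hs.2, hr.2])
          have h2 : ‖S (s + ε / 2) x‖ ≤ N * ‖x‖ := (S _).le_of_opNorm_le
            (hN (s + ε / 2) (by linarith [hs.1]) (by linarith [hs.2, hr.2])) x
          gcongr
    have b1 : W r = S (ε / 2) (∫ s in (0 : ℝ)..r, T s (S (s + ε / 2) x)) := by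
      rw [← (S (ε / 2)).intervalIntegral_comp_comm i]
      refine intervalIntegral.integral_congr_ae ?_
      rw [uIoc_of_le hr.1.le]
      filter_upwards with s hs
      rw [← hcomm' (half_pos hε).le hs.1.le, ← mul_apply_eq_comp (S (ε / 2)),
        ← h₁.add (half_pos hε).le (by linarith [hs.1, half_pos hε])]
      congr 3; ring
    have b2 : ∫ s in (0 : ℝ)..r, T s (S' (s + ε) x) =
        S' (ε / 2) (∫ s in (0 : ℝ)..r, T s (S (s + ε / 2) x)) := by
      rw [← (S' (ε / 2)).intervalIntegral_comp_comm i]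
      refine intervalIntegral.integral_congr_ae ?_
      rw [uIoc_of_le hr.1.le]
      filter_upwards with s hs
      rw [← hcommd (half_pos hε) hs.1.le, ← mul_apply_eq_comp (S' (ε / 2)),
        ← h₁.deriv_add (half_pos hε) (by linarith [hs.1, half_pos hε])]
      congr 3; ring
    have a₁ := h₁.apply_mem (half_pos hε) (∫ s in (0 : ℝ)..r, T s (S (s + ε / 2) x))
    rw [← b1, ← b2] at a₁
    -- The integral of `T(s) S'(s + ε) x` occurs in `A₁ W` and in `A₂ W` with opposite signs and
    -- disappears from the sum.
    have a := h.resolvent.eq_of_apply (apply_of_sum_le hsum a₁ a₂)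
    beta_reduce at a
    rw [zero_add, add_sub_cancel, hcomm' (by linarith [hr.1]) hr.1.le, map_sub, map_sub,
      map_smul] at a
    change μ • R (W r) - (R (S (r + ε) (T r x)) - R (S ε x)) = W r at a
    nth_rw 2 [← a]
    abel
  have hW0 : Tendsto W (𝓝[>] 0) (𝓝 0) := by
    have h4 : Tendsto (fun t : ℝ => N₂ * (N * ‖x‖) * t) (𝓝[>] 0) (𝓝 0) := by
      have : Continuous fun t : ℝ => N₂ * (N * ‖x‖) * t := by fun_prop
      simpa using (this.tendsto 0).mono_left nhdsWithin_le_nhds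
    refine squeeze_zero_norm' ?_ h4
    filter_upwards [Ioo_mem_nhdsGT one_pos] with r hr
    exact hWn r hr
  have hlim : Tendsto (fun r => R (S ε x) + (μ • R (W r) - W r)) (𝓝[>] 0) (𝓝 (R (S ε x))) := by
    have h5 : Tendsto (fun r => R (W r)) (𝓝[>] 0) (𝓝 0) := by
      simpa [Function.comp_def] using (R.continuous.tendsto 0).comp hW0
    simpa using ((h5.const_smul μ).sub hW0).const_add (R (S ε x))
  refine hlim.congr' ?_
  filter_upwards [Ioo_mem_nhdsGT one_pos] with r hr
  exact (hAW r hr).symm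

/-- The semigroup of the sum is the product of the semigroups on the range of `S ε`. -/
theorem semigroup_apply_range [CompleteSpace X] {ε t : ℝ} (hε : 0 < ε) (ht : 0 < t) (x : X) :
    P t (S ε x) = S t (T t (S ε x)) := by
  set w : ℝ → X := fun r => S (r + ε) (T r x) with hw
  -- For `r > 0` the curve `w` takes values in both domains and `w' = A₁ w + A₂ w = A w`.
  have hdw : ∀ r ∈ Ioo 0 t, HasDerivAt (fun r => P (t - r) (w r)) 0 r := by
    intro r hr
    have d1 : HasDerivAt (fun r => P (t - r)) (-P' (t - r)) r :=
      (h.hasDerivAt (t - r) (by linarith [hr.2])).comp_const_sub t r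
    have d2 : HasDerivAt (fun r => T r x) (T' r x) r := by
      simpa using hasDerivAt_clm_apply (h₂.hasDerivAt r hr.1) (hasDerivAt_const r x)
    have d3 := hasDerivAt_clm_apply
      ((h₁.hasDerivAt (r + ε) (by linarith [hr.1])).comp_add_const r ε) d2
    refine (hasDerivAt_clm_apply d1 d3).congr_deriv ?_
    obtain ⟨m, hm⟩ := apply_mul_mem h₁ h₂ hsum hcomm (s := r + ε) (by linarith [hr.1]) hr.1 x
    have := h.deriv_apply_of_mem (x := ⟨_, m⟩) (t := t - r) (by linarith [hr.2])
    rw [hm] at this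
    rw [neg_apply, ← this]
    exact neg_add_cancel _
  have hconst : ∀ r ∈ Ioo 0 t, P (t - r) (w r) = P (t - t / 2) (w (t / 2)) := by
    intro r hr
    exact isOpen_Ioo.is_const_of_deriv_eq_zero isPreconnected_Ioo
      (fun y hy => (hdw y hy).differentiableAt.differentiableWithinAt)
      (fun y hy => (hdw y hy).deriv) hr ⟨by linarith, by linarith⟩
  have hRP : ∀ r, 0 ≤ r → ∀ y, R (P r y) = P r (R y) := fun r hr y => by
    simpa using congrArg (· y) (h.commute hr).eq
  have l1 : Tendsto (fun r => P (t - r) (R (w r))) (𝓝[>] 0) (𝓝 (P t (R (S ε x)))) := by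
    have h3 : Tendsto (fun x : ℝ => t - x) (𝓝[>] 0) (𝓝 t) := by
      have : Continuous fun x : ℝ => t - x := by fun_prop
      simpa using (this.tendsto 0).mono_left nhdsWithin_le_nhds
    exact tendsto_clm_apply ((h.continuousAt ht).tendsto.comp h3)
      (tendsto_resolvent_apply h₁ h₂ h hsum hcomm hε x)
  have c1 : P t (R (S ε x)) = R (P (t - t / 2) (w (t / 2))) := by
    refine tendsto_nhds_unique l1 (tendsto_const_nhds.congr' ?_)
    filter_upwards [Ioo_mem_nhdsGT ht] with r hr
    rw [← hconst r hr, hRP _ (by linarith [hr.2])]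
  -- At this end it is `P` whose time tends to `0`, so again the limit is taken under `R`.
  have l2 : Tendsto (fun r => (R * P r) (w (t - r))) (𝓝[>] 0) (𝓝 (R (w t))) := by
    have h3 : Tendsto (fun x : ℝ => t - x) (𝓝[>] 0) (𝓝 t) := by
      have : Continuous fun x : ℝ => t - x := by fun_prop
      simpa using (this.tendsto 0).mono_left nhdsWithin_le_nhds
    have h4 : ContinuousAt w t := by
      have c3 : ContinuousAt (fun r => S (r + ε)) t :=
        ContinuousAt.comp (f := fun r => r + ε) (h₁.continuousAt (by linarith)) (by fun_prop)
      exact c3.clm_apply ((h₂.continuousAt ht).clm_apply continuousAt_const)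
    exact tendsto_clm_apply h.tendsto (h4.tendsto.comp h3)
  have c2 : R (w t) = R (P (t - t / 2) (w (t / 2))) := by
    refine tendsto_nhds_unique l2 (tendsto_const_nhds.congr' ?_)
    filter_upwards [Ioo_mem_nhdsGT ht] with r hr
    rw [← hconst (t - r) ⟨by linarith [hr.2], by linarith [hr.1]⟩, sub_sub_cancel]
    rfl
  have c3 : P t (S ε x) = w t :=
    h.resolvent.injective (by rw [hRP t ht.le, c1, c2])
  have e1 : T t (S ε x) = S ε (T t x) := by
    simpa using (congrArg (· x) (commute_semigroups h₁ h₂ hcomm hε.le ht.le).eq).symm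
  rw [c3, e1, hw, ← mul_apply_eq_comp (S t), ← h₁.add ht.le hε.le]

/-- The semigroup of the sum is the product of the semigroups on the closure of `D(A₁)`. -/
theorem semigroup_apply_of_tendsto [CompleteSpace X] {t : ℝ} (ht : 0 < t) {y : X}
    (hy : Tendsto (fun ε => S ε y) (𝓝[>] 0) (𝓝 y)) : P t y = S t (T t y) := by
  have l1 : Tendsto (fun ε => P t (S ε y)) (𝓝[>] 0) (𝓝 (P t y)) :=
    ((P t).continuous.tendsto y).comp hy
  have l2 : Tendsto (fun ε => (S t * T t) (S ε y)) (𝓝[>] 0) (𝓝 ((S t * T t) y)) :=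
    ((S t * T t).continuous.tendsto y).comp hy
  refine tendsto_nhds_unique l1 (l2.congr' ?_)
  filter_upwards [self_mem_nhdsWithin] with ε hε
  exact (semigroup_apply_range h₁ h₂ h hsum hcomm hε ht y).symm

theorem semigroup_apply_of_mem [CompleteSpace X] {t : ℝ} (ht : 0 < t) {y : X}
    (hy : y ∈ A₁.domain) : P t y = S t (T t y) :=
  semigroup_apply_of_tendsto h₁ h₂ h hsum hcomm ht (h₁.tendsto_apply_of_mem ⟨y, hy⟩)

end Sum

/-! ### The defect on arbitrary vectors -/

section Defect

variable {X : Type*} [NormedAddCommGroup X] [NormedSpace ℂ X] [CompleteSpace X]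
  {A₁ A₂ A : X →ₗ.[ℂ] X} {S S' T T' P P' : ℝ → X →L[ℂ] X} {μ₁ μ₂ μ : ℂ} {R₁ R₂ R : X →L[ℂ] X}

theorem IsAnalyticSemigroup.commute_phiOf (h₁ : IsAnalyticSemigroup A₁ S S' μ₁ R₁)
    {B : X →L[ℂ] X} (hB : ∀ r, 0 ≤ r → Commute B (S r)) (k : ℕ) {t : ℝ} (ht : 0 < t) :
    Commute B (phiOf S k t) := by
  have i := h₁.intervalIntegrable_smul ht (continuous_weight k)
  have e1 := (ContinuousLinearMap.mul ℂ (X →L[ℂ] X) B).intervalIntegral_comp_comm i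
  have e2 := ((ContinuousLinearMap.mul ℂ (X →L[ℂ] X)).flip B).intervalIntegral_comp_comm i
  simp only [ContinuousLinearMap.mul_apply', ContinuousLinearMap.flip_apply] at e1 e2
  rw [Commute, SemiconjBy, phiOf, ← e1, ← e2]
  refine intervalIntegral.integral_congr fun ξ hξ => ?_
  rw [uIcc_of_le zero_le_one] at hξ
  rw [mul_smul_comm, smul_mul_assoc, (hB _ (mul_nonneg (sub_nonneg.2 hξ.2) ht.le)).eq]

theorem IsAnalyticSemigroup.phiOf_mem (h₁ : IsAnalyticSemigroup A₁ S S' μ₁ R₁) (k : ℕ) {t : ℝ}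
    (ht : 0 < t) (x : X) : phiOf S k t x ∈ A₁.domain := by
  obtain ⟨N, hN1, hN, -⟩ := h₁.exists_bound t
  obtain ⟨Y, hY, -⟩ := h₁.exists_phiOf_eq k ht hN1 hN
  exact (h₁.resolvent.apply_of_eq (x := phiOf S k t x) (y := Y x)
    (by simpa using congrArg (· x) hY)).1

/-- `S' s * phiOf S k t` equals `S s` applied after `A₁ φ`, which is `O(1/t)`. The singularity `1/s`
of `S' s` is thereby replaced by `1/t`, uniformly in small `s`. -/
theorem IsAnalyticSemigroup.norm_deriv_mul_phiOf_le (h₁ : IsAnalyticSemigroup A₁ S S' μ₁ R₁)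
    (k : ℕ) {s t N L : ℝ} (hs : 0 < s) (hsL : s ≤ L) (ht : 0 < t) (htL : t ≤ L) (hN1 : 1 ≤ N)
    (hN : ∀ r, 0 ≤ r → r ≤ L → ‖S r‖ ≤ N) :
    ‖S' s * phiOf S k t‖ ≤ (k + 2) * N ^ 2 / t := by
  obtain ⟨Y, hY, hYn⟩ := h₁.exists_phiOf_eq k ht hN1 (fun r h0 h1 => hN r h0 (h1.trans htL))
  have e : S' s * phiOf S k t = S s * Y := by
    ext x
    obtain ⟨m, hm⟩ := h₁.resolvent.apply_of_eq (x := phiOf S k t x) (y := Y x)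
      (by simpa using congrArg (· x) hY)
    have := h₁.deriv_apply_of_mem (x := ⟨_, m⟩) hs
    rw [hm] at this
    exact this
  rw [e]
  calc _ ≤ ‖S s‖ * ‖Y‖ := norm_mul_le _ _
    _ ≤ N * ((k + 2) * N / t) := by gcongr; exact hN s hs.le hsL
    _ = _ := by ring

/-- The splitting defect for `φ_{k+1}`. -/
def defectOf (S T P : ℝ → X →L[ℂ] X) (k : ℕ) (t : ℝ) : X →L[ℂ] X :=
  phiOf P k t - ((k + 1).factorial : ℂ) • (phiOf S k t * phiOf T k t)

variable (h₁ : IsAnalyticSemigroup A₁ S S' μ₁ R₁) (h₂ : IsAnalyticSemigroup A₂ T T' μ₂ R₂)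
  (h : IsAnalyticSemigroup A P P' μ R) (hsum : A₁ + A₂ ≤ A)
  (hcomm : ∀ t, 0 ≤ t → Commute (S t) (T t))

section

include h₁ h₂ h hsum hcomm

-- Agreement of `P s y` with `S s (T s y)` at the single time `s` is enough: both sides are `A`
-- applied to this one vector.
omit [CompleteSpace X] in
theorem deriv_apply_eq {s : ℝ} (hs : 0 < s) {y : X} (hy : P s y = S s (T s y)) :
    P' s y = S' s (T s y) + S s (T' s y) := by
  obtain ⟨m, hm⟩ := apply_mul_mem h₁ h₂ hsum hcomm hs hs y
  obtain ⟨m', hm'⟩ := h.apply_mem hs y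
  rw [← hm, ← hm']
  congr 2

/-- Estimate of the defect on general vectors. -/
theorem norm_defectOf_le_rough (k : ℕ) {N L : ℝ} (hN1 : 1 ≤ N)
    (hS : ∀ r, 0 ≤ r → r ≤ L → ‖S r‖ ≤ N) (hT : ∀ r, 0 ≤ r → r ≤ L → ‖T r‖ ≤ N)
    (hP : ∀ r, 0 ≤ r → r ≤ L → ‖P r‖ ≤ N) :
    ∃ D : ℝ, 0 ≤ D ∧ ∀ t, 0 < t → t ≤ L → ∀ x, ‖defectOf S T P k t x‖ ≤ D * ‖x‖ ∧
      ∀ s, 0 < s → s ≤ t → ‖P' s (defectOf S T P k t x)‖ ≤ D * ‖x‖ / t := by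
  set c : ℝ := ((k + 1).factorial : ℝ) with hc
  have hN0 : 0 ≤ N := by linarith
  have hcn : ‖((k + 1).factorial : ℂ)‖ = c := by rw [Complex.norm_natCast]
  refine ⟨(N + c * (N * N)) + ((k + 2) * N ^ 2 + c * (2 * (N * (N * ((k + 2) * N ^ 2))))),
    by positivity, fun t ht htL x => ?_⟩
  have hSt : ‖phiOf S k t‖ ≤ N :=
    IsAnalyticSemigroup.norm_phiOf_le k ht fun r h0 h1 => hS r h0 (h1.trans htL)
  have hTt : ‖phiOf T k t‖ ≤ N :=
    IsAnalyticSemigroup.norm_phiOf_le k ht fun r h0 h1 => hT r h0 (h1.trans htL)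
  have hPt : ‖phiOf P k t‖ ≤ N :=
    IsAnalyticSemigroup.norm_phiOf_le k ht fun r h0 h1 => hP r h0 (h1.trans htL)
  refine ⟨?_, fun s hs hst => ?_⟩
  · refine ((defectOf S T P k t).le_opNorm x).trans ?_
    gcongr
    calc ‖defectOf S T P k t‖ ≤ ‖phiOf P k t‖ + c * (‖phiOf S k t‖ * ‖phiOf T k t‖) := by
          rw [defectOf]
          refine (norm_sub_le _ _).trans ?_
          rw [norm_smul, hcn]
          gcongr
          exact norm_mul_le _ _
      _ ≤ N + c * (N * N) := by gcongr
      _ ≤ _ := le_add_of_nonneg_right (by positivity)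
  · have hsL := hst.trans htL
    have e1 : P' s ((phiOf S k t * phiOf T k t) x) =
        (T s * (S' s * phiOf S k t) * phiOf T k t + S s * phiOf S k t * (T' s * phiOf T k t)) x := by
      -- For arbitrary `x`, the product `P = S T` is available on this term because the outer factor
      -- `φ(tA₁)` maps into `D(A₁)`.
      have hmem := semigroup_apply_of_mem h₁ h₂ h hsum hcomm hs
        (h₁.phiOf_mem k ht (phiOf T k t x))
      have c1 := (commute_deriv_left h₁ h₂ hcomm hs hs.le).eq
      have c2 : Commute (T' s) (phiOf S k t) :=
        h₁.commute_phiOf (fun r hr => (commute_deriv_right h₁ h₂ hcomm hr hs).symm) k ht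
      have e2 := deriv_apply_eq h₁ h₂ h hsum hcomm hs (y := phiOf S k t (phiOf T k t x)) hmem
      have e3 : T s * (S' s * phiOf S k t) * phiOf T k t +
          S s * phiOf S k t * (T' s * phiOf T k t) = S' s * T s * (phiOf S k t * phiOf T k t) +
            S s * T' s * (phiOf S k t * phiOf T k t) := by
        rw [c1]
        simp only [mul_assoc]
        rw [← mul_assoc (T' s), c2.eq, mul_assoc]
      rw [e3]
      exact e2
    have e4 : P' s (defectOf S T P k t x) = (P' s * phiOf P k t - ((k + 1).factorial : ℂ) •
        (T s * (S' s * phiOf S k t) * phiOf T k t +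
          S s * phiOf S k t * (T' s * phiOf T k t))) x := by
      rw [sub_apply, smul_apply, ← e1, defectOf, sub_apply, smul_apply, map_sub, map_smul]
      rfl
    rw [e4, mul_div_right_comm]
    refine (ContinuousLinearMap.le_opNorm _ x).trans ?_
    gcongr
    have b1 := h₁.norm_deriv_mul_phiOf_le k hs hsL ht htL hN1 hS
    have b2 := h₂.norm_deriv_mul_phiOf_le k hs hsL ht htL hN1 hT
    have b3 := h.norm_deriv_mul_phiOf_le k hs hsL ht htL hN1 hP
    have d1 : ‖T s * (S' s * phiOf S k t) * phiOf T k t‖ ≤ N * ((k + 2) * N ^ 2 / t) * N := by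
      refine (norm_mul_le _ _).trans ?_
      gcongr
      refine (norm_mul_le _ _).trans ?_
      gcongr
      exact hT s hs.le hsL
    have d2 : ‖S s * phiOf S k t * (T' s * phiOf T k t)‖ ≤ N * N * ((k + 2) * N ^ 2 / t) := by
      refine (norm_mul_le _ _).trans ?_
      gcongr
      refine (norm_mul_le _ _).trans ?_
      gcongr
      exact hS s hs.le hsL
    have d3 := norm_sub_le (P' s * phiOf P k t) (((k + 1).factorial : ℂ) •
        (T s * (S' s * phiOf S k t) * phiOf T k t + S s * phiOf S k t * (T' s * phiOf T k t)))
    rw [norm_smul, hcn] at d3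
    refine d3.trans ?_
    calc _ ≤ (k + 2) * N ^ 2 / t + c * (N * ((k + 2) * N ^ 2 / t) * N +
          N * N * ((k + 2) * N ^ 2 / t)) := by
            gcongr
            exact (norm_add_le _ _).trans (add_le_add d1 d2)
      _ = ((k + 2) * N ^ 2 + c * (2 * (N * (N * ((k + 2) * N ^ 2))))) / t := by ring
      _ ≤ _ := by
        have : 0 ≤ N + c * (N * N) := by positivity
        exact div_le_div_of_nonneg_right (by linarith) ht.le

end

end Defect

/-! ### Weighted integrals with an endpoint singularity -/

section Weighted

variable {X : Type*} [NormedAddCommGroup X] [NormedSpace ℂ X]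

theorem intervalIntegrable_one_sub_rpow {b : ℝ} (hb : 0 < b) :
    IntervalIntegrable (fun ξ : ℝ => (1 - ξ) ^ (b - 1)) volume 0 1 := by
  have := (intervalIntegral.intervalIntegrable_rpow' (a := 0) (b := 1) (r := b - 1)
    (by linarith)).comp_sub_left 1
  simpa using this.symm

theorem integral_one_sub_rpow {b : ℝ} (hb : 0 < b) :
    ∫ ξ in (0 : ℝ)..1, (1 - ξ) ^ (b - 1) = 1 / b := by
  rw [intervalIntegral.integral_comp_sub_left (fun u : ℝ => u ^ (b - 1)) 1, sub_self, sub_zero,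
    integral_rpow (Or.inl (by linarith)), sub_add_cancel, Real.one_rpow, Real.zero_rpow hb.ne',
    sub_zero]

theorem norm_integral_weight_le_rpow (k : ℕ) {f : ℝ → X} {b C : ℝ} (hb : 0 < b)
    (h : ∀ ξ ∈ Ioo (0 : ℝ) 1, ‖f ξ‖ ≤ C * (1 - ξ) ^ (b - 1)) :
    ‖∫ ξ in (0 : ℝ)..1, (weight k ξ : ℂ) • f ξ‖ ≤ C / b := by
  refine (norm_integral_le_of_norm_le_Ioo (C := fun ξ => C * (1 - ξ) ^ (b - 1)) zero_le_one
    ((intervalIntegrable_one_sub_rpow hb).const_mul C) fun ξ hξ => ?_).trans_eq ?_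
  · rw [norm_smul]
    calc _ ≤ 1 * ‖f ξ‖ := by gcongr; exact norm_weight_le k hξ.1.le hξ.2.le
      _ ≤ _ := by rw [one_mul]; exact h ξ hξ
  · rw [intervalIntegral.integral_const_mul, integral_one_sub_rpow hb, mul_one_div]

theorem norm_integral_weight_le (k : ℕ) {f : ℝ → X} {C : ℝ}
    (h : ∀ ξ ∈ Ioo (0 : ℝ) 1, ‖f ξ‖ ≤ C) :
    ‖∫ ξ in (0 : ℝ)..1, (weight k ξ : ℂ) • f ξ‖ ≤ C := by
  simpa using norm_integral_weight_le_rpow k one_pos (f := f) (C := C) (by simpa using h)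

theorem intervalIntegrable_weight_smul (k : ℕ) {f : ℝ → X} {C : ℝ}
    (hf : ContinuousOn f (Ioo 0 1)) (h : ∀ ξ ∈ Ioo (0 : ℝ) 1, ‖f ξ‖ ≤ C) :
    IntervalIntegrable (fun ξ => (weight k ξ : ℂ) • f ξ) volume 0 1 :=
  intervalIntegrable_of_norm_le zero_le_one
    (ContinuousOn.smul (Complex.continuous_ofReal.comp (continuous_weight k)).continuousOn hf)
    (C := fun _ => C) intervalIntegrable_const fun ξ hξ => by
      rw [norm_smul]
      calc _ ≤ 1 * ‖f ξ‖ := by gcongr; exact norm_weight_le k hξ.1.le hξ.2.le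
        _ ≤ _ := by rw [one_mul]; exact h ξ hξ

theorem integral_weight_smul_const [CompleteSpace X] (k : ℕ) (x : X) :
    ∫ ξ in (0 : ℝ)..1, (weight k ξ : ℂ) • x = ((k + 1).factorial : ℂ)⁻¹ • x := by
  rw [intervalIntegral.integral_smul_const, intervalIntegral.integral_ofReal, integral_weight]
  push_cast; rfl

theorem integral_congr_Ioo {f g : ℝ → X} (h : ∀ ξ ∈ Ioo (0 : ℝ) 1, f ξ = g ξ) :
    ∫ ξ in (0 : ℝ)..1, f ξ = ∫ ξ in (0 : ℝ)..1, g ξ := by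
  refine intervalIntegral.integral_congr_ae ?_
  rw [uIoc_of_le zero_le_one]
  exact ae_of_forall_Ioo h

theorem clm_integral_weight [CompleteSpace X] (k : ℕ) {f g : ℝ → X} (B : X →L[ℂ] X)
    (hf : IntervalIntegrable (fun ξ => (weight k ξ : ℂ) • f ξ) volume 0 1)
    (h : ∀ ξ ∈ Ioo (0 : ℝ) 1, B (f ξ) = g ξ) :
    B (∫ ξ in (0 : ℝ)..1, (weight k ξ : ℂ) • f ξ) =
      ∫ ξ in (0 : ℝ)..1, (weight k ξ : ℂ) • g ξ := by
  rw [← B.intervalIntegral_comp_comm hf]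
  refine integral_congr_Ioo fun ξ hξ => ?_
  rw [map_smul, h ξ hξ]

end Weighted

/-! ### The defect on regular vectors -/

section Defect

variable {X : Type*} [NormedAddCommGroup X] [NormedSpace ℂ X] [CompleteSpace X]
  {A₁ A₂ A : X →ₗ.[ℂ] X} {S S' T T' P P' : ℝ → X →L[ℂ] X} {μ₁ μ₂ μ : ℂ} {R₁ R₂ R : X →L[ℂ] X}

/-- Makes `P = S T` available on vectors that are only Hölder regular for `A₁`. -/
theorem IsAnalyticSemigroup.tendsto_of_norm_deriv_le (h₁ : IsAnalyticSemigroup A₁ S S' μ₁ R₁)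
    {b K L : ℝ} (hb : 0 < b) (hL : 0 < L) {x : X}
    (hK : ∀ r, 0 < r → r ≤ L → ‖S' r x‖ ≤ K * r ^ (b - 1)) :
    Tendsto (fun ε => S ε x) (𝓝[>] 0) (𝓝 x) := by
  rw [tendsto_iff_norm_sub_tendsto_zero]
  have h4 : Tendsto (fun t : ℝ => K * (t ^ b / b)) (𝓝[>] 0) (𝓝 0) := by
    have : ContinuousAt (fun t : ℝ => K * (t ^ b / b)) 0 :=
      continuousAt_const.mul ((Real.continuousAt_rpow_const 0 b (Or.inr hb.le)).div_const b)
    have h5 := this.tendsto.mono_left (nhdsWithin_le_nhds (s := Ioi 0))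
    simpa [Real.zero_rpow hb.ne'] using h5
  refine squeeze_zero' (Eventually.of_forall fun _ => norm_nonneg _) ?_ h4
  filter_upwards [Ioo_mem_nhdsGT hL] with r hr
  exact h₁.norm_sub_le_rpow hb hK hr.1 hr.2.le

variable (h₁ : IsAnalyticSemigroup A₁ S S' μ₁ R₁) (h₂ : IsAnalyticSemigroup A₂ T T' μ₂ R₂)
  (h : IsAnalyticSemigroup A P P' μ R) (hsum : A₁ + A₂ ≤ A)
  (hcomm : ∀ t, 0 ≤ t → Commute (S t) (T t))

include h₁ h₂ h hsum hcomm

/-- The two representations of the defect on regular vectors. -/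
theorem defectOf_apply (k : ℕ) {N L t : ℝ} (hN1 : 1 ≤ N)
    (hS : ∀ r, 0 ≤ r → r ≤ L → ‖S r‖ ≤ N) (hT : ∀ r, 0 ≤ r → r ≤ L → ‖T r‖ ≤ N)
    (ht : 0 < t) (htL : t ≤ L) {x : X} (hx : Tendsto (fun ε => S ε x) (𝓝[>] 0) (𝓝 x)) :
    defectOf S T P k t x = (∫ ξ in (0 : ℝ)..1,
        (weight k ξ : ℂ) • S ((1 - ξ) * t) (T ((1 - ξ) * t) x)) -
          ((k + 1).factorial : ℂ) • phiOf S k t (phiOf T k t x) ∧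
    defectOf S T P k t x = (∫ ξ in (0 : ℝ)..1,
        (weight k ξ : ℂ) • T ((1 - ξ) * t) (S ((1 - ξ) * t) x - x)) -
          ((k + 1).factorial : ℂ) • phiOf T k t
            (∫ ξ in (0 : ℝ)..1, (weight k ξ : ℂ) • (S ((1 - ξ) * t) x - x)) := by
  have hc0 : ((k + 1).factorial : ℂ) ≠ 0 := by exact_mod_cast (k + 1).factorial_ne_zero
  have hτ : ∀ ξ ∈ Ioo (0 : ℝ) 1, 0 < (1 - ξ) * t ∧ (1 - ξ) * t ≤ L := fun ξ hξ =>
    ⟨mul_pos (sub_pos.2 hξ.2) ht, by nlinarith [hξ.1, hξ.2]⟩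
  have e1 : phiOf P k t x =
      ∫ ξ in (0 : ℝ)..1, (weight k ξ : ℂ) • S ((1 - ξ) * t) (T ((1 - ξ) * t) x) := by
    rw [h.phiOf_apply k ht]
    refine integral_congr_Ioo fun ξ hξ => ?_
    rw [semigroup_apply_of_tendsto h₁ h₂ h hsum hcomm (hτ ξ hξ).1 hx]
  have d1 : defectOf S T P k t x = (∫ ξ in (0 : ℝ)..1,
        (weight k ξ : ℂ) • S ((1 - ξ) * t) (T ((1 - ξ) * t) x)) -
          ((k + 1).factorial : ℂ) • phiOf S k t (phiOf T k t x) := by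
    rw [← e1]; rfl
  refine ⟨d1, d1.trans ?_⟩
  have cS := (h₁.continuousOn_comp ht).clm_apply (continuousOn_const (c := x))
  have cT := (h₂.continuousOn_comp ht).clm_apply (continuousOn_const (c := x))
  have nS : ∀ ξ ∈ Ioo (0 : ℝ) 1, ‖S ((1 - ξ) * t) x‖ ≤ N * ‖x‖ := fun ξ hξ =>
    (S _).le_of_opNorm_le (hS _ (hτ ξ hξ).1.le (hτ ξ hξ).2) x
  have nT : ∀ ξ ∈ Ioo (0 : ℝ) 1, ‖T ((1 - ξ) * t) x‖ ≤ N * ‖x‖ := fun ξ hξ =>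
    (T _).le_of_opNorm_le (hT _ (hτ ξ hξ).1.le (hτ ξ hξ).2) x
  have nu : ∀ ξ ∈ Ioo (0 : ℝ) 1, ‖S ((1 - ξ) * t) x - x‖ ≤ N * ‖x‖ + ‖x‖ := fun ξ hξ =>
    (norm_sub_le _ _).trans (by gcongr; exact nS ξ hξ)
  have iT := intervalIntegrable_weight_smul k cT nT
  have cu : ContinuousOn (fun ξ => S ((1 - ξ) * t) x - x) (Ioo 0 1) := cS.sub continuousOn_const
  have iu := intervalIntegrable_weight_smul k cu nu
  have iv := intervalIntegrable_weight_smul k (C := N * (N * ‖x‖ + ‖x‖))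
    ((h₂.continuousOn_comp ht).clm_apply cu) (fun ξ hξ => by
      refine ((T _).le_opNorm _).trans ?_
      have := nu ξ hξ
      have := hT _ (hτ ξ hξ).1.le (hτ ξ hξ).2
      gcongr)
  have ix : IntervalIntegrable (fun ξ => (weight k ξ : ℂ) • x) volume 0 1 :=
    intervalIntegrable_weight_smul k continuousOn_const (C := ‖x‖) (fun _ _ => le_rfl)
  -- Writing `S(τ) x = (S(τ) x - x) + x` under `T(τ)` splits off exactly `φ(tA₂) x`.
  have e2 : ∫ ξ in (0 : ℝ)..1, (weight k ξ : ℂ) • S ((1 - ξ) * t) (T ((1 - ξ) * t) x) =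
      (∫ ξ in (0 : ℝ)..1, (weight k ξ : ℂ) • T ((1 - ξ) * t) (S ((1 - ξ) * t) x - x)) +
        phiOf T k t x := by
    rw [h₂.phiOf_apply k ht, ← intervalIntegral.integral_add iv iT]
    refine integral_congr_Ioo fun ξ hξ => ?_
    have e3 : S ((1 - ξ) * t) (T ((1 - ξ) * t) x) = T ((1 - ξ) * t) (S ((1 - ξ) * t) x) := by
      simpa using congrArg (· x) (hcomm _ (hτ ξ hξ).1.le).eq
    rw [← smul_add, e3, ← map_add, sub_add_cancel]
  -- The weight has mass `1/(k+1)!`, so the factor `(k+1)!` turns the constant part into the same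
  -- `φ(tA₂) x`, and the two copies cancel. This fixes the factor in the definition of the defect.
  have e4 : phiOf S k t x = (∫ ξ in (0 : ℝ)..1, (weight k ξ : ℂ) • (S ((1 - ξ) * t) x - x)) +
      ((k + 1).factorial : ℂ)⁻¹ • x := by
    rw [h₁.phiOf_apply k ht, ← integral_weight_smul_const, ← intervalIntegral.integral_add iu ix]
    refine integral_congr_Ioo fun ξ hξ => ?_
    rw [← smul_add, sub_add_cancel]
  have e5 : phiOf S k t (phiOf T k t x) = phiOf T k t (phiOf S k t x) := by
    have : Commute (phiOf S k t) (phiOf T k t) := h₂.commute_phiOf (fun r hr =>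
      (h₁.commute_phiOf (fun s hs => (commute_semigroups h₁ h₂ hcomm hs hr).symm) k ht).symm) k ht
    simpa using congrArg (· x) this.eq
  rw [e2, e5, e4, map_add, smul_add, map_smul, smul_inv_smul₀ hc0]
  abel

/-- Estimate of the defect on regular vectors. -/
theorem norm_defectOf_le_smooth (k : ℕ) {N L b : ℝ} (hb : 0 < b) (hb1 : b ≤ 1) (hN1 : 1 ≤ N)
    (hS : ∀ r, 0 ≤ r → r ≤ L → ‖S r‖ ≤ N) (hT : ∀ r, 0 ≤ r → r ≤ L → ‖T r‖ ≤ N)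
    (hT' : ∀ r, 0 < r → r ≤ L → ‖T' r‖ ≤ N / r) :
    ∃ D : ℝ, 0 ≤ D ∧ ∀ t, 0 < t → 2 * t ≤ L → ∀ x K,
      (∀ r, 0 < r → r ≤ L → ‖S' r x‖ ≤ K * r ^ (b - 1)) →
      ‖defectOf S T P k t x‖ ≤ D * K * t ^ b ∧
      ∀ s, 0 < s → s ≤ t → ‖P' s (defectOf S T P k t x)‖ ≤ D * K * t ^ b / t := by
  set c : ℝ := ((k + 1).factorial : ℝ) with hc
  have hN0 : 0 ≤ N := by linarith
  have hcn : ‖((k + 1).factorial : ℂ)‖ = c := by rw [Complex.norm_natCast]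
  have hcpos : 0 ≤ c := by positivity
  -- The first bracket bounds the defect itself; the second collects the constants of `p1` and `p2`.
  refine ⟨(N / b + c * (N / b)) + (N * N / b + c * (N * (N / b)) +
    N * (N / b / b + c * ((k + 2) * N ^ 2 / b))), by positivity, fun t ht htL x K hK => ?_⟩
  have htL' : t ≤ L := by linarith
  have hL : 0 < L := by linarith
  have hK0 : 0 ≤ K := by
    have h1 := (norm_nonneg _).trans (hK t ht htL')
    exact nonneg_of_mul_nonneg_left h1 (Real.rpow_pos_of_pos ht _)
  have htb : 0 ≤ t ^ b := Real.rpow_nonneg ht.le _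
  have hx := h₁.tendsto_of_norm_deriv_le hb hL hK
  obtain ⟨y1, y2⟩ := defectOf_apply h₁ h₂ h hsum hcomm k hN1 hS hT ht htL' hx
  have hτ : ∀ ξ ∈ Ioo (0 : ℝ) 1, 0 < (1 - ξ) * t ∧ (1 - ξ) * t ≤ t := fun ξ hξ =>
    ⟨mul_pos (sub_pos.2 hξ.2) ht, by nlinarith [hξ.1, hξ.2]⟩
  have hτb : ∀ ξ ∈ Ioo (0 : ℝ) 1, ((1 - ξ) * t) ^ (b - 1) = t ^ b / t * (1 - ξ) ^ (b - 1) :=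
    fun ξ hξ => by
      rw [Real.mul_rpow (sub_nonneg.2 hξ.2.le) ht.le, ← Real.rpow_sub_one ht.ne', mul_comm]
  have hu : ∀ ξ ∈ Ioo (0 : ℝ) 1, ‖S ((1 - ξ) * t) x - x‖ ≤ K * (((1 - ξ) * t) ^ b / b) :=
    fun ξ hξ => h₁.norm_sub_le_rpow hb hK (hτ ξ hξ).1 ((hτ ξ hξ).2.trans htL')
  have hu' : ∀ ξ ∈ Ioo (0 : ℝ) 1, ‖S ((1 - ξ) * t) x - x‖ ≤ K * (t ^ b / b) := fun ξ hξ => by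
    refine (hu ξ hξ).trans ?_
    have := (hτ ξ hξ).1.le
    have := (hτ ξ hξ).2
    gcongr
  have hv' : ∀ ξ ∈ Ioo (0 : ℝ) 1, ‖T ((1 - ξ) * t) (S ((1 - ξ) * t) x - x)‖ ≤
      N * (K * (t ^ b / b)) := fun ξ hξ => by
    refine ((T _).le_opNorm _).trans ?_
    have := hT _ (hτ ξ hξ).1.le ((hτ ξ hξ).2.trans htL')
    have := hu' ξ hξ
    gcongr
  have hSt : ‖phiOf S k t‖ ≤ N :=
    IsAnalyticSemigroup.norm_phiOf_le k ht fun r h0 h1 => hS r h0 (h1.trans htL')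
  have hTt : ‖phiOf T k t‖ ≤ N :=
    IsAnalyticSemigroup.norm_phiOf_le k ht fun r h0 h1 => hT r h0 (h1.trans htL')
  set U := ∫ ξ in (0 : ℝ)..1, (weight k ξ : ℂ) • (S ((1 - ξ) * t) x - x) with hU
  have hUn : ‖U‖ ≤ K * (t ^ b / b) := norm_integral_weight_le k hu'
  set y := defectOf S T P k t x with hy
  constructor
  · rw [y2]
    refine (norm_sub_le _ _).trans ?_
    rw [norm_smul, hcn]
    have g1 := norm_integral_weight_le k hv'
    have g2 : ‖phiOf T k t U‖ ≤ N * (K * (t ^ b / b)) := (ContinuousLinearMap.le_opNorm _ _).trans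
      (by gcongr)
    calc _ ≤ N * (K * (t ^ b / b)) + c * (N * (K * (t ^ b / b))) := by gcongr
      _ = (N / b + c * (N / b)) * K * t ^ b := by ring
      _ ≤ _ := by
        have : 0 ≤ N * N / b + c * (N * (N / b)) +
          N * (N / b / b + c * ((k + 2) * N ^ 2 / b)) := by positivity
        exact mul_le_mul_of_nonneg_right (mul_le_mul_of_nonneg_right (by linarith) hK0) htb
  · intro s hs hst
    have hsL : s ≤ L := hst.trans htL'
    have cS := (h₁.continuousOn_comp ht).clm_apply (continuousOn_const (c := x))
    have cT := (h₂.continuousOn_comp ht).clm_apply (continuousOn_const (c := x))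
    have iST := intervalIntegrable_weight_smul k (C := N * (N * ‖x‖))
      ((h₁.continuousOn_comp ht).clm_apply cT) (fun ξ hξ => by
        have m := hτ ξ hξ
        refine (S _).le_of_opNorm_le_of_le (hS _ m.1.le (m.2.trans htL')) ?_
        exact (T _).le_of_opNorm_le (hT _ m.1.le (m.2.trans htL')) x)
    have iS := intervalIntegrable_weight_smul k (C := N * ‖x‖) cS (fun ξ hξ => by
        have m := hτ ξ hξ
        exact (S _).le_of_opNorm_le (hS _ m.1.le (m.2.trans htL')) x)
    have cu : ContinuousOn (fun ξ => S ((1 - ξ) * t) x - x) (Ioo 0 1) := cS.sub continuousOn_const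
    have iv := intervalIntegrable_weight_smul k ((h₂.continuousOn_comp ht).clm_apply cu) hv'
    -- In the first representation the integrand lies in the range of `S(τ)` and the other term in
    -- `D(A₁)`; `P s - S s * T s` vanishes on both.
    have hPy : P s y = S s (T s y) := by
      have q : (P s - S s * T s) y = 0 := by
        rw [y1, map_sub, map_smul]
        have q1 := clm_integral_weight k (P s - S s * T s) iST (g := fun _ => 0) (fun ξ hξ => by
          have m := (hτ ξ hξ).1
          have := semigroup_apply_range h₁ h₂ h hsum hcomm m hs (T ((1 - ξ) * t) x)
          simp [this])
        have q2 : (P s - S s * T s) (phiOf S k t (phiOf T k t x)) = 0 := by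
          have := semigroup_apply_of_mem h₁ h₂ h hsum hcomm hs (h₁.phiOf_mem k ht (phiOf T k t x))
          simp [this]
        rw [q1, q2]
        simp
      simpa [sub_eq_zero] using q
    rw [deriv_apply_eq h₁ h₂ h hsum hcomm hs hPy]
    have hSs := hS s hs.le hsL
    have hTs := hT s hs.le hsL
    -- Here `s + τ ≤ 2 t ≤ L` is needed. As `b ≤ 1`, the power `r^(b-1)` is nonincreasing, so `s +
    -- τ` may be replaced by `τ`.
    have hS's : ∀ ξ ∈ Ioo (0 : ℝ) 1,
        ‖S' (s + (1 - ξ) * t) x‖ ≤ K * (t ^ b / t) * (1 - ξ) ^ (b - 1) := fun ξ hξ => by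
      have m1 := (hτ ξ hξ).1
      have m2 := (hτ ξ hξ).2
      refine (hK _ (by linarith) (by linarith)).trans ?_
      rw [mul_assoc, ← hτb ξ hξ]
      gcongr 1
      exact Real.rpow_le_rpow_of_nonpos m1 (by linarith) (by linarith)
    -- First representation: commutation moves `S' s` next to `S(τ)`, leaving `S'(s + τ) x` under
    -- bounded operators.
    have p1 : ‖S' s (T s y)‖ ≤ (N * N / b + c * (N * (N / b))) * K * t ^ b / t := by
      have f1 : (S' s * T s) (∫ ξ in (0 : ℝ)..1,
          (weight k ξ : ℂ) • S ((1 - ξ) * t) (T ((1 - ξ) * t) x)) = ∫ ξ in (0 : ℝ)..1,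
            (weight k ξ : ℂ) • T s (T ((1 - ξ) * t) (S' (s + (1 - ξ) * t) x)) :=
        clm_integral_weight k (S' s * T s) iST (fun ξ hξ => by
          have m := (hτ ξ hξ).1
          have c1 := (commute_semigroups h₁ h₂ hcomm m.le m.le).eq
          have c2 := (commute_deriv_left h₁ h₂ hcomm hs m.le).eq
          have c3 := (commute_deriv_left h₁ h₂ hcomm hs hs.le).eq
          have : S' s * T s * (S ((1 - ξ) * t) * T ((1 - ξ) * t)) =
              T s * (T ((1 - ξ) * t) * S' (s + (1 - ξ) * t)) := by
            rw [c1, c3, mul_assoc, ← mul_assoc (S' s), c2, h₁.deriv_add hs m.le, mul_assoc]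
          exact congrArg (· x) this)
      have f2 : (S' s * T s) (phiOf S k t (phiOf T k t x)) = T s (phiOf T k t (∫ ξ in (0 : ℝ)..1,
          (weight k ξ : ℂ) • S' (s + (1 - ξ) * t) x)) := by
        have q := clm_integral_weight k (S' s) iS (g := fun ξ => S' (s + (1 - ξ) * t) x)
          (fun ξ hξ => by
            rw [h₁.deriv_add hs (hτ ξ hξ).1.le]; rfl)
        rw [← h₁.phiOf_apply k ht] at q
        rw [← q]
        have c1 : Commute (phiOf S k t) (phiOf T k t) := h₂.commute_phiOf (fun r hr =>
          (h₁.commute_phiOf (fun s hs => (commute_semigroups h₁ h₂ hcomm hs hr).symm) k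
            ht).symm) k ht
        have c2 : Commute (S' s) (phiOf T k t) :=
          h₂.commute_phiOf (fun r hr => commute_deriv_left h₁ h₂ hcomm hs hr) k ht
        have c3 := (commute_deriv_left h₁ h₂ hcomm hs hs.le).eq
        have : S' s * T s * (phiOf S k t * phiOf T k t) =
            T s * (phiOf T k t * (S' s * phiOf S k t)) := by
          rw [c1.eq, c3, mul_assoc, ← mul_assoc (S' s), c2.eq, mul_assoc]
        exact congrArg (· x) this
      have f3 : S' s (T s y) = (∫ ξ in (0 : ℝ)..1,
            (weight k ξ : ℂ) • T s (T ((1 - ξ) * t) (S' (s + (1 - ξ) * t) x))) -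
          ((k + 1).factorial : ℂ) • T s (phiOf T k t (∫ ξ in (0 : ℝ)..1,
          (weight k ξ : ℂ) • S' (s + (1 - ξ) * t) x)) := by
        rw [← f1, ← f2, ← map_smul, ← map_sub, ← y1]; rfl
      have g1 := norm_integral_weight_le_rpow k hb
        (f := fun ξ => T s (T ((1 - ξ) * t) (S' (s + (1 - ξ) * t) x)))
        (C := N * (N * (K * (t ^ b / t)))) (fun ξ hξ => by
          have m := hτ ξ hξ
          have q := (T s).le_of_opNorm_le_of_le hTs ((T ((1 - ξ) * t)).le_of_opNorm_le_of_le
            (hT _ m.1.le (m.2.trans htL')) (hS's ξ hξ))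
          refine q.trans_eq (by ring))
      have g2 := norm_integral_weight_le_rpow k hb hS's
      have g3 := (T s).le_of_opNorm_le_of_le hTs ((phiOf T k t).le_of_opNorm_le_of_le hTt g2)
      rw [f3]
      refine (norm_sub_le _ _).trans ?_
      rw [norm_smul, hcn]
      calc _ ≤ N * (N * (K * (t ^ b / t))) / b + c * (N * (N * (K * (t ^ b / t) / b))) := by gcongr
        _ = _ := by ring
    -- Second representation: `T'(s + τ) = O(1/τ)` acts on `S(τ) x - x = O(τ^b)`, again of order
    -- `τ^(b-1)`. In the other term `T' s φ(tA₂) = O(1/t)` acts on a vector of size `t^b`.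
    have p2 : ‖S s (T' s y)‖ ≤ N * (N / b / b + c * ((k + 2) * N ^ 2 / b)) * K * t ^ b / t := by
      have f1 := clm_integral_weight k (T' s) iv
        (g := fun ξ => T' (s + (1 - ξ) * t) (S ((1 - ξ) * t) x - x)) (fun ξ hξ => by
          rw [h₂.deriv_add hs (hτ ξ hξ).1.le]; rfl)
      have g1 := norm_integral_weight_le_rpow k hb
        (f := fun ξ => T' (s + (1 - ξ) * t) (S ((1 - ξ) * t) x - x))
        (C := N * K / b * (t ^ b / t)) (fun ξ hξ => by
          have m := hτ ξ hξ
          have q1 : ‖T' (s + (1 - ξ) * t)‖ ≤ N / ((1 - ξ) * t) :=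
            (hT' _ (by linarith) (by linarith)).trans (by
              have := m.1
              gcongr
              linarith)
          refine ((T' _).le_of_opNorm_le_of_le q1 (hu ξ hξ)).trans_eq ?_
          rw [mul_assoc, ← hτb ξ hξ, Real.rpow_sub_one m.1.ne']
          ring)
      have q := h₂.norm_deriv_mul_phiOf_le k hs hsL ht htL' hN1 hT
      have g2 : ‖T' s (phiOf T k t U)‖ ≤ (k + 2) * N ^ 2 / t * (K * (t ^ b / b)) :=
        (T' s * phiOf T k t).le_of_opNorm_le_of_le q hUn
      have g3 : ‖T' s y‖ ≤ N * K / b * (t ^ b / t) / b +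
          c * ((k + 2) * N ^ 2 / t * (K * (t ^ b / b))) := by
        rw [y2, map_sub, f1, map_smul]
        refine (norm_sub_le _ _).trans ?_
        rw [norm_smul, hcn]
        gcongr
      refine ((S s).le_of_opNorm_le_of_le hSs g3).trans_eq ?_
      ring
    refine (norm_add_le _ _).trans ((add_le_add p1 p2).trans ?_)
    rw [← add_div, ← add_mul, ← add_mul]
    have : 0 ≤ N / b + c * (N / b) := by positivity
    exact div_le_div_of_nonneg_right (mul_le_mul_of_nonneg_right
      (mul_le_mul_of_nonneg_right (by linarith) hK0) htb) ht.le

end Defect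

/-! ### Passage to and from the interpolation norms -/

theorem memLp_one_of_norm_le_rpow {f : ℝ → ℝ} (hf : ContinuousOn f (Ioo 0 1)) {t β E N : ℝ}
    (ht : 0 < t) (hβ : 0 < β) (hβ1 : β < 1) (hE : 0 ≤ E) (hN : 0 ≤ N)
    (h1 : ∀ s ∈ Ioo (0 : ℝ) 1, s ≤ t → ‖f s‖ ≤ E / t * s ^ (-β))
    (h2 : ∀ s ∈ Ioo (0 : ℝ) 1, t < s → ‖f s‖ ≤ N * E * s ^ (-β - 1)) :
    MemLp f 1 unitMeasure ∧
      (eLpNorm f 1 unitMeasure).toReal ≤ (1 / (1 - β) + N / β) * t ^ (-β) * E := by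
  have hE' : 0 ≤ E / t := by positivity
  set g₁ : ℝ → ℝ := (Ioc 0 t).indicator fun s => E / t * s ^ (-β) with hg₁
  set g₂ : ℝ → ℝ := (Ioi t).indicator fun s => N * E * s ^ (-β - 1) with hg₂
  have i1 : Integrable g₁ := by
    rw [hg₁, integrable_indicator_iff measurableSet_Ioc]
    refine Integrable.const_mul ?_ _
    exact (intervalIntegrable_iff_integrableOn_Ioc_of_le ht.le).1
      (intervalIntegral.intervalIntegrable_rpow' (by linarith))
  have i2 : Integrable g₂ := by
    rw [hg₂, integrable_indicator_iff measurableSet_Ioi]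
    exact Integrable.const_mul (integrableOn_Ioi_rpow_of_lt (by linarith) ht) _
  have n1 : ∀ s, 0 ≤ g₁ s := fun s => indicator_nonneg (fun s hs => by
    have := Real.rpow_nonneg hs.1.le (-β)
    positivity) s
  have n2 : ∀ s, 0 ≤ g₂ s := fun s => indicator_nonneg (fun s hs => by
    have := Real.rpow_nonneg (ht.trans hs).le (-β - 1)
    positivity) s
  have hfg : ∀ᵐ s ∂unitMeasure, ‖f s‖ ≤ (g₁ + g₂) s :=
    ae_restrict_of_forall_mem measurableSet_Ioo fun s hs => by
      rw [Pi.add_apply]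
      rcases le_or_gt s t with hst | hst
      · have : g₁ s = E / t * s ^ (-β) := indicator_of_mem (show s ∈ Ioc 0 t from ⟨hs.1, hst⟩) _
        linarith [h1 s hs hst, n2 s]
      · have : g₂ s = N * E * s ^ (-β - 1) := indicator_of_mem (show s ∈ Ioi t from hst) _
        linarith [h2 s hs hst, n1 s]
  have hint : Integrable f unitMeasure :=
    Integrable.mono' (i1.add i2).restrict (hf.aestronglyMeasurable measurableSet_Ioo) hfg
  refine ⟨memLp_one_iff_integrable.2 hint, ?_⟩
  rw [eLpNorm_one_eq_lintegral_enorm, ← integral_norm_eq_lintegral_enorm hint.1]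
  have v1 : ∫ s, g₁ s = E / t * (t ^ (1 - β) / (1 - β)) := by
    rw [hg₁, integral_indicator measurableSet_Ioc, integral_const_mul,
      ← intervalIntegral.integral_of_le ht.le, integral_rpow (Or.inl (by linarith)),
      Real.zero_rpow (by linarith), sub_zero, neg_add_eq_sub]
  have v2 : ∫ s, g₂ s = N * E * (t ^ (-β) / β) := by
    rw [hg₂, integral_indicator measurableSet_Ioi, integral_const_mul,
      integral_Ioi_rpow_of_lt (by linarith) ht, sub_add_cancel, neg_div_neg_eq]
  calc ∫ s, ‖f s‖ ∂unitMeasure ≤ ∫ s, (g₁ + g₂) s ∂unitMeasure :=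
        integral_mono_ae hint.norm (i1.add i2).restrict hfg
    _ ≤ ∫ s, (g₁ + g₂) s := setIntegral_le_integral (i1.add i2)
        (Eventually.of_forall fun s => add_nonneg (n1 s) (n2 s))
    _ = E / t * (t ^ (1 - β) / (1 - β)) + N * E * (t ^ (-β) / β) := by
        rw [← v1, ← v2, ← integral_add i1 i2]; rfl
    _ = _ := by
        rw [sub_eq_neg_add, Real.rpow_add_one ht.ne']
        have : 1 - β ≠ 0 := by linarith
        field_simp

section Interp

variable {X : Type*} [NormedAddCommGroup X] [NormedSpace ℂ X]
  {A : X →ₗ.[ℂ] X} {S' : ℝ → X →L[ℂ] X} {μ : ℂ} {R : X →L[ℂ] X}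

theorem IsAnalyticSemigroup.interpFun_eq (h : IsAnalyticSemigroup A (semigroup A) S' μ R)
    (β : ℝ) (p : ℝ≥0∞) (x : X) {s : ℝ} (hs : 0 < s) :
    interpFun A β p x s = s ^ (1 - β - (1 / p).toReal) * ‖S' s x‖ := by
  rw [interpFun, h.app_eq hs, norm_smul, Complex.norm_real, Real.norm_of_nonneg (by positivity)]

/-- Up to time `t` the hypothesis is used, afterwards the analytic bound `N / s`; the integrals of
`s^(-β) / t` over `(0, t)` and of `s^(-β-1)` over `(t, ∞)` are both multiples of `t^(-β)`. -/
theorem IsAnalyticSemigroup.exists_interpNorm_le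
    (h : IsAnalyticSemigroup A (semigroup A) S' μ R) {β L : ℝ} (hβ : 0 ≤ β) (hβ1 : β < 1) :
    ∃ C : ℝ, 0 ≤ C ∧ ∀ t, 0 < t → t ≤ L → ∀ y E, ‖y‖ ≤ E →
      (∀ s, 0 < s → s ≤ t → ‖S' s y‖ ≤ E / t) →
      y ∈ interpSpace A β 1 ∧ interpNorm A β 1 y ≤ C * t ^ (-β) * E := by
  rcases hβ.eq_or_lt with rfl | hβ
  · refine ⟨1, zero_le_one, fun t ht _ y E hy _ => ⟨Or.inl rfl, ?_⟩⟩
    simpa [interpNorm] using hy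
  obtain ⟨N, hN1, -, hN⟩ := h.exists_bound 1
  have hN0 : 0 ≤ N := by linarith
  have hβ' : 0 < 1 - β := by linarith
  -- The summand `max L 0 ^ β` pays for `‖y‖` itself, since `t ≤ L` gives `1 ≤ L^β t^(-β)`.
  refine ⟨max L 0 ^ β + (1 / (1 - β) + N / β), by positivity, fun t ht htL y E hy hE => ?_⟩
  have hE0 : 0 ≤ E := (norm_nonneg y).trans hy
  have hv : ∀ s, 0 < s → interpFun A β 1 y s = s ^ (-β) * ‖S' s y‖ := fun s hs => by
    rw [h.interpFun_eq β 1 y hs]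
    simp
  have hcont : ContinuousOn (interpFun A β 1 y) (Ioo 0 1) := by
    refine ContinuousOn.congr (f := fun s => s ^ (-β) * ‖S' s y‖) ?_ fun s hs => hv s hs.1
    refine ContinuousOn.mul (fun s hs =>
      (Real.continuousAt_rpow_const s _ (Or.inl hs.1.ne')).continuousWithinAt) ?_
    exact ((h.continuousOn_deriv.mono fun s hs => hs.1).clm_apply continuousOn_const).norm
  obtain ⟨m1, m2⟩ := memLp_one_of_norm_le_rpow hcont ht hβ hβ1 hE0 hN0 (fun s hs hst => by
      rw [hv s hs.1, norm_mul, norm_norm, Real.norm_of_nonneg (Real.rpow_nonneg hs.1.le _), mul_comm]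
      exact mul_le_mul_of_nonneg_right (hE s hs.1 hst) (Real.rpow_nonneg hs.1.le _))
    (fun s hs _ => by
      rw [hv s hs.1, norm_mul, norm_norm, Real.norm_of_nonneg (Real.rpow_nonneg hs.1.le _),
        Real.rpow_sub_one hs.1.ne']
      have := (S' s).le_of_opNorm_le_of_le (hN s hs.1 hs.2.le) hy
      calc s ^ (-β) * ‖S' s y‖ ≤ s ^ (-β) * (N / s * E) :=
            mul_le_mul_of_nonneg_left this (Real.rpow_nonneg hs.1.le _)
        _ = _ := by ring)
  refine ⟨Or.inr m1, ?_⟩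
  rw [interpNorm, if_neg hβ.ne', add_mul, add_mul]
  refine add_le_add (hy.trans ?_) m2
  refine le_mul_of_one_le_left hE0 ?_
  rw [Real.rpow_neg ht.le, ← div_eq_mul_inv, one_le_div (Real.rpow_pos_of_pos ht _)]
  exact Real.rpow_le_rpow ht.le (htL.trans (le_max_left _ _)) hβ.le

/-- An essential supremum on `(0, 1)` controls every `r ≤ L`: almost every time obeys the bound, so
some `s` slightly below `min r 1` does, and `S' r = S (r - s) * S' s` carries it to `r`. The choice
`s ≥ r / (2 L)` keeps the powers of `s` and `r` comparable. -/
theorem IsAnalyticSemigroup.exists_norm_deriv_le_interpNorm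
    (h : IsAnalyticSemigroup A (semigroup A) S' μ R) {β L : ℝ} (hβ : 0 < β) (hβ1 : β < 1)
    (hL : 1 ≤ L) :
    ∃ C : ℝ, 0 ≤ C ∧ ∀ x ∈ interpSpace A β ⊤, ∀ r, 0 < r → r ≤ L →
      ‖S' r x‖ ≤ C * interpNorm A β ⊤ x * r ^ (β - 1) := by
  obtain ⟨N, hN1, hN, -⟩ := h.exists_bound L
  refine ⟨N * (2 * L) ^ (1 - β), by positivity, fun x hx r hr hrL => ?_⟩
  have hx : MemLp (interpFun A β ⊤ x) ⊤ unitMeasure := hx.resolve_left hβ.ne'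
  set M := (eLpNorm (interpFun A β ⊤ x) ⊤ unitMeasure).toReal with hM
  have hM0 : 0 ≤ M := ENNReal.toReal_nonneg
  have hMn : M ≤ interpNorm A β ⊤ x := by
    rw [interpNorm, if_neg hβ.ne']
    linarith [norm_nonneg x]
  have hae : ∀ᵐ s ∂unitMeasure, interpFun A β ⊤ x s ≤ M := by
    filter_upwards [enorm_ae_le_eLpNormEssSup (interpFun A β ⊤ x) unitMeasure] with s hs
    rw [← eLpNorm_exponent_top] at hs
    have := ENNReal.toReal_mono hx.2.ne hs
    rw [toReal_enorm] at this
    exact (le_abs_self _).trans this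
  set m := min r 1 with hm
  have hm0 : 0 < m := lt_min hr one_pos
  have hmL : r / L ≤ m := le_min (div_le_self hr.le hL) ((div_le_one (by linarith)).2 hrL)
  obtain ⟨s, ⟨hs1, hs2⟩, hs⟩ : ∃ s ∈ Ioo (m / 2) m, interpFun A β ⊤ x s ≤ M := by
    have h1 : ∀ᵐ s ∂volume.restrict (Ioo (m / 2) m), interpFun A β ⊤ x s ≤ M :=
      ae_mono (Measure.restrict_mono (Ioo_subset_Ioo (by positivity) (min_le_right _ _)) le_rfl) hae
    have h2 : ∀ᵐ s ∂volume.restrict (Ioo (m / 2) m), s ∈ Ioo (m / 2) m :=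
      ae_restrict_mem measurableSet_Ioo
    have : (ae (volume.restrict (Ioo (m / 2) m))).NeBot := by
      rw [ae_neBot, Ne, Measure.restrict_eq_zero, Real.volume_Ioo, ENNReal.ofReal_eq_zero]
      linarith
    exact (h2.and h1).exists
  have hs0 : 0 < s := by linarith
  have hsr : s ≤ r := hs2.le.trans (min_le_left _ _)
  rw [h.interpFun_eq β ⊤ x hs0] at hs
  simp only [one_div, ENNReal.inv_top, ENNReal.toReal_zero, sub_zero] at hs
  have e : S' r = semigroup A (r - s) * S' s := by
    rw [← h.deriv_add' (sub_nonneg.2 hsr) hs0, sub_add_cancel]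
  have h3 : ‖S' s x‖ ≤ M * (2 * L) ^ (1 - β) * r ^ (β - 1) := by
    have q1 : r / (2 * L) ≤ s := by
      have : r / (2 * L) = r / L / 2 := by field_simp
      linarith
    have q2 : (r / (2 * L)) ^ (1 - β) ≤ s ^ (1 - β) :=
      Real.rpow_le_rpow (by positivity) q1 (by linarith)
    have q3 : (r / (2 * L)) ^ (1 - β) * ‖S' s x‖ ≤ M :=
      (mul_le_mul_of_nonneg_right q2 (norm_nonneg _)).trans hs
    rw [Real.div_rpow hr.le (by positivity)] at q3
    have r1 : 0 < r ^ (1 - β) := Real.rpow_pos_of_pos hr _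
    have r2 : 0 < (2 * L) ^ (1 - β) := Real.rpow_pos_of_pos (by linarith) _
    rw [show β - 1 = -(1 - β) by ring, Real.rpow_neg hr.le, ← div_eq_mul_inv, le_div_iff₀ r1]
    rwa [div_mul_eq_mul_div, div_le_iff₀ r2, mul_comm] at q3
  rw [e]
  calc ‖semigroup A (r - s) (S' s x)‖ ≤ N * (M * (2 * L) ^ (1 - β) * r ^ (β - 1)) :=
        (semigroup A (r - s)).le_of_opNorm_le_of_le
          (hN _ (sub_nonneg.2 hsr) (by linarith)) h3
    _ = N * (2 * L) ^ (1 - β) * M * r ^ (β - 1) := by ring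
    _ ≤ _ := by gcongr

end Interp

end SplitPhi

/-! ### The main theorem -/

theorem mainTheorem8 {X : Type*} [NormedAddCommGroup X] [NormedSpace ℂ X] [CompleteSpace X]
    (A₁ A₂ A : X →ₗ.[ℂ] X)
    (hA₁ : SplitPhi.IsSectorial A₁) (hA₂ : SplitPhi.IsSectorial A₂) (hA : SplitPhi.IsSectorial A)
    (hsum : A₁ + A₂ ≤ A)
    (hcomm : ∀ t : ℝ, 0 ≤ t →
      SplitPhi.semigroup A₁ t ∘L SplitPhi.semigroup A₂ t =
        SplitPhi.semigroup A₂ t ∘L SplitPhi.semigroup A₁ t)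
    (k : ℕ) (hk : 1 ≤ k) (T : ℝ) (hT : 0 < T) :
    (∀ β₁ β₂ : ℝ, 0 ≤ β₁ → β₁ < 1 → 0 ≤ β₂ → β₂ < 1 →
      ∃ C : ℝ, ∀ t : ℝ, 0 < t → t ≤ T →
        ∀ x ∈ SplitPhi.interpSpace A₁ β₁ ⊤,
          SplitPhi.defect A₁ A₂ A k t x ∈ SplitPhi.interpSpace A β₂ 1 ∧
          SplitPhi.interpNorm A β₂ 1 (SplitPhi.defect A₁ A₂ A k t x) ≤
            C * t ^ (β₁ - β₂) * SplitPhi.interpNorm A₁ β₁ ⊤ x) ∧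
    (∀ β₂ : ℝ, 0 ≤ β₂ → β₂ < 1 →
      ∃ C : ℝ, ∀ t : ℝ, 0 < t → t ≤ T →
        ∀ x : A₁.domain,
          SplitPhi.defect A₁ A₂ A k t x ∈ SplitPhi.interpSpace A β₂ 1 ∧
          SplitPhi.interpNorm A β₂ 1 (SplitPhi.defect A₁ A₂ A k t x) ≤
            C * t ^ (1 - β₂) * (‖(x : X)‖ + ‖A₁ x‖)) := by
  open SplitPhi in
  obtain ⟨S', μ₁, R₁, h₁⟩ := hA₁.exists_isAnalyticSemigroup
  obtain ⟨T', μ₂, R₂, h₂⟩ := hA₂.exists_isAnalyticSemigroup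
  obtain ⟨P', μ, R, h⟩ := hA.exists_isAnalyticSemigroup
  have hcomm' : ∀ t, 0 ≤ t → Commute (semigroup A₁ t) (semigroup A₂ t) := hcomm
  obtain ⟨k, rfl⟩ : ∃ j, k = j + 1 := ⟨k - 1, by omega⟩
  have hdef : ∀ t, defect A₁ A₂ A (k + 1) t =
    defectOf (semigroup A₁) (semigroup A₂) (semigroup A) k t := fun _ => rfl
  simp only [hdef]
  -- `2 * T` covers the times `s + (1 - ξ) t ≤ 2 t`; the extra `1` ensures `1 ≤ L`, as needed to
  -- reach all of `(0, L]` from the interpolation norm on `(0, 1)`.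
  set L := 2 * T + 1 with hL
  obtain ⟨N₁, hN₁, hS, -⟩ := h₁.exists_bound L
  obtain ⟨N₂, hN₂, hT₂, hT₂'⟩ := h₂.exists_bound L
  obtain ⟨N₃, hN₃, hP, -⟩ := h.exists_bound L
  set N := N₁ + N₂ + N₃ with hN
  have hN1 : 1 ≤ N := by linarith
  replace hS : ∀ r, 0 ≤ r → r ≤ L → ‖semigroup A₁ r‖ ≤ N := fun r h0 hr => by linarith [hS r h0 hr]
  replace hT₂ : ∀ r, 0 ≤ r → r ≤ L → ‖semigroup A₂ r‖ ≤ N := fun r h0 hr => by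
    linarith [hT₂ r h0 hr]
  replace hP : ∀ r, 0 ≤ r → r ≤ L → ‖semigroup A r‖ ≤ N := fun r h0 hr => by linarith [hP r h0 hr]
  replace hT₂' : ∀ r, 0 < r → r ≤ L → ‖T' r‖ ≤ N / r := fun r h0 hr =>
    (hT₂' r h0 hr).trans (div_le_div_of_nonneg_right (by linarith) h0.le)
  refine ⟨fun β₁ β₂ hβ₁ hβ₁1 hβ₂ hβ₂1 => ?_, fun β₂ hβ₂ hβ₂1 => ?_⟩
  · obtain ⟨C, hC0, hC⟩ := h.exists_interpNorm_le (L := T) hβ₂ hβ₂1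
    rcases hβ₁.eq_or_lt with rfl | hβ₁
    · obtain ⟨D, hD0, hD⟩ := norm_defectOf_le_rough h₁ h₂ h hsum hcomm' k hN1 hS hT₂ hP
      refine ⟨C * D, fun t ht htT x _ => ?_⟩
      obtain ⟨d1, d2⟩ := hD t ht (by linarith) x
      obtain ⟨m1, m2⟩ := hC t ht htT _ _ d1 d2
      refine ⟨m1, m2.trans_eq ?_⟩
      rw [interpNorm, if_pos rfl, zero_sub]
      ring
    · obtain ⟨D, hD0, hD⟩ := norm_defectOf_le_smooth h₁ h₂ h hsum hcomm' k hβ₁ hβ₁1.le hN1 hS hT₂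
        hT₂'
      obtain ⟨B, hB0, hB⟩ := h₁.exists_norm_deriv_le_interpNorm hβ₁ hβ₁1 (L := L) (by linarith)
      refine ⟨C * D * B, fun t ht htT x hx => ?_⟩
      obtain ⟨d1, d2⟩ := hD t ht (by linarith) x _ (hB x hx)
      obtain ⟨m1, m2⟩ := hC t ht htT _ _ d1 d2
      refine ⟨m1, m2.trans_eq ?_⟩
      rw [sub_eq_add_neg β₁, Real.rpow_add ht]
      ring
  · obtain ⟨C, hC0, hC⟩ := h.exists_interpNorm_le (L := T) hβ₂ hβ₂1
    -- On `D(A₁)` the derivative `S' r x = S r (A₁ x)` is bounded, which is the case `b = 1` with `K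
    -- = N ‖A₁ x‖`.
    obtain ⟨D, hD0, hD⟩ := norm_defectOf_le_smooth h₁ h₂ h hsum hcomm' k one_pos le_rfl hN1 hS hT₂
      hT₂'
    refine ⟨C * D * N, fun t ht htT x => ?_⟩
    obtain ⟨d1, d2⟩ := hD t ht (by linarith) x (N * ‖A₁ x‖) fun r h0 hr => by
      rw [h₁.deriv_apply_of_mem h0, sub_self, Real.rpow_zero, mul_one]
      exact (semigroup A₁ r).le_of_opNorm_le (hS r h0.le hr) _
    obtain ⟨m1, m2⟩ := hC t ht htT _ _ d1 d2
    refine ⟨m1, m2.trans ?_⟩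
    rw [sub_eq_add_neg (1 : ℝ), Real.rpow_add ht]
    have := norm_nonneg (x : X)
    calc _ = C * D * N * (t ^ (1 : ℝ) * t ^ (-β₂)) * ‖A₁ x‖ := by ring
      _ ≤ _ := by gcongr; linarith

end
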